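/- **Setting.** Let $\Gamma$ be a compact connected metric graph (finitely many vertices $\mathcal V$ and edges $\mathcal E\neq\emptyset$; each edge $e$ is identified with $[0,\ell_e]$, $0<\ell_e<\infty$; loops and multiple edges are allowed) with its geodesic distance $d$. Let $L_2(\Gamma)=\bigoplus_{e}L_2(e)$, and let $L$ act on each edge by $L\varphi=-(a\varphi')'+\kappa^2\varphi$, with domain the functions $\varphi$ that are continuous on $\Gamma$, belong to $H^2(e)$ on every edge, and whose derivatives along the incident edges in the direction away from $v$ sum to zero at each vertex $v$. Here $\kappa$ is measurable and essentially bounded with $\operatorname{ess\,inf}\kappa>0$, and $a$ is a positive Lipschitz function on $\Gamma$. Let $\alpha\ge 1$ be an integer; if $\alpha\ge 3$, assume moreover that on every edge $\kappa\in C^{\alpha-3,1}$ and $a\in C^{\alpha-2,1}$. Let $(\Omega,\mathcal F,\mathbb P)$ be a complete probability space and $\mathcal W$ Gaussian white noise on $L_2(\Gamma)$, i.e. a family of centered Gaussian variables with $\mathbb E[\mathcal W(f)\mathcal W(g)]=(f,g)_{L_2(\Gamma)}$. Let $u$ be the generalized Whittle–Matérn field solving $L^{\alpha/2}u=\mathcal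 W$: an $L_2(\Gamma)$-valued random variable with finite second moment such that $(u,L^{\alpha/2}\varphi)_{L_2(\Gamma)}=\mathcal W(\varphi)$ a.s. for all $\varphi\in D(L^{\alpha/2})$ (powers in the spectral sense), with point evaluations $u(s)$, $s\in\Gamma$, taken from its $L_2(\Omega)$-continuous representative. For $t\in[0,\ell_e]$ put $u_e(t)=u(s)$, where $s$ is the point of $\Gamma$ at position $t$ of $e$. **Notation.** Generated $\sigma$-algebras are understood to contain all $\mathbb P$-null sets. For $A\subset\Gamma$ and $\varepsilon>0$ let $A_\varepsilon=\{s:\exists z\in A,\ d(s,z)<\varepsilon\}$, let $H(A)$ be the closed linear span of $\{u(s):s\in A\}$ in $L_2(\Omega)$, $\mathcal F(A)=\sigma(u(s):s\in A)$, $H_+(A)=\bigcap_{\varepsilon>0}H(A_\varepsilon)$ and $\mathcal F_+(A)=\bigcap_{\varepsilon>0}\mathcal F(A_\varepsilon)$. A function $v:[0,\ell_e]\to H(\Gamma)$ has weak derivative $v'(t)\in H(\Gamma)$ at $t$, in the $L_2(\Omega)$ sense, if $\mathbb E\big[w\,\tfrac{v(t')-v(t)}{t'-t}\big]\to\mathbb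 E[w\,v'(t)]$ as $t'\to t$ in $[0,\ell_e]\setminus\{t\}$ for every $w\in H(\Gamma)$; $u_e^{(k)}$ denotes the $k$-fold iterated weak derivative of $u_e$. The field is differentiable of order $p$ if it is continuous in $L_2(\Omega)$, the $u_e^{(k)}$, $k\le p$, exist everywhere on every closed edge, and $t\mapsto\mathbb E[w\,u_e^{(k)}(t)]$ is continuous on $[0,\ell_e]$ for all $w\in H(\Gamma)$, $k\le p$ and $e$. For $B\subset\Gamma$ let $H_\alpha(B)$ and $\mathcal F_\alpha(B)$ be the linear span of, and the $\sigma$-algebra generated by, all $u_e^{(k)}(t)$ with $0\le k\le\alpha-1$ and $(e,t)$ any edge position representing a point of $B$ (so a vertex in $B$ contributes once for every incident edge end). **Theorem.** 1. For every open $S\subset\Gamma$ whose boundary $\partial S$ is finite, $H_+(\partial S)=H_\alpha(\partial S)$ and $\mathcal F_+(\partial S)=\mathcal F_\alpha(\partial S)$. 2. $u$ is Markov of order $\alpha$: it is differentiable of order $\alpha-1$ and, for every open $S\subset\Gamma$, the $\sigma$-algebras $\mathcal F_+(\overline S)$ and $\mathcal F_+(\Gamma\setminus S)$ are conditionally independent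 given $\mathcal F_\alpha(\partial S)$. -/

import Mathlib

open MeasureTheory ProbabilityTheory Set Filter Topology
open scoped ENNReal NNReal

noncomputable section

/-! ### Compact metric graphs -/

/-- A compact metric graph: finitely many vertices `V`, finitely many (and at least one) edges `E`,
each edge `e` being a segment `[0, len e]` of positive finite length joining `src e` (parameter `0`)
to `tgt e` (parameter `len e`). Loops and multiple edges are allowed; the graph is connected. -/
structure MetricGraph (V E : Type*) [Fintype V] [Fintype E] where
  len : E → ℝ
  len_pos : ∀ e, 0 < len e
  src : E → V
  tgt : E → V
  nonempty_edges : Nonempty E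
  connected : ∀ v w : V, Relation.EqvGen (fun x y => ∃ e, src e = x ∧ tgt e = y) v w

namespace MetricGraph

variable {V E : Type*} [Fintype V] [Fintype E] (G : MetricGraph V E)

/-- Positions `(t, e)` on the edges, before the end points of the edges are glued. -/
abbrev Loc : Type _ := Σ e : E, Icc (0 : ℝ) (G.len e)

/-- The position `x` is an end point of its edge, located at the vertex `v`. -/
def AtVertex (x : G.Loc) (v : V) : Prop :=
  ((x.2 : ℝ) = 0 ∧ G.src x.1 = v) ∨ ((x.2 : ℝ) = G.len x.1 ∧ G.tgt x.1 = v)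

theorem AtVertex.unique {x : G.Loc} {v w : V} (hv : G.AtVertex x v) (hw : G.AtVertex x w) :
    v = w := by
  have hl := G.len_pos x.1
  rcases hv with ⟨h1, h2⟩ | ⟨h1, h2⟩ <;> rcases hw with ⟨h3, h4⟩ | ⟨h3, h4⟩
  · exact h2.symm.trans h4
  · exact absurd (h1.symm.trans h3) hl.ne
  · exact absurd (h3.symm.trans h1) hl.ne
  · exact h2.symm.trans h4

/-- Two positions are identified if they are equal or are end points located at one vertex. -/
def glue : Setoid G.Loc where
  r x y := x = y ∨ ∃ v, G.AtVertex x v ∧ G.AtVertex y v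
  iseqv :=
    { refl := fun _ => Or.inl rfl
      symm := by
        rintro x y (h | ⟨v, hx, hy⟩)
        · exact Or.inl h.symm
        · exact Or.inr ⟨v, hy, hx⟩
      trans := by
        rintro x y z (rfl | ⟨v, hx, hy⟩) (rfl | ⟨w, hy', hz⟩)
        · exact Or.inl rfl
        · exact Or.inr ⟨w, hy', hz⟩
        · exact Or.inr ⟨v, hx, hy⟩
        · exact Or.inr ⟨v, hx, (AtVertex.unique G hy' hy) ▸ hz⟩ }

/-- The set `Γ` of points of the graph. -/
def Point : Type _ := Quotient G.glue

/-- The point of `Γ` at parameter `t` of the edge `e`, for `t ∈ [0, len e]`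
(other values of `t` are clamped to this interval and play no role). -/
def pt (e : E) (t : ℝ) : G.Point :=
  Quotient.mk G.glue ⟨e, projIcc 0 (G.len e) (G.len_pos e).le t⟩

/-- `G.PathLength p q r`: some path from `p` to `q`, made of finitely many consecutive segments each
contained in one edge, has length `r`. -/
inductive PathLength : G.Point → G.Point → ℝ≥0∞ → Prop
  | refl (p : G.Point) : PathLength p p 0
  | cons (e : E) (s t : ℝ) (hs : s ∈ Icc 0 (G.len e)) (ht : t ∈ Icc 0 (G.len e))
      (q : G.Point) (r : ℝ≥0∞) (h : PathLength (G.pt e t) q r) :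
      PathLength (G.pt e s) q (ENNReal.ofReal |s - t| + r)

theorem PathLength.append {p q z : G.Point} {r r' : ℝ≥0∞} (h : G.PathLength p q r)
    (h' : G.PathLength q z r') : G.PathLength p z (r + r') := by
  induction h with
  | refl p => simpa using h'
  | cons e s t hs ht q r h ih =>
    rw [add_assoc]
    exact PathLength.cons e s t hs ht z _ (ih h')

theorem PathLength.reverse {p q : G.Point} {r : ℝ≥0∞} (h : G.PathLength p q r) :
    G.PathLength q p r := by
  induction h with
  | refl p => exact PathLength.refl p
  | cons e s t hs ht q r h ih =>
    have h1 : G.PathLength (G.pt e t) (G.pt e s) (ENNReal.ofReal |t - s| + 0) :=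
      PathLength.cons e t s ht hs _ 0 (PathLength.refl _)
    have h2 := PathLength.append G ih h1
    rwa [add_zero, add_comm, abs_sub_comm] at h2

/-- The geodesic distance: the infimum of the lengths of the paths joining two points. -/
def geoDist (p q : G.Point) : ℝ≥0∞ := sInf {r | G.PathLength p q r}

/-- `Γ` with its geodesic distance and the induced topology. -/
instance : PseudoEMetricSpace G.Point where
  edist := G.geoDist
  edist_self p := le_antisymm (sInf_le (PathLength.refl p)) zero_le
  edist_comm p q := by
    have h : ∀ p q, G.geoDist p q ≤ G.geoDist q p := fun p q =>
      le_sInf fun r hr => sInf_le (PathLength.reverse G hr)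
    exact le_antisymm (h p q) (h q p)
  edist_triangle p q z := by
    unfold geoDist
    rw [ENNReal.sInf_add]
    refine le_iInf₂ fun r hr => ?_
    rw [add_comm, ENNReal.sInf_add]
    refine le_iInf₂ fun r' hr' => ?_
    rw [add_comm]
    exact sInf_le (PathLength.append G hr hr')

/-! ### Function spaces and the operator `L` -/

/-- Lebesgue measure on the edge `e`, identified with `[0, len e]`. -/
abbrev edgeMeasure (e : E) : Measure ℝ := volume.restrict (Icc 0 (G.len e))

/-- `L₂(Γ)`, the Hilbert direct sum of the spaces `L₂(e)`. -/
abbrev L2 : Type _ := PiLp 2 (fun e : E => Lp ℝ 2 (G.edgeMeasure e))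

/-- `g` is the weak derivative of `f` on the open interval `(0, ℓ)`, both being square integrable:
`∫ f φ' = - ∫ g φ` for all smooth `φ` compactly supported in `(0, ℓ)`. -/
def IsWeakDeriv (ℓ : ℝ) (f g : ℝ → ℝ) : Prop :=
  MemLp f 2 (volume.restrict (Icc 0 ℓ)) ∧ MemLp g 2 (volume.restrict (Icc 0 ℓ)) ∧
  ∀ φ : ℝ → ℝ, ContDiff ℝ (⊤ : ℕ∞) φ → HasCompactSupport φ → tsupport φ ⊆ Ioo 0 ℓ →
    ∫ t in Icc 0 ℓ, f t * deriv φ t = -∫ t in Icc 0 ℓ, g t * φ t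

open scoped Classical in
/-- The graph of the operator `L`: `φ ∈ D(L)` and `L φ = ψ`, where on every edge
`L φ = - (a φ')' + κ² φ` and `D(L)` consists of the `φ` that are in `H²` on every edge, continuous
on `Γ`, and whose outward derivatives along the incident edges sum to zero at every vertex.
`F` is the continuous representative of `φ`, `f' e` the continuous representative of its
derivative on `e`, and `q e` is the weak derivative of `a φ'` on `e`. -/
def LGraph (κ a : G.Point → ℝ) (φ ψ : G.L2) : Prop :=
  ∃ (F : G.Point → ℝ) (f' f'' q : E → ℝ → ℝ),
    Continuous F ∧
    (∀ e, ⇑(φ e) =ᵐ[G.edgeMeasure e] fun t => F (G.pt e t)) ∧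
    (∀ e, IsWeakDeriv (G.len e) (fun t => F (G.pt e t)) (f' e)) ∧
    (∀ e, ContinuousOn (f' e) (Icc 0 (G.len e))) ∧
    (∀ e, IsWeakDeriv (G.len e) (f' e) (f'' e)) ∧
    (∀ v, ∑ e, ((if G.src e = v then f' e 0 else 0) +
        (if G.tgt e = v then -f' e (G.len e) else 0)) = 0) ∧
    (∀ e, IsWeakDeriv (G.len e) (fun t => a (G.pt e t) * f' e t) (q e)) ∧
    (∀ e, ⇑(ψ e) =ᵐ[G.edgeMeasure e] fun t => -q e t + κ (G.pt e t) ^ 2 * F (G.pt e t))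

/-- `φ ∈ D(L ^ s)` and `L ^ s φ = ψ` in the spectral sense: along every eigenvector `η` of `L`, with
eigenvalue `lam`, the coefficient of `ψ` is `lam ^ s` times that of `φ`. As `L` has a complete
orthonormal system of eigenvectors `e_k` with eigenvalues `lam_k > 0`, this says that
`ψ = ∑ k, lam_k ^ s (φ, e_k) e_k`, the series being convergent in `L₂(Γ)`. -/
def LPowGraph (κ a : G.Point → ℝ) (s : ℝ) (φ ψ : G.L2) : Prop :=
  ∀ (lam : ℝ) (η : G.L2), η ≠ 0 → G.LGraph κ a η (lam • η) →
    inner ℝ ψ η = lam ^ s * inner ℝ φ η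

/-! ### Assumptions on the coefficients -/

/-- `κ` is bounded with `ess inf κ ≥ κ₀ > 0`, and `a` is a positive Lipschitz function on `Γ`. -/
structure BasicAssumption (κ a : G.Point → ℝ) : Prop where
  kappa_meas : ∀ e, AEStronglyMeasurable (fun t => κ (G.pt e t)) (G.edgeMeasure e)
  kappa_bdd : ∃ C : ℝ, ∀ e, ∀ᵐ t ∂(G.edgeMeasure e), |κ (G.pt e t)| ≤ C
  kappa_pos : ∃ κ₀ : ℝ, 0 < κ₀ ∧ ∀ e, ∀ᵐ t ∂(G.edgeMeasure e), κ₀ ≤ κ (G.pt e t)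
  a_pos : ∀ s, 0 < a s
  a_lip : ∃ K : ℝ≥0, LipschitzWith K a

/-- `f ∈ C^{k,1}` on the edge `[0, ℓ]`, expressed in the open edge: a `C^k` function on `(0, ℓ)` with
Lipschitz `k`-th derivative is the restriction of a unique `C^{k,1}` function on `[0, ℓ]`. -/
def IsCkLip (k : ℕ) (ℓ : ℝ) (f : ℝ → ℝ) : Prop :=
  ContDiffOn ℝ k f (Ioo 0 ℓ) ∧ ∃ K : ℝ≥0, LipschitzOnWith K (iteratedDeriv k f) (Ioo 0 ℓ)

/-- The assumption on the coefficients for the exponent `α`: if `α ≥ 3` then, on every edge,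
`κ ∈ C^{⌊α⌋-3,1}` and `a ∈ C^{⌊α⌋-2,1}`. -/
structure CoeffAssumption (κ a : G.Point → ℝ) (α : ℝ) : Prop where
  basic : G.BasicAssumption κ a
  kappa_reg : 3 ≤ α → ∀ e, IsCkLip (⌊α⌋₊ - 3) (G.len e) (fun t => κ (G.pt e t))
  a_reg : 3 ≤ α → ∀ e, IsCkLip (⌊α⌋₊ - 2) (G.len e) (fun t => a (G.pt e t))

end MetricGraph

/-! ### Random fields on a metric graph -/

variable {V E : Type*} [Fintype V] [Fintype E] {G : MetricGraph V E}
  {Ω : Type*} [mΩ : MeasurableSpace Ω] {μ : Measure Ω}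

/-- Gaussian white noise on `L₂(Γ)`: centered Gaussian variables with
`E[W(h) W(g)] = (h, g)` (such a family is automatically a.s. linear and jointly Gaussian). -/
structure IsWhiteNoise (G : MetricGraph V E) (μ : Measure Ω) (W : G.L2 → Ω → ℝ) : Prop where
  gaussian : ∀ h, HasGaussianLaw (W h) μ
  centered : ∀ h, ∫ x, W h x ∂μ = 0
  covariance : ∀ h g, ∫ x, W h x * W g x ∂μ = inner ℝ h g

/-- A random field on `Γ` with finite second moments. -/
structure RandomField (G : MetricGraph V E) (μ : Measure Ω) where
  val : G.Point → Ω → ℝ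
  memLp : ∀ s, MemLp (val s) 2 μ

namespace RandomField

variable (u : RandomField G μ)

/-- `u(s)` as an element of the Hilbert space `L₂(Ω)`. -/
def toL2 (s : G.Point) : Lp ℝ 2 μ := (u.memLp s).toLp (u.val s)

/-- `u` is the generalized Whittle--Matérn field with exponent `α` and coefficients `κ, a`:
it is the solution of `L ^ (α / 2) u = W`, that is, an `L₂(Γ)`-valued random variable `U` with finite
second moment such that `(U, L ^ (α / 2) φ) = W(φ)` a.s. for all `φ ∈ D(L ^ (α / 2))`. Point
evaluations `u(s)` refer to the `L₂(Ω)`-continuous representative of `U`: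
`s ↦ u(s) ∈ L₂(Ω)` is continuous, and `(U, f) = ∫ f(s) u(s) ds` in `L₂(Ω)` for all `f ∈ L₂(Γ)`. -/
structure IsWhittleMatern (κ a : G.Point → ℝ) (α : ℝ) (W : G.L2 → Ω → ℝ) : Prop where
  continuous : Continuous u.toL2
  solution : ∃ U : Ω → G.L2, MemLp U 2 μ ∧
    (∀ f : G.L2, (fun x => inner ℝ (U x) f) =ᵐ[μ]
      ⇑(∑ e, ∫ t in Icc 0 (G.len e), ((f e : ℝ → ℝ) t) • u.toL2 (G.pt e t))) ∧
    (∀ φ ψ : G.L2, G.LPowGraph κ a (α / 2) φ ψ → (fun x => inner ℝ (U x) ψ) =ᵐ[μ] W φ)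

/-! #### Gaussian spaces and σ-algebras -/

/-- `H(S)`, the closed linear span of `u(s)`, `s ∈ S`, in `L₂(Ω)`. -/
def gaussSpace (S : Set G.Point) : Submodule ℝ (Lp ℝ 2 μ) :=
  (Submodule.span ℝ (u.toL2 '' S)).topologicalClosure

/-- `H₊(S)`, the intersection over `ε > 0` of `H(S_ε)`, where `S_ε` is the `ε`-neighbourhood. -/
def germSpace (S : Set G.Point) : Submodule ℝ (Lp ℝ 2 μ) :=
  ⨅ (ε : ℝ) (_ : 0 < ε), u.gaussSpace (Metric.thickening ε S)

/-- The σ-algebra generated by the random variables `X i` and all null sets. -/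
@[reducible]
def sigmaGen (μ : Measure Ω) {ι : Type*} (X : ι → Ω → ℝ) : MeasurableSpace Ω :=
  (⨆ i, MeasurableSpace.comap (X i) (borel ℝ)) ⊔ MeasurableSpace.generateFrom {A | μ A = 0}

/-- `𝓕(S) = σ(u(s) : s ∈ S)`. -/
@[reducible]
def sigmaAlg (S : Set G.Point) : MeasurableSpace Ω :=
  sigmaGen μ (fun s : S => u.val s)

/-- `𝓕₊(S)`, the intersection over `ε > 0` of `𝓕(S_ε)`. -/
@[reducible]
def germSigmaAlg (S : Set G.Point) : MeasurableSpace Ω :=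
  ⨅ (ε : ℝ) (_ : 0 < ε), u.sigmaAlg (Metric.thickening ε S)

/-! #### Weak derivatives in the `L₂(Ω)` sense -/

/-- `d ∈ H(Γ)` is the weak derivative in the `L₂(Ω)` sense, at the parameter `t` of the edge `e`, of
the function `v` defined on `[0, len e]`. At the end points of the edge it is one-sided. -/
def HasWeakDerivAt (e : E) (v : ℝ → Lp ℝ 2 μ) (d : Lp ℝ 2 μ) (t : ℝ) : Prop :=
  d ∈ u.gaussSpace univ ∧ ∀ w ∈ u.gaussSpace univ,
    Tendsto (fun t' => inner ℝ w ((t' - t)⁻¹ • (v t' - v t)))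
      (𝓝[Icc 0 (G.len e) \ {t}] t) (𝓝 (inner ℝ w d))

open scoped Classical in
/-- The `k`-th weak derivative `u_e^{(k)}(t)` in the `L₂(Ω)` sense, for `t ∈ [0, len e]`
(`0` where it does not exist; where it exists it is unique). -/
def iterWeakDeriv (e : E) : ℕ → ℝ → Lp ℝ 2 μ
  | 0, t => u.toL2 (G.pt e t)
  | k + 1, t =>
    if h : ∃ d, u.HasWeakDerivAt e (iterWeakDeriv e k) d t then h.choose else 0

/-- `u` is differentiable of order `p`: it is continuous in `L₂(Ω)`, it has weak derivatives in the
`L₂(Ω)` sense of orders `1, …, p` on every (closed) edge, and `u_e^{(j)}` is weakly continuous on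
every edge for `j = 0, …, p`. -/
def IsDifferentiable (p : ℕ) : Prop :=
  Continuous u.toL2 ∧
  (∀ k < p, ∀ e, ∀ t ∈ Icc 0 (G.len e),
    u.HasWeakDerivAt e (u.iterWeakDeriv e k) (u.iterWeakDeriv e (k + 1) t) t) ∧
  (∀ j ≤ p, ∀ e, ∀ w ∈ u.gaussSpace univ,
    ContinuousOn (fun t => (inner ℝ w (u.iterWeakDeriv e j t) : ℝ)) (Icc 0 (G.len e)))

/-- Indices `(e, t, k)` of the boundary data on a set `B ⊆ Γ` up to order `α - 1`: `t` runs through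
the parameters in `[0, len e]` of the points of `B` on `e`, and `k < α`. A vertex in `B` contributes
once for every end of an edge attached to it. -/
def DataIndex (G : MetricGraph V E) (α : ℕ) (B : Set G.Point) : Type _ :=
  {i : E × ℝ × ℕ // i.2.1 ∈ Icc 0 (G.len i.1) ∧ G.pt i.1 i.2.1 ∈ B ∧ i.2.2 < α}

/-- The boundary datum `u_e^{(k)}(t)`. -/
def data (α : ℕ) (B : Set G.Point) (i : DataIndex G α B) : Lp ℝ 2 μ :=
  u.iterWeakDeriv i.1.1 i.1.2.2 i.1.2.1

/-- `H_α(B) = span {u_e(s), u_e'(s), …, u_e^{(α-1)}(s) : s ∈ B, e incident to s}`. -/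
def dataSpace (α : ℕ) (B : Set G.Point) : Submodule ℝ (Lp ℝ 2 μ) :=
  Submodule.span ℝ (range (u.data α B))

/-- `𝓕_α(B) = σ(u_e(s), u_e'(s), …, u_e^{(α-1)}(s) : s ∈ B, e incident to s)`. -/
@[reducible]
def dataSigmaAlg (α : ℕ) (B : Set G.Point) : MeasurableSpace Ω :=
  sigmaGen μ (fun i => ⇑(u.data α B i))

/-! #### Markov property -/

/-- `𝓒` splits `𝓐` and `𝓑`: they are conditionally independent given `𝓒`. -/
def Splits (μ : Measure Ω) (C A B : MeasurableSpace Ω) : Prop :=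
  ∀ s t : Set Ω, MeasurableSet[A] s → MeasurableSet[B] t →
    μ[(s ∩ t).indicator (fun _ => (1 : ℝ)) | C] =ᵐ[μ]
      μ[s.indicator (fun _ => (1 : ℝ)) | C] * μ[t.indicator (fun _ => (1 : ℝ)) | C]

/-- `u` is Markov of order `p` (`p ≥ 1`): it is differentiable of order `p - 1` and, for every open
`S`, the boundary data of order up to `p - 1` split `𝓕₊(closure S)` and `𝓕₊(Γ \ S)`. -/
def IsMarkovOfOrder (p : ℕ) : Prop :=
  u.IsDifferentiable (p - 1) ∧
  ∀ S : Set G.Point, IsOpen S →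
    Splits μ (u.dataSigmaAlg p (frontier S)) (u.germSigmaAlg (closure S)) (u.germSigmaAlg Sᶜ)

end RandomField

end

/-! Put T = L⁻¹ (`greenOp`). The equation for u makes T^α its covariance operator, so the functions
s ↦ E[w u(s)], w ∈ H(Γ), form a reproducing kernel space isometric to H(Γ). Write α = 2k + r with r
∈ {0, 1}. Then T^α = T^k B B* T^k, where B is the identity of L₂(Γ) for r = 0 and the embedding of
the energy space for r = 1. The inner product of two such functions is therefore the L₂ product, or
the energy form, of their images under L^k. Integer powers of L are local differential operators,
which gives the three properties collected in `LocalSobolev`: the functions are H^α on every edge;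
they may be changed freely away from the vertices within H^α, with norm control; and two of them
whose zero sets on the edges contain open sets covering Γ are orthogonal.

Everything else about the field follows from these properties. Since H^α embeds in C^(α-1),
difference quotients of u converge weakly, which produces the derivatives u_e^(k), and pairing w
with u_e^(k)(t) gives the k-th derivative of E[w u_e] at t.

The central step is `LocalSobolev.inner_germSpace_eq_zero`. If x ∈ H₊(closure S) is orthogonal to
the boundary data, E[x u] vanishes to order α on ∂S. Multiply it by smooth cutoffs of S at distance
ε from ∂S: a Hardy inequality, valid for an arbitrary closed zero set, keeps the products bounded in
H^α (`VanishSob.bddSob_cutoff`). A weak limit shows that the restriction of E[x u] to S, extended by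
zero, is again in the kernel space; likewise for the exterior of S. So x = x₁ + x₂ with x₁ ⟂ x₂ by
locality. Also x₂ ⟂ x because x₂ is a limit of elements vanishing near closure S; hence x₂ = 0, and
x = x₁ ⟂ H₊(Γ \ S) for the same reason. Applied to H₊(∂S), which lies in both germ spaces, this
shows that the data span a dense subspace of it; for finite ∂S the span is finite dimensional, hence
closed.

Gaussianity turns orthogonality into independence. It also yields 𝓕₊(A) = σ(H₊(A)), which is not
automatic because intersections of σ-algebras need not match intersections of the subspaces
generating them (`germSigmaAlg_eq_sigmaSub`). -/

noncomputable section

/-! ### Conditional independence and Gaussian σ-algebras -/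

section CondIndep

variable {Ω : Type*}

/-- By independence the conditional expectation of f · 1_m given `N` is the constant ∫_m f. -/
theorem setIntegral_inter_of_indep {A N mΩ : MeasurableSpace Ω} {μ : Measure Ω}
    [IsProbabilityMeasure μ]
    (hA : A ≤ mΩ) (hN : N ≤ mΩ) (hind : Indep A N μ) {f : Ω → ℝ} (hf : Integrable f μ)
    (hfm : StronglyMeasurable[A] f) {m n : Set Ω} (hm : MeasurableSet[A] m)
    (hn : MeasurableSet[N] n) :
    ∫ x in m ∩ n, f x ∂μ = (∫ x in m, f x ∂μ) * μ.real n := by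
  have h1 : StronglyMeasurable[A] (m.indicator f) := hfm.indicator hm
  have h2 := condExp_indep_eq hA hN h1 hind
  have h3 : Integrable (m.indicator f) μ := hf.indicator (hA _ hm)
  have h4 := setIntegral_condExp hN h3 hn
  rw [setIntegral_congr_ae (hN _ hn) (h2.mono fun x hx _ => hx), setIntegral_const,
    setIntegral_indicator (hA _ hm), integral_indicator (hA _ hm)] at h4
  rw [inter_comm, ← h4, smul_eq_mul, mul_comm]

theorem sup_eq_generateFrom_inter (M N : MeasurableSpace Ω) :
    M ⊔ N = MeasurableSpace.generateFrom
      (image2 (· ∩ ·) {s | MeasurableSet[M] s} {s | MeasurableSet[N] s}) := by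
  apply le_antisymm
  · refine sup_le (fun s hs => ?_) (fun s hs => ?_)
    · exact MeasurableSpace.measurableSet_generateFrom
        ⟨s, hs, univ, MeasurableSet.univ, by simp⟩
    · exact MeasurableSpace.measurableSet_generateFrom
        ⟨univ, MeasurableSet.univ, s, hs, by simp⟩
  · refine MeasurableSpace.generateFrom_le ?_
    rintro _ ⟨s, hs, t, ht, rfl⟩
    exact MeasurableSet.inter ((le_sup_left : M ≤ M ⊔ N) _ hs) ((le_sup_right : N ≤ M ⊔ N) _ ht)

/-- If `A ⊇ M` is independent of `N`, then given `M` the σ-algebras `A` and `M ⊔ N` are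
conditionally independent. -/
theorem condExp_sup_eq_of_indep {A M N mΩ : MeasurableSpace Ω} {μ : Measure Ω}
    [IsProbabilityMeasure μ]
    (hMA : M ≤ A) (hA : A ≤ mΩ) (hN : N ≤ mΩ) (hind : Indep A N μ) {s : Set Ω}
    (hs : MeasurableSet[A] s) :
    μ[s.indicator (fun _ => (1 : ℝ)) | M ⊔ N] =ᵐ[μ] μ[s.indicator (fun _ => (1 : ℝ)) | M] := by
  have hM : M ≤ mΩ := hMA.trans hA
  have hMN : M ⊔ N ≤ mΩ := sup_le hM hN
  have hint : Integrable (s.indicator (fun _ => (1 : ℝ))) μ :=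
    (integrable_const 1).indicator (hA _ hs)
  have hindM : Indep M N μ := indep_of_indep_of_le_left hind hMA
  set h := μ[s.indicator (fun _ => (1 : ℝ)) | M] with hh
  have hhi : Integrable h μ := integrable_condExp
  -- π-λ argument: the intersections m ∩ n with m ∈ `M`, n ∈ `N` form a π-system generating `M ⊔ N`,
  -- and on them both integrals factor by independence.
  have key : ∀ t, MeasurableSet[M ⊔ N] t →
      ∫ x in t, h x ∂μ = ∫ x in t, s.indicator (fun _ => (1 : ℝ)) x ∂μ := by
    intro t ht
    refine MeasurableSpace.induction_on_inter
      (C := fun t _ => ∫ x in t, h x ∂μ = ∫ x in t, s.indicator (fun _ => (1 : ℝ)) x ∂μ)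
      (sup_eq_generateFrom_inter M N) ?_ (by simp) ?_ ?_ ?_ t ht
    · rintro _ ⟨a, ha, b, hb, rfl⟩ _ ⟨c, hc, d, hd, rfl⟩ _
      refine ⟨a ∩ c, MeasurableSet.inter ha hc, b ∩ d, MeasurableSet.inter hb hd, ?_⟩
      exact inter_inter_inter_comm a c b d
    · rintro _ ⟨m, hm, n, hn, rfl⟩
      dsimp only
      rw [setIntegral_inter_of_indep hM hN hindM hhi stronglyMeasurable_condExp hm hn,
        setIntegral_inter_of_indep hA hN hind hint
          (stronglyMeasurable_const.indicator hs) (hMA _ hm) hn,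
        setIntegral_condExp hM hint hm]
    · intro t ht h1
      have h2 := integral_add_compl (hMN _ ht) hhi
      have h3 := integral_add_compl (hMN _ ht) hint
      have h4 : ∫ x, h x ∂μ = ∫ x, s.indicator (fun _ => (1 : ℝ)) x ∂μ := integral_condExp hM
      linarith
    · intro f hd hf h1
      rw [integral_iUnion (fun i => hMN _ (hf i)) hd hhi.integrableOn,
        integral_iUnion (fun i => hMN _ (hf i)) hd hint.integrableOn]
      exact tsum_congr h1
  refine (ae_eq_condExp_of_forall_setIntegral_eq hMN hint (fun _ _ _ => hhi.integrableOn)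
    (fun t ht _ => key t ht) ?_).symm
  exact (stronglyMeasurable_condExp.mono (le_sup_left : M ≤ M ⊔ N)).aestronglyMeasurable

/-- Condition first on `M ⊔ N`: there 1_t is already known, while 1_s may be replaced by its
conditional expectation given `M`. The tower property then brings the product down to `M`. -/
theorem splits_of_indep {A B M N mΩ : MeasurableSpace Ω} {μ : Measure Ω}
    [IsProbabilityMeasure μ]
    (hMA : M ≤ A) (hA : A ≤ mΩ) (hN : N ≤ mΩ) (hind : Indep A N μ) (hB : B ≤ M ⊔ N) :
    RandomField.Splits μ M A B := by
  intro s t hs ht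
  have hM : M ≤ mΩ := hMA.trans hA
  have hMN : M ⊔ N ≤ mΩ := sup_le hM hN
  have hsi : Integrable (s.indicator (fun _ => (1 : ℝ))) μ :=
    (integrable_const 1).indicator (hA _ hs)
  have hti : Integrable (t.indicator (fun _ => (1 : ℝ))) μ :=
    (integrable_const 1).indicator (hMN _ (hB _ ht))
  have hst : (s ∩ t).indicator (fun _ => (1 : ℝ)) =
      t.indicator (fun _ => (1 : ℝ)) * s.indicator (fun _ => (1 : ℝ)) := by
    ext x
    by_cases h1 : x ∈ s <;> by_cases h2 : x ∈ t <;> simp [h1, h2]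
  have hsti : Integrable (t.indicator (fun _ => (1 : ℝ)) * s.indicator (fun _ => (1 : ℝ))) μ := by
    rw [← hst]
    exact (integrable_const 1).indicator ((hA _ hs).inter (hMN _ (hB _ ht)))
  have htm : AEStronglyMeasurable[M ⊔ N] (t.indicator (fun _ => (1 : ℝ))) μ :=
    (stronglyMeasurable_const.indicator (hB _ ht)).aestronglyMeasurable
  have h1 := condExp_mul_of_aestronglyMeasurable_left htm hsti hsi
  have h2 := condExp_sup_eq_of_indep hMA hA hN hind hs
  set h := μ[s.indicator (fun _ => (1 : ℝ)) | M] with hh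
  have h3 : μ[(s ∩ t).indicator (fun _ => (1 : ℝ)) | M ⊔ N] =ᵐ[μ]
      h * t.indicator (fun _ => (1 : ℝ)) := by
    rw [hst]
    filter_upwards [h1, h2] with x hx1 hx2
    rw [hx1, Pi.mul_apply, Pi.mul_apply, hx2, mul_comm]
  have h4 : μ[(s ∩ t).indicator (fun _ => (1 : ℝ)) | M] =ᵐ[μ]
      μ[h * t.indicator (fun _ => (1 : ℝ)) | M] :=
    (condExp_condExp_of_le (le_sup_left : M ≤ M ⊔ N) hMN).symm.trans (condExp_congr_ae h3)
  refine h4.trans ?_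
  refine condExp_mul_of_aestronglyMeasurable_left
    stronglyMeasurable_condExp.aestronglyMeasurable ?_ hti
  have : Integrable (μ[(s ∩ t).indicator (fun _ => (1 : ℝ)) | M ⊔ N]) μ := integrable_condExp
  exact this.congr h3

end CondIndep

/-! ### Completed σ-algebras generated by subspaces of L₂(Ω) -/

section NullSets

namespace RandomField

section

variable {Ω : Type*} {m mΩ : MeasurableSpace Ω} {μ : Measure Ω}

theorem measurableSet_sigmaGen_of_null {ι : Type*} (X : ι → Ω → ℝ) {A : Set Ω} (hA : μ A = 0) :
    MeasurableSet[sigmaGen μ X] A :=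
  (le_sup_right : MeasurableSpace.generateFrom {A | μ A = 0} ≤ sigmaGen μ X) _
    (MeasurableSpace.measurableSet_generateFrom hA)

theorem measurable_sigmaGen {ι : Type*} (X : ι → Ω → ℝ) (i : ι) :
    Measurable[sigmaGen μ X] (X i) := by
  rw [measurable_iff_comap_le, BorelSpace.measurable_eq (α := ℝ)]
  exact (le_iSup (fun i => MeasurableSpace.comap (X i) (borel ℝ)) i).trans le_sup_left

theorem measurable_of_ae_eq (hm : ∀ A, μ A = 0 → MeasurableSet[m] A)
    {f g : Ω → ℝ} (hfg : f =ᵐ[μ] g) (hg : Measurable[m] g) : Measurable[m] f := by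
  intro s hs
  have h0 : μ {x | ¬ f x = g x} = 0 := hfg
  have h1 : f ⁻¹' s = (g ⁻¹' s \ {x | ¬ f x = g x}) ∪ (f ⁻¹' s ∩ {x | ¬ f x = g x}) := by
    ext x
    by_cases h : f x = g x <;> simp [h]
  rw [h1]
  exact ((hg hs).diff (hm _ h0)).union (hm _ (measure_mono_null inter_subset_right h0))

theorem sigmaGen_le (hm : ∀ A, μ A = 0 → MeasurableSet[m] A) {ι : Type*}
    {X : ι → Ω → ℝ} (hX : ∀ i, Measurable[m] (X i)) : sigmaGen μ X ≤ m := by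
  refine sup_le (iSup_le fun i => ?_) (MeasurableSpace.generateFrom_le hm)
  have := hX i
  rwa [measurable_iff_comap_le, BorelSpace.measurable_eq (α := ℝ)] at this

end

section

variable {Ω : Type*} {mΩ : MeasurableSpace Ω} {μ : Measure Ω}

theorem measurableSet_of_null [μ.IsComplete] {A : Set Ω} (h : μ A = 0) : MeasurableSet A :=
  Measure.IsComplete.out' A h

theorem sigmaGen_le_ambient [μ.IsComplete] {ι : Type*} {X : ι → Ω → ℝ}
    (hX : ∀ i, AEStronglyMeasurable (X i) μ) : sigmaGen μ X ≤ mΩ :=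
  sigmaGen_le (fun _ => measurableSet_of_null) fun i =>
    measurable_of_ae_eq (fun _ => measurableSet_of_null) (hX i).ae_eq_mk
      (hX i).stronglyMeasurable_mk.measurable

/-- The σ-algebra generated by the elements of a subspace of `L₂(Ω)` and the null sets. -/
@[reducible]
def sigmaSub (M : Submodule ℝ (Lp ℝ 2 μ)) : MeasurableSpace Ω :=
  sigmaGen μ (fun x : ↥M => ((x : Lp ℝ 2 μ) : Ω → ℝ))

theorem sigmaSub_le [μ.IsComplete] (M : Submodule ℝ (Lp ℝ 2 μ)) : sigmaSub M ≤ mΩ :=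
  sigmaGen_le_ambient fun _ => Lp.aestronglyMeasurable _

theorem sigmaSub_mono {M N : Submodule ℝ (Lp ℝ 2 μ)} (h : M ≤ N) : sigmaSub M ≤ sigmaSub N :=
  sigmaGen_le (fun _ => measurableSet_sigmaGen_of_null _) fun x =>
    measurable_sigmaGen (fun x : ↥N => ((x : Lp ℝ 2 μ) : Ω → ℝ)) ⟨x, h x.2⟩

theorem measurable_coe_of_mem_closure_span {Ω : Type*} {m mΩ : MeasurableSpace Ω} {μ : Measure Ω}
    (hmΩ : m ≤ mΩ)
    (hm : ∀ A, μ A = 0 → MeasurableSet[m] A) {s : Set (Lp ℝ 2 μ)}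
    (hs : ∀ x ∈ s, Measurable[m] (x : Ω → ℝ)) {x : Lp ℝ 2 μ}
    (hx : x ∈ (Submodule.span ℝ s).topologicalClosure) : Measurable[m] (x : Ω → ℝ) := by
  have hle : (Submodule.span ℝ s).topologicalClosure ≤ lpMeas ℝ ℝ m 2 μ := by
    refine Submodule.topologicalClosure_minimal _ ?_ (isClosed_aestronglyMeasurable hmΩ)
    refine Submodule.span_le.2 fun y hy => ?_
    exact mem_lpMeas_iff_aestronglyMeasurable.2 (hs y hy).stronglyMeasurable.aestronglyMeasurable
  have h1 : AEStronglyMeasurable[m] (x : Ω → ℝ) μ :=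
    mem_lpMeas_iff_aestronglyMeasurable.1 (hle hx)
  exact measurable_of_ae_eq hm h1.ae_eq_mk h1.stronglyMeasurable_mk.measurable

/-- Linear combinations and L₂ limits of the generators stay measurable up to null sets, and the
null sets are in the σ-algebra. This lets all σ-algebras of the field be handled through closed
subspaces. -/
theorem sigmaGen_eq_sigmaSub [μ.IsComplete] {ι : Type*} {X : ι → Ω → ℝ} {x : ι → Lp ℝ 2 μ}
    (hX : ∀ i, X i =ᵐ[μ] x i) :
    sigmaGen μ X = sigmaSub (Submodule.span ℝ (range x)).topologicalClosure := by
  apply le_antisymm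
  · refine sigmaGen_le (fun _ => measurableSet_sigmaGen_of_null _) fun i => ?_
    refine measurable_of_ae_eq (fun _ => measurableSet_sigmaGen_of_null _) (hX i) ?_
    exact measurable_sigmaGen
      (fun x : (Submodule.span ℝ (range x)).topologicalClosure => ((x : Lp ℝ 2 μ) : Ω → ℝ))
      ⟨x i, subset_closure (Submodule.subset_span (mem_range_self i))⟩
  · refine sigmaGen_le (fun _ => measurableSet_sigmaGen_of_null _) fun y => ?_
    refine measurable_coe_of_mem_closure_span
      (sigmaGen_le_ambient fun i => (Lp.aestronglyMeasurable (x i)).congr (hX i).symm)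
      (fun _ => measurableSet_sigmaGen_of_null _) ?_ y.2
    rintro _ ⟨i, rfl⟩
    exact measurable_of_ae_eq (fun _ => measurableSet_sigmaGen_of_null _) (hX i).symm
      (measurable_sigmaGen X i)

theorem sigmaSub_sup_ge [μ.IsComplete] {B M N : Submodule ℝ (Lp ℝ 2 μ)} (h : B ≤ M ⊔ N) :
    sigmaSub B ≤ sigmaSub M ⊔ sigmaSub N := by
  refine sigmaGen_le (m := sigmaSub M ⊔ sigmaSub N) (fun A hA =>
    (le_sup_left : sigmaSub M ≤ sigmaSub M ⊔ sigmaSub N) _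
      (measurableSet_sigmaGen_of_null _ hA)) fun x => ?_
  obtain ⟨y, hy, z, hz, hyz⟩ := Submodule.mem_sup.1 (h x.2)
  have hy' : Measurable[sigmaSub M ⊔ sigmaSub N] (y : Ω → ℝ) :=
    (measurable_sigmaGen (fun x : ↥M => ((x : Lp ℝ 2 μ) : Ω → ℝ)) ⟨y, hy⟩).mono le_sup_left le_rfl
  have hz' : Measurable[sigmaSub M ⊔ sigmaSub N] (z : Ω → ℝ) :=
    (measurable_sigmaGen (fun x : ↥N => ((x : Lp ℝ 2 μ) : Ω → ℝ)) ⟨z, hz⟩).mono le_sup_right le_rfl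
  refine measurable_of_ae_eq (m := sigmaSub M ⊔ sigmaSub N) (fun A hA =>
    (le_sup_left : sigmaSub M ≤ sigmaSub M ⊔ sigmaSub N) _
      (measurableSet_sigmaGen_of_null _ hA)) (g := (y : Ω → ℝ) + (z : Ω → ℝ)) ?_
    (Measurable.add hy' hz')
  rw [← hyz]
  exact Lp.coeFn_add y z

/-- A set of the σ-algebra enlarged by null sets agrees almost everywhere with one of the original
σ-algebra. -/
theorem indep_sup_null {Ω : Type*} {A B mΩ : MeasurableSpace Ω} {μ : Measure Ω}
    [IsProbabilityMeasure μ] (h : Indep A B μ) :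
    Indep (A ⊔ MeasurableSpace.generateFrom {A | μ A = 0})
      (B ⊔ MeasurableSpace.generateFrom {A | μ A = 0}) μ := by
  have key : ∀ (m : MeasurableSpace Ω) (s : Set Ω),
      MeasurableSet[m ⊔ MeasurableSpace.generateFrom {A | μ A = 0}] s →
      ∃ t, MeasurableSet[m] t ∧ s =ᵐ[μ] t := by
    intro m s hs
    have hle : m ⊔ MeasurableSpace.generateFrom {A | μ A = 0} ≤ eventuallyMeasurableSpace m (ae μ) := by
      refine sup_le (fun t ht => ⟨t, ht, EventuallyEq.rfl⟩) (MeasurableSpace.generateFrom_le ?_)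
      intro t ht
      exact ⟨∅, MeasurableSet.empty, ae_eq_empty.2 ht⟩
    exact hle _ hs
  rw [Indep_iff] at h ⊢
  intro s t hs ht
  obtain ⟨s', hs', hs2⟩ := key A s hs
  obtain ⟨t', ht', ht2⟩ := key B t ht
  rw [measure_congr (hs2.inter ht2), measure_congr hs2, measure_congr ht2, h s' t' hs' ht']

/-- A subspace of `L₂(Ω)` all of whose elements are centered Gaussian. -/
def IsGaussSub (K : Submodule ℝ (Lp ℝ 2 μ)) : Prop :=
  ∀ x ∈ K, HasGaussianLaw (x : Ω → ℝ) μ ∧ ∫ ω, (x : Ω → ℝ) ω ∂μ = 0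

/-- Finite linear combinations of elements of `M` and `N` stay in `K`, so together they form a
Gaussian process; there vanishing covariances give independence, and the null sets are added
afterwards. -/
theorem IsGaussSub.indep [IsProbabilityMeasure μ] {K M N : Submodule ℝ (Lp ℝ 2 μ)}
    (hK : IsGaussSub K) (hM : M ≤ K) (hN : N ≤ K)
    (hMN : ∀ x ∈ M, ∀ y ∈ N, inner ℝ x y = 0) : Indep (sigmaSub M) (sigmaSub N) μ := by
  set X : M → Ω → ℝ := fun x => ((x : Lp ℝ 2 μ) : Ω → ℝ)
  set Y : N → Ω → ℝ := fun x => ((x : Lp ℝ 2 μ) : Ω → ℝ)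
  let Z : M ⊕ N → Lp ℝ 2 μ := Sum.elim (fun x => x) (fun y => y)
  have hZ : ∀ i, Z i ∈ K := by
    rintro (x | y)
    exacts [hM x.2, hN y.2]
  have hXY : Sum.elim X Y = fun i => (Z i : Ω → ℝ) := by
    funext i
    rcases i with x | y <;> rfl
  have hproc : IsGaussianProcess (Sum.elim X Y) μ := by
    rw [hXY]
    refine ⟨fun I => ⟨?_⟩⟩
    have hmeas : AEMeasurable (fun ω => I.restrict (fun i => (Z i : Ω → ℝ) ω)) μ :=
      aemeasurable_pi_lambda _ fun i => (Lp.aestronglyMeasurable (Z i)).aemeasurable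
    refine ⟨fun L => ?_⟩
    classical
    -- A linear functional of a finite subfamily is almost everywhere an element of `K`, hence
    -- Gaussian; this is joint Gaussianity.
    have hL : ∃ z ∈ K, (L ∘ fun ω => I.restrict (fun i => (Z i : Ω → ℝ) ω)) =ᵐ[μ] (z : Ω → ℝ) := by
      refine ⟨∑ i : I, L (Pi.single i 1) • Z i, Submodule.sum_mem _ fun i _ =>
        K.smul_mem _ (hZ _), ?_⟩
      have h1 : ∀ᵐ ω ∂μ, ∀ i : I, (L (Pi.single i 1) • Z i : Lp ℝ 2 μ) ω =
          L (Pi.single i 1) * (Z i : Ω → ℝ) ω := by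
        rw [ae_all_iff]
        intro i
        filter_upwards [Lp.coeFn_smul (L (Pi.single i 1)) (Z i)] with ω hω
        simp [hω]
      have h2 := Lp.coeFn_fun_finsetSum (Finset.univ : Finset I) (fun i => L (Pi.single i 1) • Z i)
      filter_upwards [h1, h2] with ω hω hω2
      rw [hω2]
      simp only [hω, Function.comp_apply]
      have h3 : (I.restrict fun i => (Z i : Ω → ℝ) ω) =
          ∑ i : I, (Z i : Ω → ℝ) ω • (Pi.single i 1 : I → ℝ) := by
        ext j
        simp [Finset.sum_apply, Pi.single_apply]
      rw [h3, map_sum]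
      refine Finset.sum_congr rfl fun i _ => ?_
      rw [map_smul, smul_eq_mul, mul_comm]
    obtain ⟨z, hzK, hz⟩ := hL
    have hg := (hK z hzK).1.congr hz.symm
    have hg2 := hg.isGaussian_map.map_eq_gaussianReal (ContinuousLinearMap.id ℝ ℝ)
    rw [AEMeasurable.map_map_of_aemeasurable (by fun_prop) hmeas]
    rw [integral_map hmeas (by fun_prop), variance_map (by fun_prop) hmeas]
    change Measure.map id _ = _ at hg2
    rw [Measure.map_id] at hg2
    change Measure.map _ μ = _
    rw [hg2]
    have hm2 : AEMeasurable (L ∘ fun ω => I.restrict (fun i => (Z i : Ω → ℝ) ω)) μ :=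
      L.continuous.measurable.comp_aemeasurable hmeas
    rw [integral_map hm2 (by fun_prop), variance_map (by fun_prop) hm2]
    rfl
  have hind : IndepFun (fun ω s => X s ω) (fun ω t => Y t ω) μ := by
    refine hproc.indepFun_of_covariance_eq_zero
      (fun s => (Lp.aestronglyMeasurable _).aemeasurable)
      (fun s => (Lp.aestronglyMeasurable _).aemeasurable) fun x y => ?_
    rw [covariance_eq_sub (Lp.memLp _) (Lp.memLp _), (hK _ (hM x.2)).2, zero_mul, sub_zero]
    have := hMN x x.2 y y.2
    rw [L2.inner_def] at this
    rw [← this]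
    refine integral_congr_ae (ae_of_all _ fun ω => ?_)
    simp [mul_comm]
  rw [IndepFun_iff_Indep] at hind
  have hc : ∀ (M : Submodule ℝ (Lp ℝ 2 μ)),
      MeasurableSpace.comap (fun ω (s : M) => ((s : Lp ℝ 2 μ) : Ω → ℝ) ω) MeasurableSpace.pi =
      ⨆ s : M, MeasurableSpace.comap ((s : Lp ℝ 2 μ) : Ω → ℝ) (borel ℝ) := by
    intro M
    rw [MeasurableSpace.pi, MeasurableSpace.comap_iSup]
    refine iSup_congr fun s => ?_
    rw [MeasurableSpace.comap_comp, BorelSpace.measurable_eq (α := ℝ)]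
    rfl
  have h5 := indep_sup_null hind
  rw [hc M, hc N] at h5
  exact h5

/-- If `A` is a σ-algebra containing `sigmaSub M` and independent of `sigmaSub N`, where
`K = M ⊔ N`, then `A ≤ sigmaSub K` forces `A = sigmaSub M`. -/
theorem eq_sigmaSub_of_indep {Ω : Type*} {A mΩ : MeasurableSpace Ω} {μ : Measure Ω}
    [IsProbabilityMeasure μ] [μ.IsComplete] {K M N : Submodule ℝ (Lp ℝ 2 μ)} (hK : K ≤ M ⊔ N)
    (hMA : sigmaSub M ≤ A) (hAK : A ≤ sigmaSub K) (hind : Indep A (sigmaSub N) μ) :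
    A = sigmaSub M := by
  refine le_antisymm (fun s hs => ?_) hMA
  have hA : A ≤ mΩ := hAK.trans (sigmaSub_le K)
  have h1 := condExp_sup_eq_of_indep hMA hA (sigmaSub_le N) hind hs
  -- Since s lies in the larger σ-algebra, its indicator is its own conditional expectation there.
  -- By `h1` it equals the one given `sigmaSub M`, so s is in `sigmaSub M` up to a null set.
  have hs2 : MeasurableSet[sigmaSub M ⊔ sigmaSub N] s := sigmaSub_sup_ge hK _ (hAK _ hs)
  rw [condExp_of_stronglyMeasurable (sup_le (sigmaSub_le M) (sigmaSub_le N))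
    (stronglyMeasurable_const.indicator hs2) ((integrable_const 1).indicator (hA _ hs))] at h1
  have h2 : Measurable[sigmaSub M] (s.indicator (fun _ => (1 : ℝ))) :=
    measurable_of_ae_eq (fun _ => measurableSet_sigmaGen_of_null _) h1
      stronglyMeasurable_condExp.measurable
  have h3 : s = (s.indicator (fun _ => (1 : ℝ))) ⁻¹' {1} := by
    ext x
    by_cases hx : x ∈ s <;> simp [hx]
  rw [h3]
  exact h2 (measurableSet_singleton 1)

end

end RandomField

end NullSets

end

noncomputable section

/-! ### Primitives and Sobolev spaces on an interval -/

theorem AbsolutelyContinuousOnInterval.of_dist_le {f h : ℝ → ℝ} {a b C : ℝ}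
    (hf : AbsolutelyContinuousOnInterval f a b)
    (hfh : ∀ x ∈ uIcc a b, ∀ y ∈ uIcc a b, dist (h x) (h y) ≤ C * dist (f x) (f y)) :
    AbsolutelyContinuousOnInterval h a b := by
  rw [absolutelyContinuousOnInterval_iff] at hf ⊢
  intro ε hε
  obtain ⟨δ, hδ, H⟩ := hf (ε / (|C| + 1)) (by positivity)
  refine ⟨δ, hδ, fun I hI hI2 => ?_⟩
  have h1 := H I hI hI2
  have h2 : ∑ i ∈ Finset.range I.1, dist (h (I.2 i).1) (h (I.2 i).2) ≤
      (|C| + 1) * ∑ i ∈ Finset.range I.1, dist (f (I.2 i).1) (f (I.2 i).2) := by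
    rw [Finset.mul_sum]
    refine Finset.sum_le_sum fun i hi => ?_
    have hmem := hI.1 i hi
    refine (hfh _ hmem.1 _ hmem.2).trans ?_
    exact mul_le_mul_of_nonneg_right ((le_abs_self C).trans (by linarith)) dist_nonneg
  calc _ ≤ _ := h2
    _ < (|C| + 1) * (ε / (|C| + 1)) := by gcongr
    _ = ε := by field_simp

/-- `f` is a primitive of the integrable function `g` on `[0, ℓ]`. -/
def IsPrim (ℓ : ℝ) (f g : ℝ → ℝ) : Prop :=
  IntegrableOn g (Icc 0 ℓ) ∧ ∀ t ∈ Icc 0 ℓ, f t = f 0 + ∫ s in (0 : ℝ)..t, g s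

namespace IsPrim

variable {ℓ : ℝ} {f g f₁ g₁ f₂ g₂ : ℝ → ℝ}

theorem intervalIntegrable (h : IsPrim ℓ f g) {s t : ℝ} (hs : s ∈ Icc 0 ℓ) (ht : t ∈ Icc 0 ℓ) :
    IntervalIntegrable g volume s t := by
  rw [intervalIntegrable_iff]
  exact h.1.mono_set (uIoc_subset_uIcc.trans (OrdConnected.uIcc_subset ordConnected_Icc hs ht))

theorem sub_eq (h : IsPrim ℓ f g) {s t : ℝ} (hs : s ∈ Icc 0 ℓ) (ht : t ∈ Icc 0 ℓ) :
    f t - f s = ∫ r in s..t, g r := by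
  have h0 : (0 : ℝ) ∈ Icc 0 ℓ := ⟨le_rfl, hs.1.trans hs.2⟩
  rw [h.2 t ht, h.2 s hs, add_sub_add_left_eq_sub]
  exact intervalIntegral.integral_interval_sub_left (h.intervalIntegrable h0 ht)
    (h.intervalIntegrable h0 hs)

theorem ac (hℓ : 0 ≤ ℓ) (h : IsPrim ℓ f g) : AbsolutelyContinuousOnInterval f 0 ℓ := by
  have h1 := (h.intervalIntegrable (left_mem_Icc.2 hℓ) (right_mem_Icc.2 hℓ)
    ).absolutelyContinuousOnInterval_intervalIntegral (left_mem_uIcc)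
  refine h1.of_dist_le (C := 1) fun x hx y hy => ?_
  rw [uIcc_of_le hℓ] at hx hy
  rw [h.2 x hx, h.2 y hy, dist_add_left, one_mul]

theorem ae_hasDerivAt (hℓ : 0 ≤ ℓ) (h : IsPrim ℓ f g) :
    ∀ᵐ t, t ∈ Icc 0 ℓ → HasDerivAt f (g t) t := by
  have h1 := (h.intervalIntegrable (left_mem_Icc.2 hℓ) (right_mem_Icc.2 hℓ)
    ).ae_hasDerivAt_integral
  have h0 : ∀ᵐ x : ℝ, x ≠ 0 := by simp [ae_iff, measure_singleton]
  have h2 : ∀ᵐ x : ℝ, x ≠ ℓ := by simp [ae_iff, measure_singleton]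
  rw [uIcc_of_le hℓ] at h1
  filter_upwards [h1, h0, h2] with t ht ht0 htl htI
  have h3 := (ht htI 0 (left_mem_Icc.2 hℓ)).const_add (f 0)
  refine h3.congr_of_eventuallyEq ?_
  filter_upwards [Icc_mem_nhds (lt_of_le_of_ne htI.1 (Ne.symm ht0)) (lt_of_le_of_ne htI.2 htl)]
    with x hx using h.2 x hx

/-- Fundamental theorem of calculus for absolutely continuous functions. With `ac` and
`ae_hasDerivAt` it reduces calculus with primitives to the rules for pointwise derivatives. -/
theorem of_ac (hℓ : 0 ≤ ℓ) (hf : AbsolutelyContinuousOnInterval f 0 ℓ)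
    (h : ∀ᵐ t, t ∈ Icc 0 ℓ → HasDerivAt f (g t) t) : IsPrim ℓ f g := by
  have hd : ∀ᵐ t, t ∈ Icc 0 ℓ → deriv f t = g t := by
    filter_upwards [h] with t ht htI using (ht htI).deriv
  have hi := hf.intervalIntegrable_deriv
  rw [intervalIntegrable_iff, uIoc_of_le hℓ, ← integrableOn_Icc_iff_integrableOn_Ioc] at hi
  refine ⟨hi.congr ((ae_restrict_iff' measurableSet_Icc).2 hd), fun t ht => ?_⟩
  have h1 := (hf.mono (c := 0) (d := t) (by
    rw [uIcc_of_le hℓ, uIcc_of_le ht.1]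
    exact Icc_subset_Icc_right ht.2)).integral_deriv_eq_sub
  have h2 : ∫ x in (0 : ℝ)..t, deriv f x = ∫ x in (0 : ℝ)..t, g x := by
    refine intervalIntegral.integral_congr_ae ?_
    filter_upwards [hd] with x hx hxI
    rw [uIoc_of_le ht.1] at hxI
    exact hx ⟨hxI.1.le, hxI.2.trans ht.2⟩
  rw [← h2, h1]
  ring

theorem continuousOn (hℓ : 0 ≤ ℓ) (h : IsPrim ℓ f g) : ContinuousOn f (Icc 0 ℓ) := by
  have := (h.ac hℓ).continuousOn
  rwa [uIcc_of_le hℓ] at this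

theorem congr (h : IsPrim ℓ f g) (hf : EqOn f₁ f (Icc 0 ℓ))
    (hg : g₁ =ᵐ[volume.restrict (Icc 0 ℓ)] g) : IsPrim ℓ f₁ g₁ := by
  refine ⟨h.1.congr hg.symm, fun t ht => ?_⟩
  rw [hf ht, hf ⟨le_rfl, ht.1.trans ht.2⟩, h.2 t ht]
  congr 1
  refine intervalIntegral.integral_congr_ae ?_
  filter_upwards [(ae_restrict_iff' measurableSet_Icc).1 hg] with x hx hxI
  rw [uIoc_of_le ht.1] at hxI
  exact (hx ⟨hxI.1.le, hxI.2.trans ht.2⟩).symm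

theorem mul (hℓ : 0 ≤ ℓ) (h₁ : IsPrim ℓ f₁ g₁) (h₂ : IsPrim ℓ f₂ g₂) :
    IsPrim ℓ (fun t => f₁ t * f₂ t) (fun t => g₁ t * f₂ t + f₁ t * g₂ t) := by
  refine of_ac hℓ ((h₁.ac hℓ).mul (h₂.ac hℓ)) ?_
  filter_upwards [h₁.ae_hasDerivAt hℓ, h₂.ae_hasDerivAt hℓ] with t h1 h2 ht
  exact (h1 ht).mul (h2 ht)

theorem add (hℓ : 0 ≤ ℓ) (h₁ : IsPrim ℓ f₁ g₁) (h₂ : IsPrim ℓ f₂ g₂) :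
    IsPrim ℓ (fun t => f₁ t + f₂ t) (fun t => g₁ t + g₂ t) := by
  refine of_ac hℓ ((h₁.ac hℓ).add (h₂.ac hℓ)) ?_
  filter_upwards [h₁.ae_hasDerivAt hℓ, h₂.ae_hasDerivAt hℓ] with t h1 h2 ht
  exact (h1 ht).add (h2 ht)

theorem const_mul (hℓ : 0 ≤ ℓ) (c : ℝ) (h : IsPrim ℓ f g) :
    IsPrim ℓ (fun t => c * f t) (fun t => c * g t) := by
  refine of_ac hℓ ((h.ac hℓ).const_mul c) ?_
  filter_upwards [h.ae_hasDerivAt hℓ] with t h1 ht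
  exact (h1 ht).const_mul c

theorem sub (hℓ : 0 ≤ ℓ) (h₁ : IsPrim ℓ f₁ g₁) (h₂ : IsPrim ℓ f₂ g₂) :
    IsPrim ℓ (fun t => f₁ t - f₂ t) (fun t => g₁ t - g₂ t) := by
  refine of_ac hℓ ((h₁.ac hℓ).sub (h₂.ac hℓ)) ?_
  filter_upwards [h₁.ae_hasDerivAt hℓ, h₂.ae_hasDerivAt hℓ] with t h1 h2 ht
  exact (h1 ht).sub (h2 ht)

theorem inv (hℓ : 0 ≤ ℓ) {c : ℝ} (hc : 0 < c) (hfc : ∀ t ∈ Icc 0 ℓ, c ≤ f t) (h : IsPrim ℓ f g) :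
    IsPrim ℓ (fun t => (f t)⁻¹) (fun t => -(g t * ((f t)⁻¹ * (f t)⁻¹))) := by
  refine of_ac hℓ ((h.ac hℓ).of_dist_le (C := (c * c)⁻¹) fun x hx y hy => ?_) ?_
  · rw [uIcc_of_le hℓ] at hx hy
    have hx' := hfc x hx
    have hy' := hfc y hy
    have hx0 : 0 < f x := hc.trans_le hx'
    have hy0 : 0 < f y := hc.trans_le hy'
    rw [Real.dist_eq, Real.dist_eq, inv_sub_inv hx0.ne' hy0.ne', abs_div, abs_of_pos
      (mul_pos hx0 hy0), abs_sub_comm, div_eq_inv_mul]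
    gcongr
  · filter_upwards [h.ae_hasDerivAt hℓ] with t h1 ht
    have h2 := (h1 ht).inv (hc.trans_le (hfc t ht)).ne'
    refine h2.congr_deriv ?_
    rw [neg_div, div_eq_mul_inv, pow_two, mul_inv]

/-- A primitive vanishing on an open set has almost everywhere vanishing derivative there. -/
theorem ae_eq_zero_of_isOpen (hℓ : 0 ≤ ℓ) (h : IsPrim ℓ f g) {O : Set ℝ} (hO : IsOpen O)
    (h0 : ∀ᵐ t, t ∈ Icc 0 ℓ → t ∈ O → f t = 0) : ∀ᵐ t, t ∈ Icc 0 ℓ → t ∈ O → g t = 0 := by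
  have hU : IsOpen (O ∩ Ioo 0 ℓ) := hO.inter isOpen_Ioo
  have h1 : EqOn f (fun _ => 0) (O ∩ Ioo 0 ℓ) := by
    refine Measure.eqOn_open_of_ae_eq (μ := volume) ?_ hU
      ((h.continuousOn hℓ).mono fun x hx => Ioo_subset_Icc_self hx.2) continuousOn_const
    refine (ae_restrict_iff' hU.measurableSet).2 ?_
    filter_upwards [h0] with t ht htO using ht (Ioo_subset_Icc_self htO.2) htO.1
  have hn0 : ∀ᵐ x : ℝ, x ≠ 0 := by simp [ae_iff, measure_singleton]
  have hnl : ∀ᵐ x : ℝ, x ≠ ℓ := by simp [ae_iff, measure_singleton]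
  filter_upwards [h.ae_hasDerivAt hℓ, hn0, hnl] with t ht ht0 htl htI htO
  have h2 : HasDerivAt f 0 t := (hasDerivAt_const t (0 : ℝ)).congr_of_eventuallyEq
    (h1.eventuallyEq_of_mem (hU.mem_nhds
      ⟨htO, lt_of_le_of_ne htI.1 (Ne.symm ht0), lt_of_le_of_ne htI.2 htl⟩))
  exact (ht htI).unique h2

theorem hasDerivWithinAt (hℓ : 0 < ℓ) (h : IsPrim ℓ f g) (hg : ContinuousOn g (Icc 0 ℓ)) {t : ℝ}
    (ht : t ∈ Icc 0 ℓ) : HasDerivWithinAt f (g t) (Icc 0 ℓ) t := by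
  have h0 : (0 : ℝ) ∈ Icc 0 ℓ := left_mem_Icc.2 hℓ.le
  have : Fact (t ∈ Icc 0 ℓ) := ⟨ht⟩
  have h1 := intervalIntegral.integral_hasDerivWithinAt_right (h.intervalIntegrable h0 ht)
    (s := Icc 0 ℓ) (t := Icc 0 ℓ)
    (hg.stronglyMeasurableAtFilter_nhdsWithin measurableSet_Icc t) (hg t ht)
  exact (h1.const_add (f 0)).congr (fun x hx => h.2 x hx) (h.2 t ht)

theorem const (c : ℝ) : IsPrim ℓ (fun _ => c) (fun _ => 0) := by
  refine ⟨integrableOn_const (by simp), fun t _ => by simp⟩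

theorem integral_mul_add (hℓ : 0 ≤ ℓ) (h₁ : IsPrim ℓ f₁ g₁) (h₂ : IsPrim ℓ f₂ g₂) :
    ∫ t in Icc 0 ℓ, (g₁ t * f₂ t + f₁ t * g₂ t) = f₁ ℓ * f₂ ℓ - f₁ 0 * f₂ 0 := by
  have h := (h₁.mul hℓ h₂).sub_eq (left_mem_Icc.2 hℓ) (right_mem_Icc.2 hℓ)
  rw [h, intervalIntegral.integral_of_le hℓ, integral_Icc_eq_integral_Ioc]

end IsPrim

/-! ### Uniformly bounded families in Sobolev spaces -/

section Sobolev

variable {ι : Type*} {ℓ : ℝ} {p : ℝ≥0∞}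

/-- A family of functions on `[0, ℓ]` that is bounded in `L_p`. -/
def BddLp (ℓ : ℝ) (p : ℝ≥0∞) (F : ι → ℝ → ℝ) : Prop :=
  ∃ C : ℝ≥0, ∀ i, MemLp (F i) p (volume.restrict (Icc 0 ℓ)) ∧
    eLpNorm (F i) p (volume.restrict (Icc 0 ℓ)) ≤ C

/-- A family of functions on `[0, ℓ]` that is bounded in the Sobolev space `W^{n,p}`. -/
def BddSob (ℓ : ℝ) (p : ℝ≥0∞) : ℕ → (ι → ℝ → ℝ) → Prop
  | 0, F => BddLp ℓ p F
  | n + 1, F => BddLp ℓ p F ∧ ∃ G, BddSob ℓ p n G ∧ ∀ i, IsPrim ℓ (F i) (G i)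

theorem BddLp.add (hp : 1 ≤ p) {F G : ι → ℝ → ℝ} (hF : BddLp ℓ p F) (hG : BddLp ℓ p G) :
    BddLp ℓ p (fun i t => F i t + G i t) := by
  obtain ⟨C, hC⟩ := hF
  obtain ⟨D, hD⟩ := hG
  refine ⟨C + D, fun i => ⟨(hC i).1.add (hD i).1, ?_⟩⟩
  refine (eLpNorm_add_le (hC i).1.1 (hD i).1.1 hp).trans ?_
  push_cast
  exact add_le_add (hC i).2 (hD i).2

theorem BddLp.mul {F G : ι → ℝ → ℝ} (hF : BddLp ℓ ∞ F) (hG : BddLp ℓ p G) :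
    BddLp ℓ p (fun i t => F i t * G i t) := by
  obtain ⟨C, hC⟩ := hF
  obtain ⟨D, hD⟩ := hG
  refine ⟨C * D, fun i => ⟨(hD i).1.mul (hC i).1, ?_⟩⟩
  refine (eLpNorm_smul_le_mul_eLpNorm (p := ∞) (q := p) (hD i).1.1 (hC i).1.1).trans ?_
  push_cast
  exact mul_le_mul' (hC i).2 (hD i).2

theorem BddLp.comp {ι' : Type*} {F : ι → ℝ → ℝ} (hF : BddLp ℓ p F) (φ : ι' → ι) :
    BddLp ℓ p (fun i => F (φ i)) :=
  hF.imp fun _ hC i => hC (φ i)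

theorem BddLp.congr {F G : ι → ℝ → ℝ} (hF : BddLp ℓ p F)
    (h : ∀ i, G i =ᵐ[volume.restrict (Icc 0 ℓ)] F i) : BddLp ℓ p G :=
  hF.imp fun _ hC i => ⟨(memLp_congr_ae (h i)).2 (hC i).1, (eLpNorm_congr_ae (h i)).trans_le (hC i).2⟩

theorem bddLp_unit {f : ℝ → ℝ} (hf : MemLp f p (volume.restrict (Icc 0 ℓ))) :
    BddLp ℓ p (fun _ : Unit => f) :=
  ⟨(eLpNorm f p (volume.restrict (Icc 0 ℓ))).toNNReal, fun _ =>
    ⟨hf, (ENNReal.coe_toNNReal hf.2.ne).ge⟩⟩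

theorem ContinuousOn.memLp_Icc {f : ℝ → ℝ} (hf : ContinuousOn f (Icc 0 ℓ)) :
    MemLp f p (volume.restrict (Icc 0 ℓ)) := by
  obtain ⟨C, hC⟩ := isCompact_Icc.exists_bound_of_continuousOn hf
  exact MemLp.of_bound (hf.aestronglyMeasurable measurableSet_Icc) C
    ((ae_restrict_iff' measurableSet_Icc).2 (ae_of_all _ hC))

namespace BddSob

variable {n : ℕ} {F G : ι → ℝ → ℝ}

theorem bddLp (h : BddSob ℓ p n F) : BddLp ℓ p F := by
  cases n with
  | zero => exact h
  | succ n => exact h.1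

theorem of_succ (h : BddSob ℓ p (n + 1) F) : BddSob ℓ p n F := by
  induction n generalizing F with
  | zero => exact h.1
  | succ n ih =>
    obtain ⟨h1, G, hG, hFG⟩ := h
    exact ⟨h1, G, ih hG, hFG⟩

theorem of_le {m : ℕ} (hmn : m ≤ n) (h : BddSob ℓ p n F) : BddSob ℓ p m F := by
  induction n, hmn using Nat.le_induction with
  | base => exact h
  | succ n _ ih => exact ih h.of_succ

theorem add (hℓ : 0 ≤ ℓ) (hp : 1 ≤ p) (hF : BddSob ℓ p n F) (hG : BddSob ℓ p n G) :
    BddSob ℓ p n (fun i t => F i t + G i t) := by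
  induction n generalizing F G with
  | zero => exact BddLp.add hp hF hG
  | succ n ih =>
    obtain ⟨h1, F', hF', hFF'⟩ := hF
    obtain ⟨h2, G', hG', hGG'⟩ := hG
    exact ⟨h1.add hp h2, _, ih hF' hG', fun i => (hFF' i).add hℓ (hGG' i)⟩

/-- Leibniz rule. The first factor is measured in W^{n,∞}, the class of the coefficients, and the
second in W^{n,p}, used with p = 2 for elements of the kernel space. -/
theorem mul (hℓ : 0 ≤ ℓ) (hp : 1 ≤ p) (hF : BddSob ℓ ∞ n F) (hG : BddSob ℓ p n G) :
    BddSob ℓ p n (fun i t => F i t * G i t) := by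
  induction n generalizing F G with
  | zero => exact BddLp.mul hF hG
  | succ n ih =>
    have hFn := hF.of_succ
    have hGn := hG.of_succ
    obtain ⟨h1, F', hF', hFF'⟩ := hF
    obtain ⟨h2, G', hG', hGG'⟩ := hG
    exact ⟨h1.mul h2, _, (ih hF' hGn).add hℓ hp (ih hFn hG'), fun i => (hFF' i).mul hℓ (hGG' i)⟩

theorem const (c : ℝ) : BddSob ℓ p n (fun (_ : ι) _ => c) := by
  have h0 : ∀ c : ℝ, BddLp ℓ p (fun (_ : ι) _ => c) := fun c =>
    (bddLp_unit (f := fun _ => c) (memLp_const c)).comp fun _ => ()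
  induction n generalizing c with
  | zero => exact h0 c
  | succ n ih => exact ⟨h0 c, _, ih 0, fun _ => IsPrim.const c⟩

theorem const_mul (hℓ : 0 ≤ ℓ) (hp : 1 ≤ p) (c : ℝ) (hF : BddSob ℓ p n F) :
    BddSob ℓ p n (fun i t => c * F i t) :=
  (const c).mul hℓ hp hF

theorem neg (hℓ : 0 ≤ ℓ) (hp : 1 ≤ p) (hF : BddSob ℓ p n F) : BddSob ℓ p n (fun i t => -F i t) := by
  simpa using hF.const_mul hℓ hp (-1)

theorem sub (hℓ : 0 ≤ ℓ) (hp : 1 ≤ p) (hF : BddSob ℓ p n F) (hG : BddSob ℓ p n G) :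
    BddSob ℓ p n (fun i t => F i t - G i t) := by
  simpa [sub_eq_add_neg] using hF.add hℓ hp (hG.neg hℓ hp)

theorem comp {ι' : Type*} (hF : BddSob ℓ p n F) (φ : ι' → ι) : BddSob ℓ p n (fun i => F (φ i)) := by
  induction n generalizing F with
  | zero => exact BddLp.comp hF φ
  | succ n ih =>
    obtain ⟨h1, F', hF', hFF'⟩ := hF
    exact ⟨h1.comp φ, _, ih hF', fun i => hFF' (φ i)⟩

theorem congr (hF : BddSob ℓ p n F) (h : ∀ i, EqOn (G i) (F i) (Icc 0 ℓ)) : BddSob ℓ p n G := by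
  have h' : ∀ i, G i =ᵐ[volume.restrict (Icc 0 ℓ)] F i := fun i =>
    (ae_restrict_iff' measurableSet_Icc).2 (ae_of_all _ fun t ht => h i ht)
  cases n with
  | zero => exact BddLp.congr hF h'
  | succ n =>
    obtain ⟨h1, F', hF', hFF'⟩ := hF
    exact ⟨h1.congr h', F', hF', fun i => (hFF' i).congr (h i) EventuallyEq.rfl⟩

theorem continuousOn (hℓ : 0 ≤ ℓ) (hF : BddSob ℓ p (n + 1) F) (i : ι) :
    ContinuousOn (F i) (Icc 0 ℓ) := by
  obtain ⟨_, F', _, hFF'⟩ := hF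
  exact (hFF' i).continuousOn hℓ

theorem inv (hℓ : 0 ≤ ℓ) {c : ℝ} (hc : 0 < c) (hFc : ∀ i, ∀ t ∈ Icc 0 ℓ, c ≤ F i t)
    (hF : BddSob ℓ ∞ n F) : BddSob ℓ ∞ n (fun i t => (F i t)⁻¹) := by
  have h0 : BddLp ℓ ∞ (fun i t => (F i t)⁻¹) := by
    obtain ⟨C, hC⟩ := hF.bddLp
    have hb : ∀ i, ∀ᵐ t ∂(volume.restrict (Icc 0 ℓ)), ‖(F i t)⁻¹‖ ≤ c⁻¹ := fun i =>
      (ae_restrict_iff' measurableSet_Icc).2 (ae_of_all _ fun t ht => by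
        rw [Real.norm_eq_abs, abs_of_pos (inv_pos.2 (hc.trans_le (hFc i t ht)))]
        exact inv_anti₀ hc (hFc i t ht))
    refine ⟨(c⁻¹).toNNReal, fun i => ⟨memLp_top_of_bound
      (hC i).1.1.aemeasurable.inv.aestronglyMeasurable _ (hb i), ?_⟩⟩
    rw [eLpNorm_exponent_top]
    exact eLpNormEssSup_le_of_ae_bound (hb i)
  induction n with
  | zero => exact h0
  | succ n ih =>
    have hI := ih hF.of_succ
    obtain ⟨h1, F', hF', hFF'⟩ := hF
    exact ⟨h0, _, (hF'.mul hℓ le_top (hI.mul hℓ le_top hI)).neg hℓ le_top,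
      fun i => (hFF' i).inv hℓ hc (hFc i)⟩

theorem contDiffOn (hℓ : 0 < ℓ) {f : ℝ → ℝ} (hf : BddSob ℓ p (n + 1) (fun _ : Unit => f)) :
    ContDiffOn ℝ n f (Icc 0 ℓ) := by
  induction n generalizing f with
  | zero => exact contDiffOn_zero.2 (hf.continuousOn hℓ.le ())
  | succ n ih =>
    obtain ⟨_, G, hG, hFG⟩ := hf
    have hGc := hG.continuousOn hℓ.le ()
    have hd : ∀ t ∈ Icc 0 ℓ, HasDerivWithinAt f (G () t) (Icc 0 ℓ) t := fun t ht =>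
      (hFG ()).hasDerivWithinAt hℓ hGc ht
    have hu := uniqueDiffOn_Icc hℓ
    push_cast
    rw [contDiffOn_succ_iff_derivWithin hu]
    refine ⟨fun t ht => (hd t ht).differentiableWithinAt, by simp, ?_⟩
    exact (ih (f := G ()) hG).congr fun t ht => (hd t ht).derivWithin (hu t ht)

end BddSob

theorem LipschitzWith.isPrim_deriv {f : ℝ → ℝ} {K : ℝ≥0} (hℓ : 0 ≤ ℓ) (hf : LipschitzWith K f) :
    IsPrim ℓ f (deriv f) := by
  have hac : AbsolutelyContinuousOnInterval f 0 ℓ :=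
    (hf.lipschitzOnWith (s := uIcc 0 ℓ)).absolutelyContinuousOnInterval
  refine IsPrim.of_ac hℓ hac ?_
  filter_upwards [hac.ae_differentiableAt] with t ht htI
  exact (ht (by rwa [uIcc_of_le hℓ])).hasDerivAt

theorem LipschitzWith.bddSob_one {f : ℝ → ℝ} {K : ℝ≥0} (hℓ : 0 ≤ ℓ) (hf : LipschitzWith K f) :
    BddSob ℓ ∞ 1 (fun _ : Unit => f) := by
  refine ⟨bddLp_unit hf.continuous.continuousOn.memLp_Icc, fun _ => deriv f, bddLp_unit ?_,
    fun _ => hf.isPrim_deriv hℓ⟩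
  exact memLp_top_of_bound (measurable_deriv f).aestronglyMeasurable K
    (ae_of_all _ fun t => norm_deriv_le_of_lipschitz hf)

/-- The hypothesis concerns the open interval only, so the values of f at the end points are
irrelevant. The Lipschitz top derivative extends to the line, and integrating k times gives a
function of class W^{k+1,∞} on the closed interval. -/
theorem MetricGraph.IsCkLip.exists_bddSob {k : ℕ} {f : ℝ → ℝ} (hℓ : 0 < ℓ)
    (hf : MetricGraph.IsCkLip k ℓ f) :
    ∃ g, EqOn g f (Ioo 0 ℓ) ∧ BddSob ℓ ∞ (k + 1) (fun _ : Unit => g) := by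
  induction k generalizing f with
  | zero =>
    obtain ⟨_, K, hK⟩ := hf
    rw [iteratedDeriv_zero] at hK
    obtain ⟨g, hg, hfg⟩ := hK.extend_real
    exact ⟨g, hfg.symm, hg.bddSob_one hℓ.le⟩
  | succ k ih =>
    obtain ⟨hf1, K, hK⟩ := hf
    push_cast at hf1
    rw [contDiffOn_succ_iff_deriv_of_isOpen isOpen_Ioo] at hf1
    rw [iteratedDeriv_succ'] at hK
    obtain ⟨g, hg, hgS⟩ := ih ⟨hf1.2.2, K, hK⟩
    have hgc : ContinuousOn g (Icc 0 ℓ) := hgS.continuousOn hℓ.le ()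
    -- The integration starts at the midpoint, where f and its derivatives are controlled, rather
    -- than at an end point.
    have hm : ℓ / 2 ∈ Ioo 0 ℓ := ⟨by linarith, by linarith⟩
    have hgi : ∀ s ∈ Icc 0 ℓ, ∀ t ∈ Icc 0 ℓ, IntervalIntegrable g volume s t := fun s hs t ht =>
      (hgc.mono (OrdConnected.uIcc_subset ordConnected_Icc hs ht)).intervalIntegrable
    have h0 : (0 : ℝ) ∈ Icc 0 ℓ := left_mem_Icc.2 hℓ.le
    have hprim : IsPrim ℓ (fun t => f (ℓ / 2) + ∫ s in (ℓ / 2)..t, g s) g := by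
      refine ⟨hgc.integrableOn_compact isCompact_Icc, fun t ht => ?_⟩
      rw [add_assoc, intervalIntegral.integral_add_adjacent_intervals
        (hgi _ (Ioo_subset_Icc_self hm) _ h0) (hgi _ h0 _ ht)]
    refine ⟨fun t => f (ℓ / 2) + ∫ s in (ℓ / 2)..t, g s, fun t ht => ?_,
      bddLp_unit (hprim.continuousOn hℓ.le).memLp_Icc, fun _ => g, hgS, fun _ => hprim⟩
    have h1 : ∫ s in (ℓ / 2)..t, g s = f t - f (ℓ / 2) := by
      refine intervalIntegral.integral_eq_sub_of_hasDerivAt (fun x hx => ?_)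
        (hgi _ (Ioo_subset_Icc_self hm) _ (Ioo_subset_Icc_self ht))
      have hx' : x ∈ Ioo 0 ℓ := OrdConnected.uIcc_subset ordConnected_Ioo hm ht hx
      rw [hg hx']
      exact ((hf1.1 x hx').differentiableAt (isOpen_Ioo.mem_nhds hx')).hasDerivAt
    simp only [h1]
    ring

end Sobolev

end

noncomputable section

/-! ### Hardy inequalities and cutoffs near a closed set -/

section Cutoff

variable {ℓ : ℝ} {Z S : Set ℝ}

theorem exists_mem_frontier_uIcc {s t : ℝ} (hs : s ∈ S) (ht : t ∉ S) :
    ∃ z ∈ uIcc s t, z ∈ frontier S := by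
  by_contra! h
  have hpre : IsPreconnected (uIcc s t) := isPreconnected_uIcc
  have h1 : uIcc s t ⊆ interior S ∪ (closure S)ᶜ := by
    intro z hz
    by_cases hzc : z ∈ closure S
    · left
      by_contra hzi
      exact h z hz ⟨hzc, hzi⟩
    · exact Or.inr hzc
  have hs' : s ∈ interior S := (h1 left_mem_uIcc).resolve_right fun h => h (subset_closure hs)
  have ht' : t ∈ (closure S)ᶜ := (h1 right_mem_uIcc).resolve_left fun h => ht (interior_subset h)
  obtain ⟨z, -, hz1, hz2⟩ := hpre _ _ isOpen_interior isClosed_closure.isOpen_compl h1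
    ⟨s, left_mem_uIcc, hs'⟩ ⟨t, right_mem_uIcc, ht'⟩
  exact hz2 (subset_closure (interior_subset hz1))

/-- `f ∈ H^n(0, ℓ)`, and `f` and its derivatives of order less than `n` vanish on `Z`. -/
def VanishSob (ℓ : ℝ) (Z : Set ℝ) : ℕ → (ℝ → ℝ) → Prop
  | 0, f => MemLp f 2 (volume.restrict (Icc 0 ℓ))
  | n + 1, f => (∀ t ∈ Icc 0 ℓ, t ∈ Z → f t = 0) ∧ ∃ g, VanishSob ℓ Z n g ∧ IsPrim ℓ f g

theorem VanishSob.memLp (hℓ : 0 ≤ ℓ) {n : ℕ} {f : ℝ → ℝ} (hf : VanishSob ℓ Z n f) :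
    MemLp f 2 (volume.restrict (Icc 0 ℓ)) := by
  cases n with
  | zero => exact hf
  | succ n =>
    obtain ⟨_, g, _, hfg⟩ := hf
    exact (hfg.continuousOn hℓ).memLp_Icc

theorem VanishSob.of_succ (hℓ : 0 ≤ ℓ) {n : ℕ} {f : ℝ → ℝ} (hf : VanishSob ℓ Z (n + 1) f) :
    VanishSob ℓ Z n f := by
  induction n generalizing f with
  | zero => exact VanishSob.memLp hℓ hf
  | succ n ih =>
    obtain ⟨h0, g, hg, hfg⟩ := hf
    exact ⟨h0, g, ih hg, hfg⟩

theorem VanishSob.of_le (hℓ : 0 ≤ ℓ) {m n : ℕ} (hmn : m ≤ n) {f : ℝ → ℝ} (hf : VanishSob ℓ Z n f) :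
    VanishSob ℓ Z m f := by
  induction n, hmn using Nat.le_induction with
  | base => exact hf
  | succ n _ ih => exact ih (hf.of_succ hℓ)

theorem VanishSob.of_iteratedDerivWithin (hℓ : 0 < ℓ) {n : ℕ} {f : ℝ → ℝ}
    (hf : BddSob ℓ 2 n (fun _ : Unit => f))
    (h : ∀ k < n, ∀ t ∈ Icc 0 ℓ, t ∈ Z → iteratedDerivWithin k f (Icc 0 ℓ) t = 0) :
    VanishSob ℓ Z n f := by
  induction n generalizing f with
  | zero => exact (hf.choose_spec ()).1
  | succ n ih =>
    obtain ⟨_, G, hG, hFG⟩ := hf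
    refine ⟨fun t ht htZ => by simpa using h 0 n.succ_pos t ht htZ, G (), ih hG ?_, hFG ()⟩
    intro k hk t ht htZ
    obtain ⟨n, rfl⟩ : ∃ m, n = m + 1 := ⟨n - 1, by omega⟩
    have hGc := hG.continuousOn hℓ.le ()
    have he : EqOn (derivWithin f (Icc 0 ℓ)) (G ()) (Icc 0 ℓ) := fun s hs =>
      ((hFG ()).hasDerivWithinAt hℓ hGc hs).derivWithin (uniqueDiffOn_Icc hℓ s hs)
    refine Eq.trans ?_ (h (k + 1) (by omega) t ht htZ)
    rw [iteratedDerivWithin_succ']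
    exact (iteratedDerivWithin_congr he ht).symm

theorem sq_lintegral_le_measure_mul {A : Set ℝ} {g : ℝ → ℝ}
    (hg : AEStronglyMeasurable g (volume.restrict A)) :
    (∫⁻ s in A, ‖g s‖ₑ) ^ 2 ≤ volume A * ∫⁻ s in A, ‖g s‖ₑ ^ 2 := by
  have h := ENNReal.lintegral_mul_le_Lp_mul_Lq (volume.restrict A) Real.HolderConjugate.two_two
    (f := fun _ => 1) (g := fun s => ‖g s‖ₑ) aemeasurable_const hg.enorm
  simp only [Pi.mul_apply, one_mul, ENNReal.rpow_ofNat, one_pow, lintegral_one,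
    Measure.restrict_apply_univ] at h
  calc (∫⁻ s in A, ‖g s‖ₑ) ^ 2
      ≤ ((volume A) ^ (1 / 2 : ℝ) * (∫⁻ s in A, ‖g s‖ₑ ^ 2) ^ (1 / 2 : ℝ)) ^ 2 := by gcongr
    _ = _ := by
      rw [mul_pow, ← ENNReal.rpow_natCast, ← ENNReal.rpow_natCast, ← ENNReal.rpow_mul,
        ← ENNReal.rpow_mul]
      norm_num

/-- The clamping of the real line to `[0, ℓ]` maps `Z` to itself. -/
def ClampStable (ℓ : ℝ) (Z : Set ℝ) : Prop := ∀ z ∈ Z, max 0 (min ℓ z) ∈ Z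

/-- Clamping fixes t ∈ [0, ℓ] and does not increase distances to it. It is needed because `G.pt e`
clamps its parameter, so preimages of sets of points may reach outside the edge. -/
theorem ClampStable.exists_near (hℓ : 0 ≤ ℓ) (hZ : ClampStable ℓ Z) {t r : ℝ} (ht : t ∈ Icc 0 ℓ)
    (htZ : t ∈ Metric.thickening r Z) : ∃ z ∈ Z, z ∈ Icc 0 ℓ ∧ |t - z| < r := by
  obtain ⟨z, hz, hzt⟩ := Metric.mem_thickening_iff.1 htZ
  refine ⟨_, hZ z hz, ⟨le_max_left _ _, max_le hℓ (min_le_left _ _)⟩, lt_of_le_of_lt ?_ hzt⟩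
  rw [Real.dist_eq]
  rcases le_total z 0 with h | h
  · rw [min_eq_right (h.trans hℓ), max_eq_left h, sub_zero, abs_of_nonneg ht.1]
    exact (le_sub_self_iff t).2 h |>.trans (le_abs_self _)
  · rcases le_total z ℓ with h2 | h2
    · rw [min_eq_right h2, max_eq_right h]
    · rw [min_eq_left h2, max_eq_right hℓ, abs_sub_comm, abs_of_nonneg (sub_nonneg.2 ht.2),
        abs_sub_comm]
      exact (sub_le_sub_right h2 t).trans (le_abs_self _)

/-- For t within r of a zero z, f(t) is the integral of g between z and t, so Cauchy–Schwarz bounds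
|f(t)|² by r times the integral of |g|² over the part of the neighbourhood within r of t.
Integrating in t and exchanging the integrals costs the length 2r of the window. The zero set may be
arbitrarily irregular. -/
theorem hardy_step (hℓ : 0 ≤ ℓ) (hZ : ClampStable ℓ Z) {f g : ℝ → ℝ} (hfg : IsPrim ℓ f g)
    (hf : ∀ t ∈ Icc 0 ℓ, t ∈ Z → f t = 0) {r : ℝ} :
    ∫⁻ t in Icc 0 ℓ ∩ Metric.thickening r Z, ‖f t‖ₑ ^ 2 ≤
      ENNReal.ofReal r * ENNReal.ofReal (2 * r) *
        ∫⁻ t in Icc 0 ℓ ∩ Metric.thickening r Z, ‖g t‖ₑ ^ 2 := by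
  set A := Icc 0 ℓ ∩ Metric.thickening r Z with hA
  have hAm : MeasurableSet A := measurableSet_Icc.inter Metric.isOpen_thickening.measurableSet
  have hgm : AEStronglyMeasurable g (volume.restrict A) :=
    hfg.1.aestronglyMeasurable.mono_measure (Measure.restrict_mono inter_subset_left le_rfl)
  let k : ℝ × ℝ → ℝ≥0∞ := {p : ℝ × ℝ | |p.2 - p.1| < r}.indicator 1
  have hkS : MeasurableSet {p : ℝ × ℝ | |p.2 - p.1| < r} :=
    measurableSet_lt (by fun_prop) measurable_const
  have hk : Measurable k := measurable_one.indicator hkS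
  have hpt : ∀ t ∈ A, ‖f t‖ₑ ^ 2 ≤ ENNReal.ofReal r * ∫⁻ s in A, k (t, s) * ‖g s‖ₑ ^ 2 := by
    intro t ht
    obtain ⟨z, hzZ, hzI, hzt⟩ := hZ.exists_near hℓ ht.1 ht.2
    have h1 : f t = ∫ s in z..t, g s := by
      rw [← hfg.sub_eq hzI ht.1, hf z hzI hzZ, sub_zero]
    have hIA : uIoc z t ⊆ A := by
      intro s hs
      have hs' := uIoc_subset_uIcc hs
      refine ⟨OrdConnected.uIcc_subset ordConnected_Icc hzI ht.1 hs', ?_⟩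
      rw [Metric.mem_thickening_iff]
      refine ⟨z, hzZ, lt_of_le_of_lt ?_ hzt⟩
      rw [Real.dist_eq]
      exact abs_sub_left_of_mem_uIcc hs'
    have h2 : ‖f t‖ₑ ≤ ∫⁻ s in uIoc z t, ‖g s‖ₑ := by
      have h4 : ‖f t‖ₑ = ‖∫ s in uIoc z t, g s‖ₑ := by
        rw [h1, ← ofReal_norm, intervalIntegral.norm_intervalIntegral_eq, ofReal_norm]
      rw [h4]
      exact enorm_integral_le_lintegral_enorm _
    have h3 : ∫⁻ s in uIoc z t, ‖g s‖ₑ ^ 2 ≤ ∫⁻ s in A, k (t, s) * ‖g s‖ₑ ^ 2 := by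
      calc ∫⁻ s in uIoc z t, ‖g s‖ₑ ^ 2 = ∫⁻ s in uIoc z t, k (t, s) * ‖g s‖ₑ ^ 2 := by
            refine setLIntegral_congr_fun measurableSet_uIoc fun s hs => ?_
            have : |s - t| < r := by
              have hs' := uIoc_subset_uIcc hs
              have := abs_sub_right_of_mem_uIcc hs'
              rw [abs_sub_comm]
              exact this.trans_lt (by rwa [abs_sub_comm] at hzt ⊢)
            simp [k, this]
        _ ≤ _ := lintegral_mono_set hIA
    calc ‖f t‖ₑ ^ 2 ≤ (∫⁻ s in uIoc z t, ‖g s‖ₑ) ^ 2 := by gcongr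
      _ ≤ volume (uIoc z t) * ∫⁻ s in uIoc z t, ‖g s‖ₑ ^ 2 :=
        sq_lintegral_le_measure_mul (hgm.mono_measure (Measure.restrict_mono hIA le_rfl))
      _ ≤ _ := by
        gcongr
        rw [Real.volume_uIoc]
        exact ENNReal.ofReal_le_ofReal hzt.le
  calc ∫⁻ t in A, ‖f t‖ₑ ^ 2
      ≤ ∫⁻ t in A, ENNReal.ofReal r * ∫⁻ s in A, k (t, s) * ‖g s‖ₑ ^ 2 :=
        setLIntegral_mono' hAm hpt
    _ = ENNReal.ofReal r * ∫⁻ t in A, ∫⁻ s in A, k (t, s) * ‖g s‖ₑ ^ 2 :=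
        lintegral_const_mul' _ _ ENNReal.ofReal_ne_top
    _ = ENNReal.ofReal r * ∫⁻ s in A, ∫⁻ t in A, k (t, s) * ‖g s‖ₑ ^ 2 := by
        rw [lintegral_lintegral_swap]
        exact hk.aemeasurable.mul ((hgm.enorm.pow_const 2).comp_snd)
    _ ≤ ENNReal.ofReal r * ∫⁻ s in A, ENNReal.ofReal (2 * r) * ‖g s‖ₑ ^ 2 := by
        gcongr with s
        have hks : Measurable fun t => k (t, s) := hk.comp (by fun_prop)
        rw [lintegral_mul_const _ hks]
        gcongr
        calc ∫⁻ t in A, k (t, s) ≤ ∫⁻ t, k (t, s) := setLIntegral_le_lintegral _ _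
          _ = ∫⁻ t, (Metric.ball s r).indicator 1 t := by
            refine lintegral_congr fun t => ?_
            simp only [k, indicator, mem_ofPred_eq, Metric.mem_ball, Real.dist_eq, abs_sub_comm]
            rfl
          _ = _ := by
            rw [lintegral_indicator_one measurableSet_ball, Real.volume_ball]
    _ = _ := by
        rw [lintegral_const_mul' _ _ ENNReal.ofReal_ne_top, mul_assoc]

/-- Each order of vanishing contributes a factor 2r² by `hardy_step`, so the squared norm on the
r-neighbourhood of `Z` is O(r^(2m)). -/
theorem VanishSob.hardy (hℓ : 0 ≤ ℓ) (hZ : ClampStable ℓ Z) {m : ℕ} {f : ℝ → ℝ}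
    (hf : VanishSob ℓ Z m f) : ∃ C : ℝ≥0∞, C ≠ ∞ ∧ ∀ r : ℝ, 0 < r →
      ∫⁻ t in Icc 0 ℓ ∩ Metric.thickening r Z, ‖f t‖ₑ ^ 2 ≤ C * ENNReal.ofReal (r ^ m) ^ 2 := by
  induction m generalizing f with
  | zero =>
    refine ⟨∫⁻ t in Icc 0 ℓ, ‖f t‖ₑ ^ 2, ?_, fun r _ => ?_⟩
    · have := (hf : MemLp f 2 _).2
      rw [eLpNorm_lt_top_iff_lintegral_rpow_enorm_lt_top (by norm_num) (by norm_num)] at this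
      simpa using this.ne
    · simpa using lintegral_mono_set (inter_subset_left)
  | succ m ih =>
    obtain ⟨h0, g, hg, hfg⟩ := hf
    obtain ⟨C, hC, H⟩ := ih hg
    refine ⟨2 * C, ENNReal.mul_ne_top (by simp) hC, fun r hr => ?_⟩
    refine (hardy_step hℓ hZ hfg h0).trans ?_
    calc ENNReal.ofReal r * ENNReal.ofReal (2 * r) *
          ∫⁻ t in Icc 0 ℓ ∩ Metric.thickening r Z, ‖g t‖ₑ ^ 2
        ≤ ENNReal.ofReal r * ENNReal.ofReal (2 * r) * (C * ENNReal.ofReal (r ^ m) ^ 2) := by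
          gcongr
          exact H r hr
      _ = _ := by
          rw [pow_succ r m, ENNReal.ofReal_mul (by positivity), ENNReal.ofReal_mul (by positivity),
            ENNReal.ofReal_ofNat]
          ring

/-- The convolution of the indicator function of `B` with `x ↦ ε⁻¹ ρ (x / ε)`. -/
def mollify (B : Set ℝ) (ε : ℝ) (ρ : ℝ → ℝ) : ℝ → ℝ :=
  convolution (B.indicator fun _ => (1 : ℝ)) (fun x => ε⁻¹ * ρ (ε⁻¹ * x))
    (ContinuousLinearMap.mul ℝ ℝ) volume

/-- A smooth function supported in `[-1, 1]`. -/
structure IsKernel (ρ : ℝ → ℝ) : Prop where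
  smooth : ContDiff ℝ (⊤ : ℕ∞) ρ
  supp : tsupport ρ ⊆ Icc (-1) 1

theorem IsKernel.hasCompactSupport {ρ : ℝ → ℝ} (hρ : IsKernel ρ) : HasCompactSupport ρ :=
  isCompact_Icc.of_isClosed_subset (isClosed_tsupport ρ) hρ.supp

theorem IsKernel.derivative {ρ : ℝ → ℝ} (hρ : IsKernel ρ) : IsKernel (deriv ρ) :=
  ⟨(contDiff_infty_iff_deriv.1 hρ.smooth).2, tsupport_deriv_subset.trans hρ.supp⟩

theorem IsKernel.integrable {ρ : ℝ → ℝ} (hρ : IsKernel ρ) : Integrable ρ :=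
  hρ.smooth.continuous.integrable_of_hasCompactSupport hρ.hasCompactSupport

theorem IsKernel.integral_deriv {ρ : ℝ → ℝ} (hρ : IsKernel ρ) : ∫ x, deriv ρ x = 0 :=
  integral_eq_zero_of_hasDerivAt_of_integrable
    (fun x => (hρ.smooth.differentiable (by simp) x).hasDerivAt) hρ.derivative.integrable hρ.integrable

theorem IsKernel.eq_zero {ρ : ℝ → ℝ} (hρ : IsKernel ρ) {x : ℝ} (hx : 1 < |x|) : ρ x = 0 := by
  by_contra h
  have := hρ.supp (subset_tsupport ρ h)
  exact absurd (abs_le.2 this) (not_le.2 hx)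

theorem exists_isKernel : ∃ ρ : ℝ → ℝ, IsKernel ρ ∧ ∫ x, ρ x = 1 := by
  let b : ContDiffBump (0 : ℝ) := ⟨1 / 2, 1, by norm_num, by norm_num⟩
  refine ⟨b.normed volume, ⟨b.contDiff_normed, ?_⟩, b.integral_normed⟩
  rw [b.tsupport_normed_eq, Real.closedBall_eq_Icc]
  norm_num [b]

theorem mollify_apply (B : Set ℝ) (ε : ℝ) (ρ : ℝ → ℝ) (t : ℝ) :
    mollify B ε ρ t = ∫ s, B.indicator (fun _ => (1 : ℝ)) s * (ε⁻¹ * ρ (ε⁻¹ * (t - s))) := by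
  rw [mollify, convolution_def]
  rfl

theorem integral_scaled {ε : ℝ} (hε : 0 < ε) (ρ : ℝ → ℝ) (t : ℝ) :
    ∫ s, ε⁻¹ * ρ (ε⁻¹ * (t - s)) = ∫ x, ρ x := by
  rw [integral_sub_left_eq_self (fun x => ε⁻¹ * ρ (ε⁻¹ * x)) volume t, integral_const_mul,
    Measure.integral_comp_mul_left, inv_inv, abs_of_pos hε, smul_eq_mul, inv_mul_cancel_left₀ hε.ne']

theorem mollify_eq {B : Set ℝ} {ε : ℝ} (hε : 0 < ε) {ρ : ℝ → ℝ} (hρ : IsKernel ρ) {t c : ℝ}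
    (h : ∀ s, |s - t| ≤ ε → B.indicator (fun _ => (1 : ℝ)) s = c) :
    mollify B ε ρ t = c * ∫ x, ρ x := by
  rw [mollify_apply, ← integral_scaled hε ρ t, ← integral_const_mul]
  refine integral_congr_ae (ae_of_all _ fun s => ?_)
  by_cases hs : |s - t| ≤ ε
  · simp only [h s hs]
  · have : ρ (ε⁻¹ * (t - s)) = 0 := by
      refine hρ.eq_zero ?_
      rw [abs_mul, abs_of_pos (inv_pos.2 hε), abs_sub_comm, inv_mul_eq_div, lt_div_iff₀ hε, one_mul]
      exact not_le.1 hs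
    simp [this]

theorem abs_mollify_le {B : Set ℝ} {ε : ℝ} (hε : 0 < ε) {ρ : ℝ → ℝ} (hρ : IsKernel ρ) (t : ℝ) :
    |mollify B ε ρ t| ≤ ∫ x, |ρ x| := by
  rw [mollify_apply, ← integral_scaled hε (fun x => |ρ x|) t]
  have hi : Integrable fun s => ε⁻¹ * |ρ (ε⁻¹ * (t - s))| := by
    have h1 : Integrable fun x => ε⁻¹ * |ρ (ε⁻¹ * x)| :=
      ((hρ.integrable.abs).comp_mul_left' (inv_pos.2 hε).ne').const_mul _
    exact (integrable_comp_sub_left _ t).2 h1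
  rw [← Real.norm_eq_abs]
  refine norm_integral_le_of_norm_le hi (ae_of_all _ fun s => ?_)
  rw [norm_mul, norm_mul, Real.norm_eq_abs (ε⁻¹), abs_of_pos (inv_pos.2 hε), Real.norm_eq_abs]
  refine mul_le_of_le_one_left (by positivity) ?_
  by_cases hs : s ∈ B <;> simp [hs]

/-- Differentiation costs a factor ε⁻¹ and replaces the kernel ρ by ρ', which has integral zero. For
this reason `IsKernel` does not fix the mass of the kernel. -/
theorem hasDerivAt_mollify {B : Set ℝ} (hB : MeasurableSet B) {ε : ℝ} (hε : 0 < ε) {ρ : ℝ → ℝ}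
    (hρ : IsKernel ρ) (t : ℝ) :
    HasDerivAt (mollify B ε ρ) (ε⁻¹ * mollify B ε (deriv ρ) t) t := by
  have hc : HasCompactSupport fun x => ε⁻¹ * ρ (ε⁻¹ * x) :=
    (hρ.hasCompactSupport.comp_homeomorph (Homeomorph.mulLeft₀ ε⁻¹ (inv_pos.2 hε).ne')).mul_left
  have hd : ∀ x, HasDerivAt (fun x => ε⁻¹ * ρ (ε⁻¹ * x)) (ε⁻¹ * (ε⁻¹ * deriv ρ (ε⁻¹ * x))) x := by
    intro x
    have h1 : HasDerivAt ρ (deriv ρ (ε⁻¹ * x)) (ε⁻¹ * x) :=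
      (hρ.smooth.differentiable (by simp) _).hasDerivAt
    have h2 := h1.comp x ((hasDerivAt_id x).const_mul ε⁻¹)
    refine (h2.const_mul ε⁻¹).congr_deriv ?_
    ring
  have hs : ContDiff ℝ 1 fun x => ε⁻¹ * ρ (ε⁻¹ * x) := by
    have := hρ.smooth.of_le (m := 1) (by simp)
    fun_prop
  have h := hc.hasDerivAt_convolution_right (ContinuousLinearMap.mul ℝ ℝ) (μ := volume)
    (f₀ := B.indicator fun _ => (1 : ℝ)) ((locallyIntegrable_const (1 : ℝ)).indicator hB) hs t
  refine h.congr_deriv ?_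
  rw [mollify_apply, convolution_def, ← integral_const_mul]
  refine integral_congr_ae (ae_of_all _ fun s => ?_)
  simp only [(hd _).deriv, ContinuousLinearMap.mul_apply']
  ring

theorem continuous_mollify {B : Set ℝ} (hB : MeasurableSet B) {ε : ℝ} (hε : 0 < ε) {ρ : ℝ → ℝ}
    (hρ : IsKernel ρ) : Continuous (mollify B ε ρ) :=
  continuous_iff_continuousAt.2 fun t => (hasDerivAt_mollify hB hε hρ t).continuousAt

theorem isPrim_mollify {B : Set ℝ} (hB : MeasurableSet B) {ε : ℝ} (hε : 0 < ε) {ρ : ℝ → ℝ}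
    (hρ : IsKernel ρ) : IsPrim ℓ (mollify B ε ρ) (fun t => ε⁻¹ * mollify B ε (deriv ρ) t) := by
  have hc : Continuous fun t => ε⁻¹ * mollify B ε (deriv ρ) t :=
    continuous_const.mul (continuous_mollify hB hε hρ.derivative)
  refine ⟨hc.continuousOn.integrableOn_compact isCompact_Icc, fun t _ => ?_⟩
  rw [intervalIntegral.integral_eq_sub_of_hasDerivAt
    (fun x _ => hasDerivAt_mollify hB hε hρ x) (hc.intervalIntegrable _ _)]
  ring

/-- The part of `S` at distance at least `2 ε` from `Z`. -/
def innerPart (S Z : Set ℝ) (ε : ℝ) : Set ℝ := S \ Metric.thickening (2 * ε) Z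

theorem measurableSet_innerPart (hS : IsOpen S) (ε : ℝ) : MeasurableSet (innerPart S Z ε) :=
  hS.measurableSet.diff Metric.isOpen_thickening.measurableSet

theorem notMem_thickening_of_mem_innerPart {ε s t : ℝ} (hs : s ∈ innerPart S Z ε)
    (hst : |s - t| ≤ ε) : t ∉ Metric.thickening ε Z := by
  intro ht
  obtain ⟨z, hz, hzt⟩ := Metric.mem_thickening_iff.1 ht
  refine hs.2 (Metric.mem_thickening_iff.2 ⟨z, hz, ?_⟩)
  rw [Real.dist_eq] at hzt ⊢
  calc |s - z| ≤ |s - t| + |t - z| := abs_sub_le _ _ _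
    _ < 2 * ε := by linarith

theorem mem_of_mem_innerPart (hSZ : frontier S ⊆ Z) {ε s t : ℝ} (hε : 0 < ε)
    (hs : s ∈ innerPart S Z ε) (hst : |s - t| ≤ ε) : t ∈ S := by
  by_contra ht
  obtain ⟨z, hz, hzf⟩ := exists_mem_frontier_uIcc hs.1 ht
  refine hs.2 (Metric.mem_thickening_iff.2 ⟨z, hSZ hzf, ?_⟩)
  have := abs_sub_left_of_mem_uIcc hz
  rw [Real.dist_eq, abs_sub_comm]
  rw [abs_sub_comm] at hst
  linarith

/-- The margin 3ε is the 2ε removed by `innerPart` plus the radius ε of the mollifier. A segment of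
length at most ε on which membership in `S` changes would meet the frontier of `S`, hence `Z`. -/
theorem mem_innerPart_iff (hSZ : frontier S ⊆ Z) {ε s t : ℝ} (hε : 0 < ε)
    (ht : t ∉ Metric.thickening (3 * ε) Z) (hst : |s - t| ≤ ε) : s ∈ innerPart S Z ε ↔ t ∈ S := by
  refine ⟨fun h => mem_of_mem_innerPart hSZ hε h hst, fun htS => ?_⟩
  have h1 : s ∉ Metric.thickening (2 * ε) Z := by
    intro h
    obtain ⟨z, hz, hzs⟩ := Metric.mem_thickening_iff.1 h
    refine ht (Metric.mem_thickening_iff.2 ⟨z, hz, ?_⟩)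
    rw [Real.dist_eq] at hzs ⊢
    rw [abs_sub_comm] at hst
    calc |t - z| ≤ |t - s| + |s - z| := abs_sub_le _ _ _
      _ < 3 * ε := by linarith
  refine ⟨?_, h1⟩
  by_contra hs
  obtain ⟨z, hz, hzf⟩ := exists_mem_frontier_uIcc htS hs
  refine ht (Metric.mem_thickening_iff.2 ⟨z, hSZ hzf, ?_⟩)
  have := abs_sub_left_of_mem_uIcc hz
  rw [Real.dist_eq, abs_sub_comm]
  linarith

open scoped Classical in
theorem mollify_innerPart_eq (hSZ : frontier S ⊆ Z) {ε t : ℝ} (hε : 0 < ε) {ρ : ℝ → ℝ}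
    (hρ : IsKernel ρ) (ht : t ∉ Metric.thickening (3 * ε) Z) :
    mollify (innerPart S Z ε) ε ρ t = (if t ∈ S then 1 else 0) * ∫ x, ρ x := by
  refine mollify_eq hε hρ fun s hs => ?_
  simp only [indicator, mem_innerPart_iff hSZ hε ht hs]

theorem mollify_innerPart_eq_zero (hSZ : frontier S ⊆ Z) {ε t : ℝ} (hε : 0 < ε) {ρ : ℝ → ℝ}
    (hρ : IsKernel ρ) (ht : t ∈ S → t ∈ Metric.thickening ε Z) :
    mollify (innerPart S Z ε) ε ρ t = 0 := by
  rw [mollify_eq hε hρ (c := 0) fun s hs => ?_, zero_mul]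
  refine indicator_of_notMem (fun hsB => ?_) _
  exact notMem_thickening_of_mem_innerPart hsB hs (ht (mem_of_mem_innerPart hSZ hε hsB hs))

/-- For m = 0 the cutoff is simply bounded. For m > 0 the kernel has integral zero, so the cutoff
lives in the 3ε-neighbourhood of `Z`, where Hardy's inequality gives f a norm of order (3ε)^m, which
cancels ε^(-m). -/
theorem VanishSob.bddLp_cutoff (hℓ : 0 ≤ ℓ) (hZ : ClampStable ℓ Z) (hS : IsOpen S)
    (hSZ : frontier S ⊆ Z) {m : ℕ} {ρ f : ℝ → ℝ} (hρ : IsKernel ρ)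
    (hm : m ≠ 0 → ∫ x, ρ x = 0) (hf : VanishSob ℓ Z m f) :
    BddLp ℓ 2 (fun (ε : {ε : ℝ // 0 < ε}) t =>
      (ε : ℝ)⁻¹ ^ m * mollify (innerPart S Z ε) ε ρ t * f t) := by
  set M := ∫ x, |ρ x| with hM
  have hM0 : 0 ≤ M := integral_nonneg fun _ => abs_nonneg _
  have hmeas : ∀ ε : {ε : ℝ // 0 < ε}, Continuous fun t =>
      (ε : ℝ)⁻¹ ^ m * mollify (innerPart S Z ε) ε ρ t := fun ε =>
    continuous_const.mul (continuous_mollify (measurableSet_innerPart hS _) ε.2 hρ)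
  have key : ∃ D : ℝ≥0∞, D ≠ ∞ ∧ ∀ ε : {ε : ℝ // 0 < ε}, ∫⁻ t in Icc 0 ℓ,
      ‖(ε : ℝ)⁻¹ ^ m * mollify (innerPart S Z ε) ε ρ t * f t‖ₑ ^ 2 ≤ D := by
    rcases eq_or_ne m 0 with rfl | hm0
    · refine ⟨ENNReal.ofReal M ^ 2 * ∫⁻ t in Icc 0 ℓ, ‖f t‖ₑ ^ 2, ?_, fun ε => ?_⟩
      · have := (hf : MemLp f 2 _).2
        rw [eLpNorm_lt_top_iff_lintegral_rpow_enorm_lt_top (by norm_num) (by norm_num)] at this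
        exact ENNReal.mul_ne_top (by simp) (by simpa using this.ne)
      · rw [← lintegral_const_mul' _ _ (by simp)]
        refine lintegral_mono fun t => ?_
        rw [pow_zero, one_mul, enorm_mul, mul_pow]
        gcongr
        rw [Real.enorm_eq_ofReal_abs]
        exact ENNReal.ofReal_le_ofReal (abs_mollify_le ε.2 hρ t)
    · obtain ⟨C, hC, H⟩ := hf.hardy hℓ hZ
      refine ⟨ENNReal.ofReal (3 ^ m * M) ^ 2 * C, ENNReal.mul_ne_top
        (ENNReal.pow_ne_top ENNReal.ofReal_ne_top) hC, fun ε => ?_⟩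
      have hε := ε.2
      have h1 : ∀ t ∈ Icc 0 ℓ, ‖(ε : ℝ)⁻¹ ^ m * mollify (innerPart S Z ε) ε ρ t * f t‖ₑ ^ 2 ≤
          (Metric.thickening (3 * (ε : ℝ)) Z).indicator
            (fun t => ENNReal.ofReal ((ε : ℝ)⁻¹ ^ m * M) ^ 2 * ‖f t‖ₑ ^ 2) t := by
        intro t _
        by_cases htZ : t ∈ Metric.thickening (3 * (ε : ℝ)) Z
        · rw [indicator_of_mem htZ, enorm_mul, mul_pow]
          gcongr
          rw [Real.enorm_eq_ofReal_abs, abs_mul, abs_of_pos (by positivity)]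
          refine ENNReal.ofReal_le_ofReal ?_
          gcongr
          exact abs_mollify_le ε.2 hρ t
        · rw [mollify_innerPart_eq hSZ ε.2 hρ htZ, hm hm0]
          simp
      calc _ ≤ ∫⁻ t in Icc 0 ℓ, (Metric.thickening (3 * (ε : ℝ)) Z).indicator
            (fun t => ENNReal.ofReal ((ε : ℝ)⁻¹ ^ m * M) ^ 2 * ‖f t‖ₑ ^ 2) t :=
            setLIntegral_mono' measurableSet_Icc h1
        _ = ENNReal.ofReal ((ε : ℝ)⁻¹ ^ m * M) ^ 2 *
            ∫⁻ t in Icc 0 ℓ ∩ Metric.thickening (3 * (ε : ℝ)) Z, ‖f t‖ₑ ^ 2 := by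
            rw [lintegral_indicator Metric.isOpen_thickening.measurableSet,
              Measure.restrict_restrict Metric.isOpen_thickening.measurableSet, inter_comm,
              lintegral_const_mul' _ _ (by simp)]
        _ ≤ ENNReal.ofReal ((ε : ℝ)⁻¹ ^ m * M) ^ 2 *
            (C * ENNReal.ofReal ((3 * (ε : ℝ)) ^ m) ^ 2) := by
            gcongr
            exact H _ (by positivity)
        _ = _ := by
            have h3 : 3 ^ m * M = ((ε : ℝ)⁻¹ ^ m * M) * (3 * (ε : ℝ)) ^ m := by
              rw [mul_pow, inv_pow]
              field_simp
            rw [h3, ENNReal.ofReal_mul (p := _ * M) (by positivity)]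
            ring
  obtain ⟨D, hD, H⟩ := key
  have hnorm : ∀ ε : {ε : ℝ // 0 < ε}, eLpNorm (fun t =>
      (ε : ℝ)⁻¹ ^ m * mollify (innerPart S Z ε) ε ρ t * f t) 2 (volume.restrict (Icc 0 ℓ)) ≤
      D ^ (1 / 2 : ℝ) := by
    intro ε
    rw [eLpNorm_eq_lintegral_rpow_enorm_toReal (by norm_num) (by norm_num)]
    simp only [ENNReal.toReal_ofNat, ENNReal.rpow_ofNat]
    exact ENNReal.rpow_le_rpow (H ε) (by norm_num)
  have hD2 : D ^ (1 / 2 : ℝ) ≠ ∞ := ENNReal.rpow_ne_top_of_nonneg (by norm_num) hD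
  refine ⟨(D ^ (1 / 2 : ℝ)).toNNReal, fun ε => ⟨⟨?_, (hnorm ε).trans_lt hD2.lt_top⟩, ?_⟩⟩
  · exact (hmeas ε).aestronglyMeasurable.mul (hf.memLp hℓ).1
  · rw [ENNReal.coe_toNNReal hD2]
    exact hnorm ε

/-- Multiplying a function that vanishes to order `m + n` on `Z` by `ε ^ (-m)` times a cutoff at
distance `ε` from `Z` gives a bounded family in `H^n`. -/
theorem VanishSob.bddSob_cutoff (hℓ : 0 ≤ ℓ) (hZ : ClampStable ℓ Z) (hS : IsOpen S)
    (hSZ : frontier S ⊆ Z) {m n : ℕ} {ρ f : ℝ → ℝ} (hρ : IsKernel ρ)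
    (hm : m ≠ 0 → ∫ x, ρ x = 0) (hf : VanishSob ℓ Z (m + n) f) :
    BddSob ℓ 2 n (fun (ε : {ε : ℝ // 0 < ε}) t =>
      (ε : ℝ)⁻¹ ^ m * mollify (innerPart S Z ε) ε ρ t * f t) := by
  induction n generalizing m ρ f with
  | zero => exact hf.bddLp_cutoff hℓ hZ hS hSZ hρ hm
  | succ n ih =>
    refine ⟨(hf.of_le hℓ (Nat.le_add_right m (n + 1))).bddLp_cutoff hℓ hZ hS hSZ hρ hm, ?_⟩
    have hf' : VanishSob ℓ Z (m + 1 + n) f := by rwa [Nat.add_right_comm]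
    obtain ⟨_, g, hg, hfg⟩ := hf
    -- Leibniz: the derivative falls either on the cutoff, giving order m + 1 with kernel ρ' and the
    -- same f, or on f, giving order m with the derivative g. In both cases the total order of
    -- vanishing suffices for n remaining derivatives.
    refine ⟨_, (ih hρ.derivative (fun _ => hρ.integral_deriv) hf').add hℓ (by norm_num) (ih hρ hm hg),
      fun ε => ?_⟩
    have h1 := ((isPrim_mollify (ℓ := ℓ) (measurableSet_innerPart (Z := Z) hS ε) ε.2 hρ).const_mul hℓ
      ((ε : ℝ)⁻¹ ^ m)).mul hℓ hfg
    refine h1.congr (fun t _ => rfl) (ae_of_all _ fun t => ?_)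
    simp only []
    ring

end Cutoff

end

noncomputable section

/-! ### The Volterra operator -/

section Volterra

variable {ℓ : ℝ}

/-- `L₂(0, ℓ)`. -/
abbrev LTwo (ℓ : ℝ) : Type := Lp ℝ 2 (volume.restrict (Icc (0 : ℝ) ℓ))

theorem LTwo.integrableOn (g : LTwo ℓ) : IntegrableOn g (Icc 0 ℓ) :=
  (Lp.memLp g).integrable (by norm_num)

theorem LTwo.intervalIntegrable (g : LTwo ℓ) {s t : ℝ} (hs : s ∈ Icc 0 ℓ) (ht : t ∈ Icc 0 ℓ) :
    IntervalIntegrable g volume s t := by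
  rw [intervalIntegrable_iff]
  exact g.integrableOn.mono_set
    (uIoc_subset_uIcc.trans (OrdConnected.uIcc_subset ordConnected_Icc hs ht))

theorem Ioc_inter_Icc_of_mem {s t : ℝ} (hs : s ∈ Icc 0 ℓ) (ht : t ∈ Icc 0 ℓ) :
    Ioc s t ∩ Icc 0 ℓ = Ioc s t :=
  inter_eq_left.2 fun _ hx => ⟨hs.1.trans hx.1.le, hx.2.trans ht.2⟩

/-- Integration over `(s, t]` as a functional on `L₂(0, ℓ)`. -/
def integralL (ℓ s t : ℝ) : LTwo ℓ →L[ℝ] ℝ :=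
  innerSL ℝ (indicatorConstLp 2 (measurableSet_Ioc (a := s) (b := t)) (measure_ne_top _ _) (1 : ℝ))

theorem integralL_apply {s t : ℝ} (hs : s ∈ Icc 0 ℓ) (ht : t ∈ Icc 0 ℓ) (hst : s ≤ t)
    (g : LTwo ℓ) : integralL ℓ s t g = ∫ r in s..t, g r := by
  rw [integralL, innerSL_apply_apply, L2.inner_indicatorConstLp_one,
    intervalIntegral.integral_of_le hst, Measure.restrict_restrict measurableSet_Ioc,
    Ioc_inter_Icc_of_mem hs ht]

/-- Cauchy–Schwarz: primitives of L₂ functions are Hölder continuous of exponent 1/2. This is the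
source of compactness below. -/
theorem abs_integral_le {s t : ℝ} (hs : s ∈ Icc 0 ℓ) (ht : t ∈ Icc 0 ℓ) (hst : s ≤ t)
    (g : LTwo ℓ) : |∫ r in s..t, g r| ≤ (t - s) ^ (1 / 2 : ℝ) * ‖g‖ := by
  rw [← integralL_apply hs ht hst, integralL, innerSL_apply_apply]
  refine (norm_inner_le_norm (𝕜 := ℝ) _ _).trans ?_
  gcongr
  rw [norm_indicatorConstLp (by norm_num) (by norm_num), norm_one, one_mul, measureReal_def,
    Measure.restrict_apply measurableSet_Ioc,
    Ioc_inter_Icc_of_mem hs ht, Real.volume_Ioc,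
    ENNReal.toReal_ofReal (sub_nonneg.2 hst)]
  norm_num

theorem LTwo.isPrim (c : ℝ) (g : LTwo ℓ) :
    IsPrim ℓ (fun t => c + ∫ r in (0 : ℝ)..t, g r) g :=
  ⟨g.integrableOn, fun t _ => by simp⟩

/-- The Volterra operator `g ↦ ∫₀ᵗ g`. -/
def volterra (ℓ : ℝ) (hℓ : 0 ≤ ℓ) : LTwo ℓ →L[ℝ] LTwo ℓ :=
  LinearMap.mkContinuous
    { toFun := fun g => ((g.isPrim 0).continuousOn hℓ).memLp_Icc.toLp _
      map_add' := fun f g => by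
        rw [← MemLp.toLp_add]
        refine MemLp.toLp_congr _ _ ((ae_restrict_iff' measurableSet_Icc).2 (ae_of_all _ ?_))
        intro t ht
        simp only [Pi.add_apply, zero_add]
        have h0 : (0 : ℝ) ∈ Icc 0 ℓ := left_mem_Icc.2 hℓ
        rw [← intervalIntegral.integral_add (f.intervalIntegrable h0 ht)
          (g.intervalIntegrable h0 ht)]
        refine intervalIntegral.integral_congr_ae ?_
        filter_upwards [(ae_restrict_iff' measurableSet_Icc).1 (Lp.coeFn_add f g)] with x hx hxI
        rw [uIoc_of_le ht.1] at hxI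
        exact hx ⟨hxI.1.le, hxI.2.trans ht.2⟩
      map_smul' := fun c g => by
        rw [RingHom.id_apply, ← MemLp.toLp_const_smul]
        refine MemLp.toLp_congr _ _ ((ae_restrict_iff' measurableSet_Icc).2 (ae_of_all _ ?_))
        intro t ht
        simp only [Pi.smul_apply, zero_add]
        rw [← intervalIntegral.integral_smul]
        refine intervalIntegral.integral_congr_ae ?_
        filter_upwards [(ae_restrict_iff' measurableSet_Icc).1 (Lp.coeFn_smul c g)] with x hx hxI
        rw [uIoc_of_le ht.1] at hxI
        exact hx ⟨hxI.1.le, hxI.2.trans ht.2⟩ }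
    ((measureUnivNNReal (volume.restrict (Icc (0 : ℝ) ℓ)) : ℝ) ^ (2 : ℝ≥0∞).toReal⁻¹ *
      ℓ ^ (1 / 2 : ℝ))
    (fun g => by
      rw [mul_assoc]
      refine Lp.norm_le_of_ae_bound (by positivity) ?_
      filter_upwards [MemLp.coeFn_toLp ((g.isPrim 0).continuousOn hℓ).memLp_Icc,
        ae_restrict_mem measurableSet_Icc] with t ht htI
      change ‖(MemLp.toLp _ ((g.isPrim 0).continuousOn hℓ).memLp_Icc : LTwo ℓ) t‖ ≤ _
      rw [ht, zero_add, Real.norm_eq_abs]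
      refine (abs_integral_le (left_mem_Icc.2 hℓ) htI htI.1 g).trans ?_
      rw [sub_zero]
      gcongr
      exacts [htI.1, htI.2])

theorem coeFn_volterra (hℓ : 0 ≤ ℓ) (g : LTwo ℓ) :
    volterra ℓ hℓ g =ᵐ[volume.restrict (Icc 0 ℓ)] fun t => ∫ r in (0 : ℝ)..t, g r := by
  refine (MemLp.coeFn_toLp ((g.isPrim 0).continuousOn hℓ).memLp_Icc).trans ?_
  simp

theorem isCompactOperator_smulRight {X Y : Type*} [NormedAddCommGroup X] [NormedSpace ℝ X]
    [NormedAddCommGroup Y] [NormedSpace ℝ Y] (c : X →L[ℝ] ℝ) (y : Y) :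
    IsCompactOperator (c.smulRight y) := by
  exact (isCompactOperator_of_locallyCompactSpace_dom c).clm_comp
    (ContinuousLinearMap.toSpanSingleton ℝ y)

/-- Step function approximations of the Volterra operator. -/
def volterraStep (ℓ : ℝ) (N : ℕ) : LTwo ℓ →L[ℝ] LTwo ℓ :=
  ∑ i ∈ Finset.range (N + 1), (integralL ℓ 0 (i * (ℓ / (N + 1)))).smulRight
    (indicatorConstLp 2 (measurableSet_Ico (a := i * (ℓ / (N + 1))) (b := (i + 1) * (ℓ / (N + 1))))
      (measure_ne_top _ _) (1 : ℝ))

theorem isCompactOperator_volterraStep (ℓ : ℝ) (N : ℕ) :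
    IsCompactOperator (volterraStep ℓ N) := by
  unfold volterraStep
  induction Finset.range (N + 1) using Finset.induction_on with
  | empty => simpa using isCompactOperator_zero
  | insert a s ha ih =>
    rw [Finset.sum_insert ha]
    exact (isCompactOperator_smulRight _ _).add ih

/-- On each cell of length ℓ / (N + 1) the step operator takes the value of the primitive at the
left end, so the Hölder bound controls the error. The Volterra operator is thus a norm limit of
finite rank operators. -/
theorem norm_volterra_sub_step_le (hℓ : 0 < ℓ) (N : ℕ) :
    ‖volterra ℓ hℓ.le - volterraStep ℓ N‖ ≤
      (measureUnivNNReal (volume.restrict (Icc (0 : ℝ) ℓ)) : ℝ) ^ (2 : ℝ≥0∞).toReal⁻¹ *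
        (ℓ / (N + 1)) ^ (1 / 2 : ℝ) := by
  refine ContinuousLinearMap.opNorm_le_bound _ (by positivity) fun g => ?_
  rw [mul_assoc]
  refine Lp.norm_le_of_ae_bound (by positivity) ?_
  set δ := ℓ / (N + 1) with hδ
  have hδ0 : 0 < δ := by positivity
  have hδN : ((N : ℝ) + 1) * δ = ℓ := by rw [hδ]; field_simp
  have h1 : ∀ᵐ t ∂(volume.restrict (Icc (0 : ℝ) ℓ)), ∀ i : ℕ,
      (((integralL ℓ 0 (i * δ)) g • indicatorConstLp 2
        (measurableSet_Ico (a := i * δ) (b := (i + 1) * δ)) (measure_ne_top _ _) (1 : ℝ) :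
          LTwo ℓ) : ℝ → ℝ) t =
      integralL ℓ 0 (i * δ) g * (Ico (i * δ) ((i + 1) * δ)).indicator (fun _ => (1 : ℝ)) t := by
    rw [ae_all_iff]
    intro i
    filter_upwards [Lp.coeFn_smul (integralL ℓ 0 (i * δ) g) (indicatorConstLp 2
        (measurableSet_Ico (a := i * δ) (b := (i + 1) * δ)) (measure_ne_top _ _) (1 : ℝ)),
      indicatorConstLp_coeFn (p := 2) (μ := volume.restrict (Icc (0 : ℝ) ℓ))
        (hs := measurableSet_Ico (a := i * δ) (b := (i + 1) * δ)) (hμs := measure_ne_top _ _)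
        (c := (1 : ℝ))] with t ht ht2
    rw [ht, Pi.smul_apply, ht2, smul_eq_mul]
  have h2 := Lp.coeFn_fun_finsetSum (p := 2) (μ := volume.restrict (Icc (0 : ℝ) ℓ))
    (Finset.range (N + 1)) (fun i : ℕ =>
    (integralL ℓ 0 (i * δ) g • indicatorConstLp 2
        (measurableSet_Ico (a := i * δ) (b := (i + 1) * δ)) (measure_ne_top _ _) (1 : ℝ) : LTwo ℓ))
  have hnl : ∀ᵐ x ∂(volume.restrict (Icc (0 : ℝ) ℓ)), x ≠ ℓ :=
    ae_restrict_of_ae (by simp [ae_iff, measure_singleton])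
  have h3 := Lp.coeFn_sub (volterra ℓ hℓ.le g) (volterraStep ℓ N g)
  have h4 : volterraStep ℓ N g = ∑ i ∈ Finset.range (N + 1),
      (integralL ℓ 0 (i * δ) g • indicatorConstLp 2
        (measurableSet_Ico (a := i * δ) (b := (i + 1) * δ)) (measure_ne_top _ _) (1 : ℝ) : LTwo ℓ)
      := by
    rw [volterraStep, sum_apply]
    rfl
  filter_upwards [h1, h2, h3, hnl, coeFn_volterra hℓ.le g, ae_restrict_mem measurableSet_Icc]
    with t h1 h2 h3 hnl h5 htI
  rw [sub_apply, h3, Pi.sub_apply, h5, h4, h2]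
  -- The index of the only cell containing t. The point t = ℓ lies in no cell and was discarded as a
  -- null set.
  set j := ⌊t / δ⌋₊ with hj
  have hj1 : (j : ℝ) * δ ≤ t := by
    rw [← le_div_iff₀ hδ0]
    exact Nat.floor_le (div_nonneg htI.1 hδ0.le)
  have hj2 : t < (j + 1) * δ := by
    rw [← div_lt_iff₀ hδ0]
    exact Nat.lt_floor_add_one _
  have hjN : j ∈ Finset.range (N + 1) := by
    rw [Finset.mem_range]
    have : (j : ℝ) * δ < ((N : ℝ) + 1) * δ := by
      rw [hδN]
      exact hj1.trans_lt (lt_of_le_of_ne htI.2 hnl)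
    exact_mod_cast lt_of_mul_lt_mul_right this hδ0.le
  rw [Finset.sum_eq_single_of_mem j hjN]
  · have hjI : (j : ℝ) * δ ∈ Icc 0 ℓ := ⟨by positivity, hj1.trans htI.2⟩
    have h0 : (0 : ℝ) ∈ Icc 0 ℓ := left_mem_Icc.2 hℓ.le
    rw [h1 j, indicator_of_mem (show t ∈ Ico ((j : ℝ) * δ) (((j : ℝ) + 1) * δ) from ⟨hj1, hj2⟩), mul_one, integralL_apply h0 hjI hjI.1,
      intervalIntegral.integral_interval_sub_left (g.intervalIntegrable h0 htI)
      (g.intervalIntegrable h0 hjI), Real.norm_eq_abs]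
    refine (abs_integral_le hjI htI hj1 g).trans ?_
    gcongr
    · linarith
  · intro i _ hij
    rw [h1 i, indicator_of_notMem, mul_zero]
    rintro ⟨ha, hb⟩
    apply hij
    have e1 : (i : ℝ) < j + 1 := lt_of_mul_lt_mul_right (ha.trans_lt hj2) hδ0.le
    have e2 : (j : ℝ) < i + 1 := lt_of_mul_lt_mul_right (hj1.trans_lt hb) hδ0.le
    have e1' : i < j + 1 := by exact_mod_cast e1
    have e2' : j < i + 1 := by exact_mod_cast e2
    omega

theorem isCompactOperator_volterra (hℓ : 0 < ℓ) : IsCompactOperator (volterra ℓ hℓ.le) := by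
  refine isCompactOperator_of_tendsto (l := atTop) (F := fun N : ℕ => volterraStep ℓ N) ?_
    (Eventually.of_forall fun N => isCompactOperator_volterraStep ℓ N)
  rw [tendsto_iff_norm_sub_tendsto_zero]
  refine squeeze_zero (fun _ => norm_nonneg _) (fun N => ?_) ?_
    (g := fun N : ℕ => (measureUnivNNReal (volume.restrict (Icc (0 : ℝ) ℓ)) : ℝ) ^
      (2 : ℝ≥0∞).toReal⁻¹ * (ℓ / (N + 1)) ^ (1 / 2 : ℝ))
  · rw [norm_sub_rev]
    exact norm_volterra_sub_step_le hℓ N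
  · have h1 : Tendsto (fun N : ℕ => ℓ / ((N : ℝ) + 1)) atTop (𝓝 0) :=
      tendsto_const_nhds.div_atTop (tendsto_atTop_add_const_right _ _ tendsto_natCast_atTop_atTop)
    have h2 := (h1.rpow_const (p := 1 / 2) (Or.inr (by norm_num))).const_mul
      ((measureUnivNNReal (volume.restrict (Icc (0 : ℝ) ℓ)) : ℝ) ^ (2 : ℝ≥0∞).toReal⁻¹)
    simpa using h2

/-- Multiplication by a bounded function on `L₂(0, ℓ)`. -/
def mulL (b : ℝ → ℝ) (hb : MemLp b ∞ (volume.restrict (Icc 0 ℓ))) : LTwo ℓ →L[ℝ] LTwo ℓ :=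
  (ContinuousLinearMap.mul ℝ ℝ).holderL (volume.restrict (Icc 0 ℓ)) ∞ 2 2 (hb.toLp b)

theorem coeFn_mulL (b : ℝ → ℝ) (hb : MemLp b ∞ (volume.restrict (Icc 0 ℓ))) (g : LTwo ℓ) :
    mulL b hb g =ᵐ[volume.restrict (Icc 0 ℓ)] fun t => b t * g t := by
  refine ((ContinuousLinearMap.mul ℝ ℝ).coeFn_holder (r := 2) (hb.toLp b) g).trans ?_
  filter_upwards [hb.coeFn_toLp] with t ht
  simp [ht]

end Volterra

end

noncomputable section

/-! ### Lemmas of du Bois-Reymond type -/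

section DuBoisReymond

variable {ℓ : ℝ}

theorem MemLp.integrableOn_Icc {f : ℝ → ℝ} (hf : MemLp f 2 (volume.restrict (Icc 0 ℓ))) :
    IntegrableOn f (Icc 0 ℓ) :=
  hf.integrable (by norm_num)

theorem MemLp.integrable_mul_Icc {f g : ℝ → ℝ} (hf : MemLp f 2 (volume.restrict (Icc 0 ℓ)))
    (hg : MemLp g 2 (volume.restrict (Icc 0 ℓ))) :
    Integrable (fun t => f t * g t) (volume.restrict (Icc 0 ℓ)) :=
  hf.integrable_mul hg

theorem IsPrim.of_integrableOn {g : ℝ → ℝ} (hg : IntegrableOn g (Icc 0 ℓ)) (c : ℝ) :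
    IsPrim ℓ (fun t => c + ∫ s in (0 : ℝ)..t, g s) g :=
  ⟨hg, fun t _ => by simp⟩

theorem IsPrim.memLp (hℓ : 0 ≤ ℓ) {f g : ℝ → ℝ} {p : ℝ≥0∞} (h : IsPrim ℓ f g) :
    MemLp f p (volume.restrict (Icc 0 ℓ)) :=
  (h.continuousOn hℓ).memLp_Icc

/-- Du Bois-Reymond. With F a primitive of `H` and m the mean of D - F, the function β' = D - F - m
has a primitive β vanishing at both ends. Testing against it and integrating by parts gives ∫ β'² =
0, so D = F + m. -/
theorem exists_isPrim_of_orthogonal (hℓ : 0 < ℓ) {D H : ℝ → ℝ}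
    (hD : MemLp D 2 (volume.restrict (Icc 0 ℓ))) (hH : MemLp H 2 (volume.restrict (Icc 0 ℓ)))
    (h : ∀ β β' : ℝ → ℝ, MemLp β' 2 (volume.restrict (Icc 0 ℓ)) → IsPrim ℓ β β' → β 0 = 0 →
      β ℓ = 0 → ∫ t in Icc 0 ℓ, (D t * β' t + H t * β t) = 0) :
    ∃ f, IsPrim ℓ f H ∧ D =ᵐ[volume.restrict (Icc 0 ℓ)] f := by
  obtain ⟨F, hF⟩ : ∃ F, IsPrim ℓ F H := ⟨_, IsPrim.of_integrableOn (MemLp.integrableOn_Icc hH) 0⟩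
  have hFL : MemLp F 2 (volume.restrict (Icc 0 ℓ)) := hF.memLp hℓ.le
  set m := ℓ⁻¹ * ∫ t in Icc 0 ℓ, (D t - F t) with hm
  have hβL : MemLp (fun t => D t - F t - m) 2 (volume.restrict (Icc 0 ℓ)) :=
    (hD.sub hFL).sub (memLp_const m)
  have hDF : IntegrableOn (fun t => D t - F t) (Icc 0 ℓ) := MemLp.integrableOn_Icc (hD.sub hFL)
  have hβ := IsPrim.of_integrableOn (MemLp.integrableOn_Icc hβL) 0
  set β' := fun t => D t - F t - m with hβ'
  set β := fun t => 0 + ∫ s in (0 : ℝ)..t, β' s with hβd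
  have hβ0 : β 0 = 0 := by simp [hβd]
  have hi0 : ∫ t in Icc 0 ℓ, β' t = 0 := by
    rw [hβ', integral_sub hDF (integrable_const _), integral_const, hm]
    simp [hℓ.le, hℓ.ne']
  have hβℓ : β ℓ = 0 := by
    simp only [hβd, zero_add]
    rw [intervalIntegral.integral_of_le hℓ.le, ← integral_Icc_eq_integral_Ioc, hi0]
  have h1 := h β β' hβL hβ hβ0 hβℓ
  have h2 := IsPrim.integral_mul_add hℓ.le hF hβ
  rw [hβ0, hβℓ, mul_zero, mul_zero, sub_zero] at h2
  have hβm : MemLp β 2 (volume.restrict (Icc 0 ℓ)) := hβ.memLp hℓ.le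
  have i1 : IntegrableOn (fun t => D t * β' t + H t * β t) (Icc 0 ℓ) :=
    (MemLp.integrable_mul_Icc hD hβL).add (MemLp.integrable_mul_Icc hH hβm)
  have i2 : IntegrableOn (fun t => H t * β t + F t * β' t) (Icc 0 ℓ) :=
    (MemLp.integrable_mul_Icc hH hβm).add (MemLp.integrable_mul_Icc hFL hβL)
  have i3 : IntegrableOn (fun t => m * β' t) (Icc 0 ℓ) := (MemLp.integrableOn_Icc hβL).const_mul m
  have h3 : ∫ t in Icc 0 ℓ, β' t ^ 2 = 0 := by
    calc ∫ t in Icc 0 ℓ, β' t ^ 2 = ∫ t in Icc 0 ℓ, ((D t * β' t + H t * β t) -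
          (H t * β t + F t * β' t) - m * β' t) := by
          refine integral_congr_ae (ae_of_all _ fun t => ?_)
          simp only [hβ']
          ring
      _ = 0 := by
          have i12 : Integrable (fun t => (D t * β' t + H t * β t) -
              (H t * β t + F t * β' t)) (volume.restrict (Icc 0 ℓ)) := i1.sub i2
          rw [integral_sub i12 i3, integral_sub i1 i2, h1, h2, integral_const_mul, hi0]
          ring
  rw [integral_eq_zero_iff_of_nonneg (fun t => sq_nonneg _) hβL.integrable_sq] at h3
  refine ⟨fun t => m + F t, ?_, ?_⟩
  · have := (IsPrim.const (ℓ := ℓ) m).add hℓ.le hF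
    simpa using this
  · filter_upwards [h3] with t ht
    have : β' t = 0 := by simpa using ht
    simp only [hβ'] at this
    linarith

/-- The primitive vanishes to the left of the support of χ, and to its right because χ has integral
zero; it is again a test function. -/
theorem exists_hasDerivAt_of_integral_eq_zero {χ : ℝ → ℝ} (hχ : ContDiff ℝ (⊤ : ℕ∞) χ)
    (hc : HasCompactSupport χ) (hs : tsupport χ ⊆ Ioo 0 ℓ) (h0 : ∫ t, χ t = 0) :
    ∃ ψ : ℝ → ℝ, ContDiff ℝ (⊤ : ℕ∞) ψ ∧ HasCompactSupport ψ ∧ tsupport ψ ⊆ Ioo 0 ℓ ∧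
      deriv ψ = χ := by
  rcases (tsupport χ).eq_empty_or_nonempty with he | hne
  · refine ⟨fun _ => 0, contDiff_const, HasCompactSupport.zero, by simp [tsupport], ?_⟩
    rw [tsupport_eq_empty_iff] at he
    simp [he]
    rfl
  obtain ⟨a, ha⟩ := hc.exists_isLeast hne
  obtain ⟨b, hb⟩ := hc.exists_isGreatest hne
  have haI := hs ha.1
  have hbI := hs hb.1
  have hz : ∀ t, t ∉ Icc a b → χ t = 0 := fun t ht => by
    by_contra h
    have := subset_tsupport χ h
    exact ht ⟨ha.2 this, hb.2 this⟩
  have hd : ∀ t, HasDerivAt (fun t => ∫ s in (0 : ℝ)..t, χ s) (χ t) t := fun t =>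
    intervalIntegral.integral_hasDerivAt_right (hχ.continuous.intervalIntegrable _ _)
      (hχ.continuous.stronglyMeasurableAtFilter _ _) hχ.continuous.continuousAt
  have hder : deriv (fun t => ∫ s in (0 : ℝ)..t, χ s) = χ := funext fun t => (hd t).deriv
  have hsupp : Function.support (fun t => ∫ s in (0 : ℝ)..t, χ s) ⊆ Icc a b := by
    intro t ht
    by_contra h
    apply ht
    rcases lt_or_ge t a with hta | hta
    · refine intervalIntegral.integral_zero_ae (ae_of_all _ fun x hx => hz x fun hxI => ?_)
      rcases hx with ⟨_, hx2⟩
      exact absurd (hxI.1.trans hx2) (not_le.2 (max_lt haI.1 hta))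
    · have htb : b < t := by
        by_contra h'
        exact h ⟨hta, not_lt.1 h'⟩
      change ∫ s in (0 : ℝ)..t, χ s = 0
      rw [intervalIntegral.integral_eq_integral_of_support_subset, h0]
      intro x hx
      by_contra hxn
      refine hx (hz x fun hxI => hxn ⟨haI.1.trans_le hxI.1, hxI.2.trans htb.le⟩)
  have hts : tsupport (fun t => ∫ s in (0 : ℝ)..t, χ s) ⊆ Icc a b :=
    closure_minimal hsupp isClosed_Icc
  refine ⟨fun t => ∫ s in (0 : ℝ)..t, χ s, ?_,
    isCompact_Icc.of_isClosed_subset (isClosed_tsupport _) hts,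
    hts.trans (Icc_subset_Ioo haI.1 hbI.2), hder⟩
  rw [contDiff_infty_iff_deriv, hder]
  exact ⟨fun t => (hd t).differentiableAt, hχ⟩

/-- With F a primitive of g, f - F is orthogonal to derivatives of test functions, that is, to test
functions of integral zero. Subtracting from any test function its integral times a fixed bump φ₀
reduces to this case, so f - F is almost everywhere the constant m. -/
theorem MetricGraph.IsWeakDeriv.exists_isPrim (hℓ : 0 < ℓ) {f g : ℝ → ℝ}
    (h : MetricGraph.IsWeakDeriv ℓ f g) :
    ∃ F, IsPrim ℓ F g ∧ f =ᵐ[volume.restrict (Icc 0 ℓ)] F := by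
  obtain ⟨hf, hg, h⟩ := h
  obtain ⟨F, hF⟩ : ∃ F, IsPrim ℓ F g := ⟨_, IsPrim.of_integrableOn (MemLp.integrableOn_Icc hg) 0⟩
  have hFL : MemLp F 2 (volume.restrict (Icc 0 ℓ)) := hF.memLp hℓ.le
  let B : ContDiffBump (ℓ / 2) := ⟨ℓ / 8, ℓ / 4, by positivity, by linarith⟩
  set φ₀ := B.normed volume with hφ₀
  have hφs : ContDiff ℝ (⊤ : ℕ∞) φ₀ := B.contDiff_normed
  have hφc : HasCompactSupport φ₀ := B.hasCompactSupport_normed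
  have hφt : tsupport φ₀ ⊆ Ioo 0 ℓ := by
    rw [hφ₀, B.tsupport_normed_eq, Real.closedBall_eq_Icc]
    have : B.rOut = ℓ / 4 := rfl
    rw [this]
    exact Icc_subset_Ioo (by linarith) (by linarith)
  have hφi : ∫ x, φ₀ x = 1 := B.integral_normed
  set m := ∫ t in Icc 0 ℓ, (f t - F t) * φ₀ t with hm
  have hfF : MemLp (fun t => f t - F t) 2 (volume.restrict (Icc 0 ℓ)) := hf.sub hFL
  have hset : ∀ φ : ℝ → ℝ, tsupport φ ⊆ Ioo 0 ℓ → ∫ t in Icc 0 ℓ, φ t = ∫ t, φ t := fun φ hφ =>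
    setIntegral_eq_integral_of_forall_compl_eq_zero fun t ht => by
      by_contra hne
      exact ht (Ioo_subset_Icc_self (hφ (subset_tsupport φ hne)))
  have key : ∀ φ : ℝ → ℝ, ContDiff ℝ (⊤ : ℕ∞) φ → HasCompactSupport φ → tsupport φ ⊆ Ioo 0 ℓ →
      ∫ t in Icc 0 ℓ, (f t - F t) * deriv φ t = 0 := by
    intro φ hφ hφc hφt
    have h1 := h φ hφ hφc hφt
    have hφp : IsPrim ℓ φ (deriv φ) := by
      have hdc : Continuous (deriv φ) := hφ.continuous_deriv (by simp)
      refine ⟨hdc.continuousOn.integrableOn_compact isCompact_Icc, fun t _ => ?_⟩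
      rw [intervalIntegral.integral_deriv_eq_sub
        (fun x _ => (hφ.differentiable (by simp)) x) (hdc.intervalIntegrable _ _)]
      ring
    have hd2 : MemLp (deriv φ) 2 (volume.restrict (Icc 0 ℓ)) :=
      (hφ.continuous_deriv (by simp)).continuousOn.memLp_Icc
    have hp2 : MemLp φ 2 (volume.restrict (Icc 0 ℓ)) := hφ.continuous.continuousOn.memLp_Icc
    have h2 := hF.integral_mul_add hℓ.le hφp
    have e0 : φ 0 = 0 := by
      by_contra hne
      exact absurd (hφt (subset_tsupport φ hne)).1 (lt_irrefl _)
    have e1 : φ ℓ = 0 := by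
      by_contra hne
      exact absurd (hφt (subset_tsupport φ hne)).2 (lt_irrefl _)
    rw [e0, e1, mul_zero, mul_zero, sub_zero, integral_add (MemLp.integrable_mul_Icc hg hp2)
      (MemLp.integrable_mul_Icc hFL hd2)] at h2
    calc ∫ t in Icc 0 ℓ, (f t - F t) * deriv φ t
        = ∫ t in Icc 0 ℓ, (f t * deriv φ t - F t * deriv φ t) := by simp only [sub_mul]
      _ = 0 := by
        rw [integral_sub (MemLp.integrable_mul_Icc hf hd2) (MemLp.integrable_mul_Icc hFL hd2), h1]
        linarith
  have hz := isOpen_Ioo.ae_eq_zero_of_integral_contDiff_smul_eq_zero (U := Ioo 0 ℓ)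
    (f := fun t => f t - F t - m) (μ := volume.restrict (Icc 0 ℓ))
    ((MemLp.integrable (μ := volume.restrict (Icc 0 ℓ)) (by norm_num)
      (hfF.sub (memLp_const m))).locallyIntegrable.locallyIntegrableOn _) (by
    intro φ hφ hφcc hφtt
    set c := ∫ t, φ t with hc
    have hχt : tsupport (fun t => φ t - c * φ₀ t) ⊆ Ioo 0 ℓ := by
      refine (tsupport_sub φ (fun t => c * φ₀ t)).trans (union_subset hφtt ?_)
      exact (tsupport_mul_subset_right (f := fun _ => c)).trans hφt
    have hχc : HasCompactSupport (fun t => φ t - c * φ₀ t) := hφcc.sub hφc.mul_left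
    obtain ⟨ψ, hψ, hψc, hψt, hψd⟩ := exists_hasDerivAt_of_integral_eq_zero
      (hφ.sub (contDiff_const.mul hφs)) hχc hχt (by
        rw [integral_sub (hφ.continuous.integrable_of_hasCompactSupport hφcc)
          ((hφs.continuous.integrable_of_hasCompactSupport hφc).const_mul c), integral_const_mul,
          hφi, mul_one, sub_self])
    have h1 := key ψ hψ hψc hψt
    rw [hψd] at h1
    have hφ2 : MemLp φ 2 (volume.restrict (Icc 0 ℓ)) := hφ.continuous.continuousOn.memLp_Icc
    have hφ02 : MemLp φ₀ 2 (volume.restrict (Icc 0 ℓ)) := hφs.continuous.continuousOn.memLp_Icc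
    have i1 := MemLp.integrable_mul_Icc hfF hφ2
    have i2 := (MemLp.integrable_mul_Icc hfF hφ02).const_mul c
    have h2 : ∫ t in Icc 0 ℓ, (f t - F t) * φ t = c * m := by
      have : ∫ t in Icc 0 ℓ, (f t - F t) * (φ t - c * φ₀ t) =
          (∫ t in Icc 0 ℓ, (f t - F t) * φ t) - c * m := by
        rw [hm, ← integral_const_mul, ← integral_sub i1 i2]
        refine integral_congr_ae (ae_of_all _ fun t => ?_)
        simp only
        ring
      linarith
    have i3 : IntegrableOn (fun t => m * φ t) (Icc 0 ℓ) := (MemLp.integrableOn_Icc hφ2).const_mul m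
    calc ∫ t in Icc 0 ℓ, φ t • (f t - F t - m)
        = ∫ t in Icc 0 ℓ, ((f t - F t) * φ t - m * φ t) := by
          refine integral_congr_ae (ae_of_all _ fun t => ?_)
          simp only [smul_eq_mul]
          ring
      _ = 0 := by
          rw [integral_sub i1 i3, h2, integral_const_mul, hset φ hφtt]
          ring)
  refine ⟨fun t => m + F t, ?_, ?_⟩
  · have := (IsPrim.const (ℓ := ℓ) m).add hℓ.le hF
    simpa using this
  · have hn0 : ∀ᵐ x ∂(volume.restrict (Icc (0 : ℝ) ℓ)), x ≠ 0 :=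
      ae_restrict_of_ae (by simp [ae_iff, measure_singleton])
    have hnl : ∀ᵐ x ∂(volume.restrict (Icc (0 : ℝ) ℓ)), x ≠ ℓ :=
      ae_restrict_of_ae (by simp [ae_iff, measure_singleton])
    filter_upwards [hz, hn0, hnl, ae_restrict_mem measurableSet_Icc] with t ht h0 hl htI
    have := ht ⟨lt_of_le_of_ne htI.1 (Ne.symm h0), lt_of_le_of_ne htI.2 hl⟩
    linarith

theorem eqOn_Icc_of_ae_eq (hℓ : 0 < ℓ) {f g : ℝ → ℝ} (hf : ContinuousOn f (Icc 0 ℓ))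
    (hg : ContinuousOn g (Icc 0 ℓ)) (h : f =ᵐ[volume.restrict (Icc 0 ℓ)] g) :
    EqOn f g (Icc 0 ℓ) :=
  Measure.eqOn_Icc_of_ae_eq volume hℓ.ne h hf hg

theorem MetricGraph.IsWeakDeriv.isPrim (hℓ : 0 < ℓ) {f g : ℝ → ℝ}
    (h : MetricGraph.IsWeakDeriv ℓ f g) (hf : ContinuousOn f (Icc 0 ℓ)) : IsPrim ℓ f g := by
  obtain ⟨F, hF, hfF⟩ := h.exists_isPrim hℓ
  exact hF.congr (eqOn_Icc_of_ae_eq hℓ hf (hF.continuousOn hℓ.le) hfF) EventuallyEq.rfl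

end DuBoisReymond

end

noncomputable section

/-! ### The energy space and the Green operator -/

namespace MetricGraph

section Operator

variable {V E : Type*} [Fintype V] [Fintype E] {G : MetricGraph V E}

/-- The element of `L₂(Γ)` given by square integrable functions on the edges. -/
def ofFun (F : E → ℝ → ℝ) (hF : ∀ e, MemLp (F e) 2 (G.edgeMeasure e)) : G.L2 :=
  WithLp.toLp 2 fun e => (hF e).toLp

theorem coeFn_ofFun (F : E → ℝ → ℝ) (hF : ∀ e, MemLp (F e) 2 (G.edgeMeasure e)) (e : E) :
    ofFun F hF e =ᵐ[G.edgeMeasure e] F e :=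
  (hF e).coeFn_toLp

theorem L2.ext_ae {f g : G.L2} (h : ∀ e, f e =ᵐ[G.edgeMeasure e] g e) : f = g := by
  ext1 e
  exact Lp.ext (h e)

theorem L2.memLp (f : G.L2) (e : E) : MemLp (f e) 2 (G.edgeMeasure e) := Lp.memLp _

theorem L2.inner_eq (f g : G.L2) :
    inner ℝ f g = ∑ e, ∫ t in Icc 0 (G.len e), f e t * g e t := by
  rw [PiLp.inner_apply]
  refine Finset.sum_congr rfl fun e _ => ?_
  rw [L2.inner_def]
  refine integral_congr_ae (ae_of_all _ fun t => ?_)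
  simp [mul_comm]

theorem L2.inner_eq_of_ae {f g : G.L2} {F H : E → ℝ → ℝ}
    (hF : ∀ e, f e =ᵐ[G.edgeMeasure e] F e) (hH : ∀ e, g e =ᵐ[G.edgeMeasure e] H e) :
    inner ℝ f g = ∑ e, ∫ t in Icc 0 (G.len e), F e t * H e t := by
  rw [L2.inner_eq]
  refine Finset.sum_congr rfl fun e _ => integral_congr_ae ?_
  filter_upwards [hF e, hH e] with t h1 h2
  rw [h1, h2]

/-- The operator on `L₂(Γ)` acting by `S e` on the edge `e`. -/
def edgewise (S : ∀ e, LTwo (G.len e) →L[ℝ] LTwo (G.len e)) : G.L2 →L[ℝ] G.L2 :=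
  (PiLp.continuousLinearEquiv 2 ℝ fun e => LTwo (G.len e)).symm.toContinuousLinearMap ∘L
    ContinuousLinearMap.pi fun e => S e ∘L PiLp.proj 2 _ e

/-- Multiplication by bounded functions on `L₂(Γ)`. -/
def mulE (b : E → ℝ → ℝ) (hb : ∀ e, MemLp (b e) ∞ (G.edgeMeasure e)) : G.L2 →L[ℝ] G.L2 :=
  edgewise fun e => mulL (b e) (hb e)

theorem coeFn_mulE (b : E → ℝ → ℝ) (hb : ∀ e, MemLp (b e) ∞ (G.edgeMeasure e)) (f : G.L2) (e : E) :
    mulE b hb f e =ᵐ[G.edgeMeasure e] fun t => b e t * f e t :=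
  coeFn_mulL (b e) (hb e) (f e)

/-- The values `s e`, `t e` at the initial and the final points of the edges are those of a
function on the vertices. -/
def EndsContinuous (G : MetricGraph V E) (s t : E → ℝ) : Prop :=
  ∃ x : V → ℝ, (∀ e, s e = x (G.src e)) ∧ ∀ e, t e = x (G.tgt e)

/-- The flows `s e`, `t e` at the initial and the final points of the edges are balanced at every
vertex. -/
def EndsBalanced (G : MetricGraph V E) (s t : E → ℝ) : Prop :=
  ∀ x : V → ℝ, ∑ e, (t e * x (G.tgt e) - s e * x (G.src e)) = 0

theorem EndsBalanced.sum_eq_zero {s t s' t' : E → ℝ} (h : G.EndsBalanced s t)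
    (h' : G.EndsContinuous s' t') : ∑ e, (t e * t' e - s e * s' e) = 0 := by
  obtain ⟨x, hs, ht⟩ := h'
  simp only [hs, ht]
  exact h x

/-- For two edge ends at the same vertex, the unit flow through one and out of the other is
balanced. Orthogonality to it says that the values at these ends agree. -/
theorem endsContinuous_of_orthogonal {s t : E → ℝ}
    (h : ∀ s' t', G.EndsBalanced s' t' → ∑ e, (t e * t' e - s e * s' e) = 0) :
    G.EndsContinuous s t := by
  classical
  let vert : E ⊕ E → V := Sum.elim G.src G.tgt
  let val : E ⊕ E → ℝ := Sum.elim s t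
  have hsum : ∀ c d : E ⊕ E → ℝ, ∑ i, c i * d i =
      ∑ e, (d (Sum.inr e) * c (Sum.inr e) - d (Sum.inl e) * -c (Sum.inl e)) := by
    intro c d
    rw [Fintype.sum_sum_type, ← Finset.sum_add_distrib]
    exact Finset.sum_congr rfl fun e _ => by ring
  have hf : Function.FactorsThrough val vert := by
    intro i j hij
    have h1 := h (fun e => -(Pi.single i (1 : ℝ) - Pi.single j (1 : ℝ) : E ⊕ E → ℝ) (Sum.inl e))
      (fun e => (Pi.single i (1 : ℝ) - Pi.single j (1 : ℝ) : E ⊕ E → ℝ) (Sum.inr e)) (by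
        intro x
        have h2 := hsum (Pi.single i (1 : ℝ) - Pi.single j (1 : ℝ)) (fun i => x (vert i))
        have h3 : ∑ k, (Pi.single i (1 : ℝ) - Pi.single j (1 : ℝ) : E ⊕ E → ℝ) k * x (vert k) = 0 := by
          simp [sub_mul, Finset.sum_sub_distrib, Pi.single_apply, hij]
        rw [h3] at h2
        rw [h2]
        exact Finset.sum_congr rfl fun e _ => by
          simp only [vert, Sum.elim_inl, Sum.elim_inr]
          ring)
    have h2 := hsum (Pi.single i (1 : ℝ) - Pi.single j (1 : ℝ)) val
    have h3 : ∑ k, (Pi.single i (1 : ℝ) - Pi.single j (1 : ℝ) : E ⊕ E → ℝ) k * val k =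
        val i - val j := by
      simp [sub_mul, Finset.sum_sub_distrib, Pi.single_apply]
    rw [h3] at h2
    have h4 := h2.trans h1
    linarith
  exact ⟨Function.extend vert val 0, fun e => (hf.extend_apply 0 (Sum.inl e)).symm,
    fun e => (hf.extend_apply 0 (Sum.inr e)).symm⟩

/-- Test functions on a single edge vanishing at its ends give the primitive, edge by edge. Test
functions with arbitrary admissible end values then leave only the boundary terms. Taking `P` to be
either vertex condition yields the dual one for f. -/
theorem exists_isPrim_of_orthogonal_ends {P : (E → ℝ) → (E → ℝ) → Prop} (hP0 : P 0 0)
    {D H : E → ℝ → ℝ} (hD : ∀ e, MemLp (D e) 2 (G.edgeMeasure e))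
    (hH : ∀ e, MemLp (H e) 2 (G.edgeMeasure e))
    (h : ∀ β β' : E → ℝ → ℝ, (∀ e, MemLp (β' e) 2 (G.edgeMeasure e)) →
      (∀ e, IsPrim (G.len e) (β e) (β' e)) → P (fun e => β e 0) (fun e => β e (G.len e)) →
      ∑ e, ∫ t in Icc 0 (G.len e), (D e t * β' e t + H e t * β e t) = 0) :
    ∃ f : E → ℝ → ℝ, (∀ e, IsPrim (G.len e) (f e) (H e)) ∧
      (∀ e, D e =ᵐ[G.edgeMeasure e] f e) ∧
      ∀ s t, P s t → ∑ e, (f e (G.len e) * t e - f e 0 * s e) = 0 := by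
  classical
  have h1 : ∀ e, ∃ f, IsPrim (G.len e) f (H e) ∧ D e =ᵐ[G.edgeMeasure e] f := by
    intro e
    refine exists_isPrim_of_orthogonal (G.len_pos e) (hD e) (hH e) fun β β' hβ' hβ h0 hl => ?_
    have h2 := h (fun i => if i = e then β else fun _ => 0) (fun i => if i = e then β' else fun _ => 0)
      (fun i => by
        by_cases hi : i = e
        · subst hi
          simpa using hβ'
        · simp [hi])
      (fun i => by
        by_cases hi : i = e
        · subst hi
          simpa using hβ
        · simpa [hi] using IsPrim.const 0)
      (by
        have e1 : (fun i => (if i = e then β else fun _ => 0) 0) = (0 : E → ℝ) := by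
          funext i
          by_cases hi : i = e <;> simp [hi, h0]
        have e2 : (fun i => (if i = e then β else fun _ => 0) (G.len i)) = (0 : E → ℝ) := by
          funext i
          by_cases hi : i = e
          · subst hi
            simpa using hl
          · simp [hi]
        rw [e1, e2]
        exact hP0)
    rw [Finset.sum_eq_single e (fun i _ hi => by simp [hi]) (by simp)] at h2
    simpa using h2
  choose f hf hDf using h1
  refine ⟨f, hf, hDf, fun s t hst => ?_⟩
  -- The affine function with end values `s e` and `t e`, written as a primitive.
  have haff : ∀ e, IsPrim (G.len e) (fun r => s e + ∫ _ in (0 : ℝ)..r, (t e - s e) / G.len e)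
      (fun _ => (t e - s e) / G.len e) := fun e =>
    IsPrim.of_integrableOn (integrableOn_const (by simp)) _
  have h2 := h (fun e r => s e + ∫ _ in (0 : ℝ)..r, (t e - s e) / G.len e)
    (fun e _ => (t e - s e) / G.len e) (fun e => memLp_const _) haff (by
      convert hst using 1
      · funext e
        simp
      · funext e
        have := (G.len_pos e).ne'
        simp only [intervalIntegral.integral_const, sub_zero, smul_eq_mul]
        field_simp
        ring)
  refine Eq.trans (Finset.sum_congr rfl fun e _ => ?_) h2
  have h3 := (hf e).integral_mul_add (G.len_pos e).le (haff e)
  have hl := (G.len_pos e).ne'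
  simp only [intervalIntegral.integral_const, sub_zero, smul_eq_mul, zero_mul, add_zero] at h3
  have h4 : s e + G.len e * ((t e - s e) / G.len e) = t e := by
    field_simp
    ring
  rw [h4] at h3
  rw [← h3]
  refine integral_congr_ae ?_
  filter_upwards [hDf e] with r hr
  rw [hr]
  simp only [intervalIntegral.integral_const, sub_zero, smul_eq_mul]
  ring

/-- Bounded weights with bounded inverse: the operator is `- (p² φ')' + q² φ`. -/
structure Weights (G : MetricGraph V E) (p q : E → ℝ → ℝ) : Prop where
  p_mem : ∀ e, MemLp (p e) ∞ (G.edgeMeasure e)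
  p_inv_mem : ∀ e, MemLp (fun t => (p e t)⁻¹) ∞ (G.edgeMeasure e)
  p_ne : ∀ e, ∀ᵐ t ∂(G.edgeMeasure e), p e t ≠ 0
  q_mem : ∀ e, MemLp (q e) ∞ (G.edgeMeasure e)
  q_inv_mem : ∀ e, MemLp (fun t => (q e t)⁻¹) ∞ (G.edgeMeasure e)
  q_ne : ∀ e, ∀ᵐ t ∂(G.edgeMeasure e), q e t ≠ 0

variable {p q : E → ℝ → ℝ}

/-- Pairs `(b / p, b' / q)` with `b` balanced at every vertex. -/
def balancedPairs (G : MetricGraph V E) (p q : E → ℝ → ℝ) : Set (WithLp 2 (G.L2 × G.L2)) :=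
  {z | ∃ b b' : E → ℝ → ℝ, (∀ e, MemLp (b' e) 2 (G.edgeMeasure e)) ∧
    (∀ e, IsPrim (G.len e) (b e) (b' e)) ∧
    G.EndsBalanced (fun e => b e 0) (fun e => b e (G.len e)) ∧
    (∀ e, z.fst e =ᵐ[G.edgeMeasure e] fun t => (p e t)⁻¹ * b e t) ∧
    ∀ e, z.snd e =ᵐ[G.edgeMeasure e] fun t => (q e t)⁻¹ * b' e t}

/-- The energy space, made of the pairs `(p f', q f)` with `f` in `H¹(Γ)`. -/
def energySpace (G : MetricGraph V E) (p q : E → ℝ → ℝ) : Submodule ℝ (WithLp 2 (G.L2 × G.L2)) :=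
  (Submodule.span ℝ (balancedPairs G p q))ᗮ

/-- The pair `y` is `(p f', q f)`, where `f` belongs to `H¹(Γ)` and has derivative `g`. -/
structure EnergyRep (p q : E → ℝ → ℝ) (y : WithLp 2 (G.L2 × G.L2)) (f g : E → ℝ → ℝ) : Prop where
  memLp : ∀ e, MemLp (g e) 2 (G.edgeMeasure e)
  prim : ∀ e, IsPrim (G.len e) (f e) (g e)
  ends : G.EndsContinuous (fun e => f e 0) (fun e => f e (G.len e))
  fst_eq : ∀ e, y.fst e =ᵐ[G.edgeMeasure e] fun t => p e t * g e t
  snd_eq : ∀ e, y.snd e =ᵐ[G.edgeMeasure e] fun t => q e t * f e t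

theorem mem_orthogonal_span_iff {H : Type*} [NormedAddCommGroup H] [InnerProductSpace ℝ H]
    {s : Set H} {y : H} : y ∈ (Submodule.span ℝ s)ᗮ ↔ ∀ z ∈ s, inner ℝ z y = 0 := by
  constructor
  · intro h z hz
    exact Submodule.inner_right_of_mem_orthogonal (Submodule.subset_span hz) h
  · intro h
    rw [Submodule.mem_orthogonal]
    intro u hu
    induction hu using Submodule.span_induction with
    | mem x hx => exact h x hx
    | zero => exact inner_zero_left _
    | add x z _ _ hx hz => rw [inner_add_left, hx, hz, add_zero]
    | smul c x _ hx => rw [inner_smul_left, hx, mul_zero]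

theorem mem_energySpace_iff {y : WithLp 2 (G.L2 × G.L2)} :
    y ∈ energySpace G p q ↔ ∀ z ∈ balancedPairs G p q, inner ℝ z y = 0 :=
  mem_orthogonal_span_iff

theorem memLp_mul_of_top {ℓ : ℝ} {b f : ℝ → ℝ} (hb : MemLp b ∞ (volume.restrict (Icc 0 ℓ)))
    (hf : MemLp f 2 (volume.restrict (Icc 0 ℓ))) :
    MemLp (fun t => b t * f t) 2 (volume.restrict (Icc 0 ℓ)) :=
  hf.mul hb

theorem inner_prod_eq {y z : WithLp 2 (G.L2 × G.L2)} {F₁ F₂ H₁ H₂ : E → ℝ → ℝ}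
    (h1 : ∀ e, y.fst e =ᵐ[G.edgeMeasure e] F₁ e) (h2 : ∀ e, y.snd e =ᵐ[G.edgeMeasure e] F₂ e)
    (h3 : ∀ e, z.fst e =ᵐ[G.edgeMeasure e] H₁ e) (h4 : ∀ e, z.snd e =ᵐ[G.edgeMeasure e] H₂ e) :
    inner ℝ y z = ∑ e, ∫ t in Icc 0 (G.len e), (F₁ e t * H₁ e t + F₂ e t * H₂ e t) := by
  rw [WithLp.prod_inner_apply]
  change inner ℝ y.fst z.fst + inner ℝ y.snd z.snd = _
  rw [L2.inner_eq, L2.inner_eq, ← Finset.sum_add_distrib]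
  refine Finset.sum_congr rfl fun e _ => ?_
  rw [← integral_add (MemLp.integrable_mul_Icc (L2.memLp _ e) (L2.memLp _ e))
    (MemLp.integrable_mul_Icc (L2.memLp _ e) (L2.memLp _ e))]
  refine integral_congr_ae ?_
  filter_upwards [h1 e, h2 e, h3 e, h4 e] with t h1 h2 h3 h4
  rw [h1, h2, h3, h4]

/-- Integration by parts on each edge: the weights cancel, and the boundary terms pair a balanced
flow with a continuous function. -/
theorem EnergyRep.mem (hw : G.Weights p q) {y : WithLp 2 (G.L2 × G.L2)} {f g : E → ℝ → ℝ}
    (h : EnergyRep p q y f g) : y ∈ energySpace G p q := by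
  refine mem_energySpace_iff.2 ?_
  rintro z ⟨b, b', hb', hb, hbal, hz1, hz2⟩
  rw [inner_prod_eq hz1 hz2 h.fst_eq h.snd_eq]
  refine Eq.trans (Finset.sum_congr rfl fun e _ => ?_) (hbal.sum_eq_zero h.ends)
  rw [← (hb e).integral_mul_add (G.len_pos e).le (h.prim e)]
  refine integral_congr_ae ?_
  filter_upwards [hw.p_ne e, hw.q_ne e] with t hp hq
  field_simp
  ring

/-- Orthogonality of y to all (b / p, b' / q) says that the second component divided by q has the
first divided by p as weak derivative, with continuous end values. Defining the space as an
orthogonal complement makes it complete at once; this lemma recovers its elements as functions. -/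
theorem exists_energyRep (hw : G.Weights p q) {y : WithLp 2 (G.L2 × G.L2)}
    (hy : y ∈ energySpace G p q) : ∃ f g, EnergyRep p q y f g := by
  have hD : ∀ e, MemLp (fun t => (q e t)⁻¹ * y.snd e t) 2 (G.edgeMeasure e) := fun e =>
    memLp_mul_of_top (hw.q_inv_mem e) (L2.memLp _ e)
  have hH : ∀ e, MemLp (fun t => (p e t)⁻¹ * y.fst e t) 2 (G.edgeMeasure e) := fun e =>
    memLp_mul_of_top (hw.p_inv_mem e) (L2.memLp _ e)
  obtain ⟨f, hf, hDf, hends⟩ := exists_isPrim_of_orthogonal_ends (P := G.EndsBalanced)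
    (fun x => by simp) hD hH (by
    intro β β' hβ' hβ hbal
    have hm1 : ∀ e, MemLp (fun t => (p e t)⁻¹ * β e t) 2 (G.edgeMeasure e) := fun e =>
      memLp_mul_of_top (hw.p_inv_mem e) ((hβ e).memLp (G.len_pos e).le)
    have hm2 : ∀ e, MemLp (fun t => (q e t)⁻¹ * β' e t) 2 (G.edgeMeasure e) := fun e =>
      memLp_mul_of_top (hw.q_inv_mem e) (hβ' e)
    have h0 := mem_energySpace_iff.1 hy (WithLp.toLp 2 (ofFun _ hm1, ofFun _ hm2))
      ⟨β, β', hβ', hβ, hbal, coeFn_ofFun _ hm1, coeFn_ofFun _ hm2⟩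
    rw [inner_prod_eq (coeFn_ofFun _ hm1) (coeFn_ofFun _ hm2) (fun e => EventuallyEq.rfl)
      (fun e => EventuallyEq.rfl)] at h0
    refine Eq.trans ?_ h0
    refine Finset.sum_congr rfl fun e _ => integral_congr_ae (ae_of_all _ fun t => ?_)
    simp only
    ring)
  refine ⟨f, _, hH, hf, endsContinuous_of_orthogonal hends, fun e => ?_, fun e => ?_⟩
  · filter_upwards [hw.p_ne e] with t ht
    rw [mul_inv_cancel_left₀ ht]
  · filter_upwards [hw.q_ne e, hDf e] with t ht h2
    rw [← h2, mul_inv_cancel_left₀ ht]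

instance : CompleteSpace (energySpace G p q) := by
  unfold energySpace
  infer_instance

/-- The embedding of the energy space in `L₂(Γ)`. -/
def energyEmb (hw : G.Weights p q) : energySpace G p q →L[ℝ] G.L2 :=
  mulE (fun e t => (q e t)⁻¹) hw.q_inv_mem ∘L WithLp.sndL 2 ℝ G.L2 G.L2 ∘L
    (energySpace G p q).subtypeL

/-- The derivative of an element of the energy space. -/
def energyDeriv (hw : G.Weights p q) : energySpace G p q →L[ℝ] G.L2 :=
  mulE (fun e t => (p e t)⁻¹) hw.p_inv_mem ∘L WithLp.fstL 2 ℝ G.L2 G.L2 ∘L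
    (energySpace G p q).subtypeL

theorem EnergyRep.emb_eq (hw : G.Weights p q) {y : energySpace G p q} {f g : E → ℝ → ℝ}
    (h : EnergyRep p q (y : WithLp 2 (G.L2 × G.L2)) f g) (e : E) :
    energyEmb hw y e =ᵐ[G.edgeMeasure e] f e := by
  filter_upwards [coeFn_mulE (fun e t => (q e t)⁻¹) hw.q_inv_mem
    (y : WithLp 2 (G.L2 × G.L2)).snd e, h.snd_eq e, hw.q_ne e] with t h1 h2 h3
  refine h1.trans ?_
  simp only [h2]
  rw [inv_mul_cancel_left₀ h3]

theorem EnergyRep.deriv_eq (hw : G.Weights p q) {y : energySpace G p q} {f g : E → ℝ → ℝ}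
    (h : EnergyRep p q (y : WithLp 2 (G.L2 × G.L2)) f g) (e : E) :
    energyDeriv hw y e =ᵐ[G.edgeMeasure e] g e := by
  filter_upwards [coeFn_mulE (fun e t => (p e t)⁻¹) hw.p_inv_mem
    (y : WithLp 2 (G.L2 × G.L2)).fst e, h.fst_eq e, hw.p_ne e] with t h1 h2 h3
  refine h1.trans ?_
  simp only [h2]
  rw [inv_mul_cancel_left₀ h3]

/-- The mean value of a function in `L₂(0, ℓ)`. -/
def meanL (ℓ : ℝ) : LTwo ℓ →L[ℝ] ℝ := ℓ⁻¹ • integralL ℓ 0 ℓ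

/-- A function is the Volterra integral of its derivative plus a constant, and the constant is the
mean of the difference. Written with operators, this shows the embedding to be compact. -/
theorem energyEmb_apply_eq (hw : G.Weights p q) (y : energySpace G p q) (e : E) :
    energyEmb hw y e = volterra (G.len e) (G.len_pos e).le (energyDeriv hw y e) +
      Lp.const 2 (G.edgeMeasure e) (meanL (G.len e) (energyEmb hw y e -
        volterra (G.len e) (G.len_pos e).le (energyDeriv hw y e))) := by
  obtain ⟨f, g, h⟩ := exists_energyRep hw y.2
  have hl := G.len_pos e
  have h1 : energyEmb hw y e - volterra (G.len e) hl.le (energyDeriv hw y e) =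
      Lp.const 2 (G.edgeMeasure e) (f e 0) := by
    refine Lp.ext ?_
    filter_upwards [Lp.coeFn_sub (energyEmb hw y e)
      (volterra (G.len e) hl.le (energyDeriv hw y e)), h.emb_eq hw e,
      coeFn_volterra hl.le (energyDeriv hw y e), Lp.coeFn_const (p := 2)
      (μ := G.edgeMeasure e) (f e 0), ae_restrict_mem measurableSet_Icc] with t h1 h2 h3 h4 ht
    rw [h1, Pi.sub_apply, h2, h3, h4, (h.prim e).2 t ht, Function.const_apply]
    have h5 : ∫ s in (0 : ℝ)..t, energyDeriv hw y e s = ∫ s in (0 : ℝ)..t, g e s := by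
      refine intervalIntegral.integral_congr_ae ?_
      filter_upwards [(ae_restrict_iff' measurableSet_Icc).1 (h.deriv_eq hw e)] with x hx hxI
      rw [uIoc_of_le ht.1] at hxI
      exact hx ⟨hxI.1.le, hxI.2.trans ht.2⟩
    rw [h5, add_sub_cancel_right]
  have h2 : meanL (G.len e) (Lp.const 2 (G.edgeMeasure e) (f e 0)) = f e 0 := by
    rw [meanL, smul_apply, integralL_apply (left_mem_Icc.2 hl.le)
      (right_mem_Icc.2 hl.le) hl.le, intervalIntegral.integral_of_le hl.le,
      ← integral_Icc_eq_integral_Ioc, integral_congr_ae (Lp.coeFn_const (p := 2)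
      (μ := G.edgeMeasure e) (f e 0))]
    simp [hl.le, hl.ne']
  rw [h1, h2, ← h1]
  abel

theorem isCompactOperator_sum {X Y ι : Type*} [NormedAddCommGroup X] [NormedSpace ℝ X]
    [NormedAddCommGroup Y] [NormedSpace ℝ Y] (s : Finset ι) {S : ι → X →L[ℝ] Y}
    (h : ∀ i, IsCompactOperator (S i)) :
    IsCompactOperator (∑ i ∈ s, S i : X →L[ℝ] Y) := by
  classical
  induction s using Finset.induction_on with
  | empty => simpa using isCompactOperator_zero
  | insert a s ha ih =>
    rw [Finset.sum_insert ha]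
    exact (h a).add ih

theorem isCompactOperator_energyEmb (hw : G.Weights p q) : IsCompactOperator (energyEmb hw) := by
  classical
  let pr := fun e => PiLp.proj (𝕜 := ℝ) 2 (fun e => LTwo (G.len e)) e
  have h1 : ∀ e, IsCompactOperator (pr e ∘L energyEmb hw) := by
    intro e
    have he : pr e ∘L energyEmb hw = volterra (G.len e) (G.len_pos e).le ∘L pr e ∘L energyDeriv hw +
        Lp.constL 2 (G.edgeMeasure e) ℝ ∘L (meanL (G.len e) ∘L (pr e ∘L energyEmb hw -
          volterra (G.len e) (G.len_pos e).le ∘L pr e ∘L energyDeriv hw)) := by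
      ext1 y
      exact energyEmb_apply_eq hw y e
    rw [he]
    exact ((isCompactOperator_volterra (G.len_pos e)).comp_clm (pr e ∘L energyDeriv hw)).add
      ((isCompactOperator_of_locallyCompactSpace_dom _).clm_comp (Lp.constL 2 (G.edgeMeasure e) ℝ))
  have h2 : energyEmb hw = ∑ e, ((PiLp.continuousLinearEquiv 2 ℝ fun e =>
      LTwo (G.len e)).symm.toContinuousLinearMap ∘L
      ContinuousLinearMap.single ℝ (fun i => LTwo (G.len i)) e) ∘L
      (pr e ∘L energyEmb hw) := by
    ext1 y
    rw [sum_apply]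
    ext1 i
    rw [WithLp.ofLp_sum, Finset.sum_apply, Finset.sum_eq_single i]
    · simp [pr]
    · intro j _ hj
      simp [pr, hj.symm]
    · simp
  rw [h2]
  refine isCompactOperator_sum _ fun e => ?_
  exact IsCompactOperator.clm_comp (h1 e) ((PiLp.continuousLinearEquiv 2 ℝ fun e =>
      LTwo (G.len e)).symm.toContinuousLinearMap ∘L
      ContinuousLinearMap.single ℝ (fun i => LTwo (G.len i)) e)

/-- The adjoint of the embedding of the energy space in `L₂(Γ)`. -/
def energyAdj (hw : G.Weights p q) : G.L2 →L[ℝ] energySpace G p q :=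
  ContinuousLinearMap.adjoint (𝕜 := ℝ) (E := energySpace G p q) (F := G.L2) (energyEmb hw)

theorem inner_energyAdj (hw : G.Weights p q) (f : G.L2) (y : energySpace G p q) :
    inner ℝ (energyAdj hw f) y = inner ℝ f (energyEmb hw y) := by
  rw [energyAdj]
  exact ContinuousLinearMap.adjoint_inner_left _ _ _

/-- The inverse of the operator `- (p² φ')' + q² φ`. -/
def greenOp (hw : G.Weights p q) : G.L2 →L[ℝ] G.L2 :=
  energyEmb hw ∘L energyAdj hw

/-- `h` is in the domain of the operator `- (p² φ')' + q² φ`, which maps it to `f`; here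
`b = p² h'`. -/
structure DomL (G : MetricGraph V E) (p q : E → ℝ → ℝ) (h b f : E → ℝ → ℝ) : Prop where
  memLp : ∀ e, MemLp (f e) 2 (G.edgeMeasure e)
  prim : ∀ e, IsPrim (G.len e) (h e) (fun t => (p e t ^ 2)⁻¹ * b e t)
  prim_flux : ∀ e, IsPrim (G.len e) (b e) (fun t => q e t ^ 2 * h e t - f e t)
  ends : G.EndsContinuous (fun e => h e 0) (fun e => h e (G.len e))
  ends_flux : G.EndsBalanced (fun e => b e 0) (fun e => b e (G.len e))

theorem DomL.exists_energyRep (hw : G.Weights p q) {h b f : E → ℝ → ℝ} (hd : DomL G p q h b f) :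
    ∃ y : energySpace G p q, EnergyRep p q (y : WithLp 2 (G.L2 × G.L2)) h
      (fun e t => (p e t ^ 2)⁻¹ * b e t) := by
  have hb : ∀ e, MemLp (b e) 2 (G.edgeMeasure e) := fun e =>
    (hd.prim_flux e).memLp (G.len_pos e).le
  have hh : ∀ e, MemLp (h e) 2 (G.edgeMeasure e) := fun e => (hd.prim e).memLp (G.len_pos e).le
  have hm : ∀ e, MemLp (fun t => (p e t ^ 2)⁻¹ * b e t) 2 (G.edgeMeasure e) := fun e => by
    have := memLp_mul_of_top (hw.p_inv_mem e) (memLp_mul_of_top (hw.p_inv_mem e) (hb e))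
    refine (memLp_congr_ae (ae_of_all _ fun t => ?_)).1 this
    rw [pow_two, mul_inv, mul_assoc]
  have hm1 : ∀ e, MemLp (fun t => p e t * ((p e t ^ 2)⁻¹ * b e t)) 2 (G.edgeMeasure e) := fun e =>
    memLp_mul_of_top (hw.p_mem e) (hm e)
  have hm2 : ∀ e, MemLp (fun t => q e t * h e t) 2 (G.edgeMeasure e) := fun e =>
    memLp_mul_of_top (hw.q_mem e) (hh e)
  have hr : EnergyRep p q (WithLp.toLp 2 (ofFun _ hm1, ofFun _ hm2)) h
      (fun e t => (p e t ^ 2)⁻¹ * b e t) :=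
    ⟨hm, hd.prim, hd.ends, coeFn_ofFun _ hm1, coeFn_ofFun _ hm2⟩
  exact ⟨⟨_, hr.mem hw⟩, hr⟩

/-- Integration by parts shows that y represents the functional z ↦ (F, z) for the energy inner
product; the boundary terms vanish since the flux is balanced and z is continuous. -/
theorem DomL.adjoint_eq (hw : G.Weights p q) {h b f : E → ℝ → ℝ} (hd : DomL G p q h b f)
    {F : G.L2} (hF : ∀ e, F e =ᵐ[G.edgeMeasure e] f e) {y : energySpace G p q}
    (hy : EnergyRep p q (y : WithLp 2 (G.L2 × G.L2)) h (fun e t => (p e t ^ 2)⁻¹ * b e t)) :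
    energyAdj hw F = y := by
  refine ext_inner_right ℝ fun z => ?_
  rw [inner_energyAdj]
  obtain ⟨β, γ, hz⟩ := MetricGraph.exists_energyRep hw z.2
  rw [L2.inner_eq_of_ae hF (hz.emb_eq hw), Submodule.coe_inner,
    inner_prod_eq hy.fst_eq hy.snd_eq hz.fst_eq hz.snd_eq, eq_comm, ← sub_eq_zero,
    ← Finset.sum_sub_distrib]
  refine Eq.trans (Finset.sum_congr rfl fun e _ => ?_) (hd.ends_flux.sum_eq_zero hz.ends)
  rw [← (hd.prim_flux e).integral_mul_add (G.len_pos e).le (hz.prim e), ← integral_sub]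
  · refine integral_congr_ae ?_
    filter_upwards [hw.p_ne e] with t hp
    field_simp
    ring
  · exact (MemLp.integrable_mul_Icc (memLp_mul_of_top (hw.p_mem e) (hy.memLp e))
      (memLp_mul_of_top (hw.p_mem e) (hz.memLp e))).add (MemLp.integrable_mul_Icc
      (memLp_mul_of_top (hw.q_mem e) ((hy.prim e).memLp (G.len_pos e).le))
      (memLp_mul_of_top (hw.q_mem e) ((hz.prim e).memLp (G.len_pos e).le)))
  · exact MemLp.integrable_mul_Icc (hd.memLp e) ((hz.prim e).memLp (G.len_pos e).le)

theorem DomL.greenOp_eq (hw : G.Weights p q) {h b f : E → ℝ → ℝ} (hd : DomL G p q h b f)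
    {F : G.L2} (hF : ∀ e, F e =ᵐ[G.edgeMeasure e] f e) (e : E) :
    greenOp hw F e =ᵐ[G.edgeMeasure e] h e := by
  obtain ⟨y, hy⟩ := hd.exists_energyRep hw
  rw [greenOp, ContinuousLinearMap.comp_apply, hd.adjoint_eq hw hF hy]
  exact hy.emb_eq hw e

/-- Regularity of the weak solution. The Riesz representative satisfies the variational identity
against all H¹(Γ) functions, so by du Bois-Reymond p² h' has the weak derivative q² h - F, and the
natural vertex condition is balance of the flux. -/
theorem exists_domL (hw : G.Weights p q) (F : G.L2) :
    ∃ h b, DomL G p q h b (fun e => F e) ∧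
      (∀ e, greenOp hw F e =ᵐ[G.edgeMeasure e] h e) := by
  obtain ⟨h, g, hr⟩ := exists_energyRep hw (energyAdj hw F).2
  have hh : ∀ e, MemLp (h e) 2 (G.edgeMeasure e) := fun e => (hr.prim e).memLp (G.len_pos e).le
  have hD : ∀ e, MemLp (fun t => p e t * (p e t * g e t)) 2 (G.edgeMeasure e) := fun e =>
    memLp_mul_of_top (hw.p_mem e) (memLp_mul_of_top (hw.p_mem e) (hr.memLp e))
  have hH : ∀ e, MemLp (fun t => q e t * (q e t * h e t) - F e t) 2 (G.edgeMeasure e) := fun e =>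
    (memLp_mul_of_top (hw.q_mem e) (memLp_mul_of_top (hw.q_mem e) (hh e))).sub (L2.memLp F e)
  obtain ⟨b, hb, hDb, hends⟩ := exists_isPrim_of_orthogonal_ends (P := G.EndsContinuous)
    ⟨0, by simp, by simp⟩ hD hH (by
    intro β β' hβ' hβ hc
    have hβ2 : ∀ e, MemLp (β e) 2 (G.edgeMeasure e) := fun e => (hβ e).memLp (G.len_pos e).le
    have hm1 : ∀ e, MemLp (fun t => p e t * β' e t) 2 (G.edgeMeasure e) := fun e =>
      memLp_mul_of_top (hw.p_mem e) (hβ' e)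
    have hm2 : ∀ e, MemLp (fun t => q e t * β e t) 2 (G.edgeMeasure e) := fun e =>
      memLp_mul_of_top (hw.q_mem e) (hβ2 e)
    have hz : EnergyRep p q (WithLp.toLp 2 (ofFun _ hm1, ofFun _ hm2)) β β' :=
      ⟨hβ', hβ, hc, coeFn_ofFun _ hm1, coeFn_ofFun _ hm2⟩
    have h1 := inner_energyAdj hw F (⟨_, hz.mem hw⟩ : energySpace G p q)
    rw [Submodule.coe_inner, inner_prod_eq hr.fst_eq hr.snd_eq hz.fst_eq hz.snd_eq,
      L2.inner_eq_of_ae (fun e => EventuallyEq.rfl)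
        (EnergyRep.emb_eq hw (y := ⟨_, hz.mem hw⟩) hz), ← sub_eq_zero,
      ← Finset.sum_sub_distrib] at h1
    refine Eq.trans ?_ h1
    refine Finset.sum_congr rfl fun e _ => ?_
    rw [← integral_sub]
    · refine integral_congr_ae (ae_of_all _ fun t => ?_)
      simp only
      ring
    · exact (MemLp.integrable_mul_Icc (memLp_mul_of_top (hw.p_mem e) (hr.memLp e))
        (hm1 e)).add (MemLp.integrable_mul_Icc (memLp_mul_of_top (hw.q_mem e) (hh e)) (hm2 e))
    · exact MemLp.integrable_mul_Icc (L2.memLp F e) (hβ2 e))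
  refine ⟨h, b, ⟨L2.memLp F, fun e => ?_, fun e => ?_, hr.ends, fun x =>
    hends _ _ ⟨x, fun _ => rfl, fun _ => rfl⟩⟩, fun e => hr.emb_eq hw e⟩
  · refine (hr.prim e).congr (fun _ _ => rfl) ?_
    filter_upwards [hDb e, hw.p_ne e] with t h1 h2
    rw [← h1]
    field_simp
  · refine (hb e).congr (fun _ _ => rfl) (ae_of_all _ fun t => ?_)
    simp only
    ring

theorem isCompactOperator_greenOp (hw : G.Weights p q) : IsCompactOperator (greenOp hw) :=
  (isCompactOperator_energyEmb hw).comp_clm (energyAdj hw)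

theorem inner_greenOp (hw : G.Weights p q) (f g : G.L2) :
    inner ℝ (greenOp hw f) g =
      inner ℝ (energyAdj hw f) (energyAdj hw g) := by
  calc inner ℝ (greenOp hw f) g = inner ℝ g (energyEmb hw (energyAdj hw f)) :=
        (real_inner_comm _ _).symm
    _ = inner ℝ (energyAdj hw g) (energyAdj hw f) := (inner_energyAdj hw g _).symm
    _ = inner ℝ (energyAdj hw f) (energyAdj hw g) := real_inner_comm _ _

theorem isSymmetric_greenOp (hw : G.Weights p q) :
    (greenOp hw : G.L2 →ₗ[ℝ] G.L2).IsSymmetric := by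
  intro f g
  change inner ℝ (greenOp hw f) g = inner ℝ f (greenOp hw g)
  exact (inner_greenOp hw f g).trans (inner_energyAdj hw f (energyAdj hw g))

/-- The operator is local: if h vanishes on an open set, so do h', the flux b, its derivative and
finally f. -/
theorem DomL.eq_zero_of_isOpen {h b f : E → ℝ → ℝ} (hd : DomL G p q h b f)
    (hw : G.Weights p q) (e : E) {O : Set ℝ} (hO : IsOpen O)
    (h0 : ∀ᵐ t, t ∈ Icc 0 (G.len e) → t ∈ O → h e t = 0) :
    ∀ᵐ t, t ∈ Icc 0 (G.len e) → t ∈ O → f e t = 0 := by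
  have h1 := (hd.prim e).ae_eq_zero_of_isOpen (G.len_pos e).le hO h0
  have h2 : ∀ᵐ t, t ∈ Icc 0 (G.len e) → t ∈ O → b e t = 0 := by
    filter_upwards [h1, (ae_restrict_iff' measurableSet_Icc).1 (hw.p_ne e)] with t h1 h2 ht htO
    have h3 := h1 ht htO
    have h4 := h2 ht
    rcases mul_eq_zero.1 h3 with h5 | h5
    · exact absurd h5 (inv_ne_zero (pow_ne_zero 2 h4))
    · exact h5
  filter_upwards [h0, (hd.prim_flux e).ae_eq_zero_of_isOpen (G.len_pos e).le hO h2]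
    with t h0 h3 ht htO
  have := h3 ht htO
  rw [h0 ht htO, mul_zero, zero_sub, neg_eq_zero] at this
  exact this

theorem greenOp_injective (hw : G.Weights p q) : Function.Injective (greenOp hw) := by
  rw [injective_iff_map_eq_zero]
  intro F hF
  obtain ⟨h, b, hd, hh⟩ := exists_domL hw F
  refine L2.ext_ae fun e => ?_
  have h0 : ∀ᵐ t, t ∈ Icc 0 (G.len e) → t ∈ (univ : Set ℝ) → h e t = 0 := by
    have h1 := hh e
    rw [hF] at h1
    have h2 : ((0 : G.L2) e : ℝ → ℝ) =ᵐ[G.edgeMeasure e] 0 := Lp.coeFn_zero _ _ _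
    filter_upwards [(ae_restrict_iff' measurableSet_Icc).1 (h1.symm.trans h2)] with t ht htI _
    exact ht htI
  have h2 : ((0 : G.L2) e : ℝ → ℝ) =ᵐ[G.edgeMeasure e] 0 := Lp.coeFn_zero _ _ _
  refine EventuallyEq.trans ?_ h2.symm
  refine (ae_restrict_iff' measurableSet_Icc).2 ?_
  filter_upwards [hd.eq_zero_of_isOpen hw e isOpen_univ h0] with t ht htI
  exact ht htI (mem_univ _)

end Operator

end MetricGraph

end

noncomputable section

/-! ### Powers of the operator -/

namespace MetricGraph

section Powers

variable {V E : Type*} [Fintype V] [Fintype E] {G : MetricGraph V E} {p q : E → ℝ → ℝ}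

/-- Sobolev regularity of the coefficients `p²` and `q²` sufficient for the exponent `α`. -/
structure CoeffReg (G : MetricGraph V E) (p q : E → ℝ → ℝ) (α : ℕ) : Prop where
  p_sq : ∀ e m, m + 1 ≤ α → BddSob (G.len e) ∞ m (fun _ : Unit => fun t => p e t ^ 2)
  p_sq_inv : ∀ e m, m + 1 ≤ α → BddSob (G.len e) ∞ m (fun _ : Unit => fun t => (p e t ^ 2)⁻¹)
  q_sq : ∀ e m, m + 2 ≤ α → BddSob (G.len e) ∞ m (fun _ : Unit => fun t => q e t ^ 2)

theorem DomL.congr_right {h b f f' : E → ℝ → ℝ} (hd : DomL G p q h b f)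
    (hf : ∀ e, f' e =ᵐ[G.edgeMeasure e] f e) : DomL G p q h b f' :=
  ⟨fun e => (memLp_congr_ae (hf e)).2 (hd.memLp e), hd.prim, fun e =>
    (hd.prim_flux e).congr (fun _ _ => rfl) (by
      filter_upwards [hf e] with t ht
      rw [ht]), hd.ends, hd.ends_flux⟩

/-- `f` is the image of `h` under the `k`-th power of the operator. -/
def PowL (G : MetricGraph V E) (p q : E → ℝ → ℝ) : ℕ → (E → ℝ → ℝ) → (E → ℝ → ℝ) → Prop
  | 0, h, f => h = f
  | k + 1, h, f => ∃ b h', DomL G p q h b h' ∧ PowL G p q k h' f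

theorem exists_powL (hw : G.Weights p q) (k : ℕ) {F : G.L2} {f : E → ℝ → ℝ}
    (hF : ∀ e, F e =ᵐ[G.edgeMeasure e] f e) :
    ∃ h, PowL G p q k h f ∧ ∀ e, (greenOp hw ^ k) F e =ᵐ[G.edgeMeasure e] h e := by
  induction k with
  | zero => exact ⟨f, rfl, hF⟩
  | succ k ih =>
    obtain ⟨h', hp, hh'⟩ := ih
    obtain ⟨h, b, hd, hh⟩ := exists_domL hw ((greenOp hw ^ k) F)
    refine ⟨h, ⟨b, h', hd.congr_right fun e => (hh' e).symm, hp⟩, fun e => ?_⟩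
    rw [pow_succ']
    exact hh e

theorem PowL.greenOp_pow_eq (hw : G.Weights p q) {k : ℕ} {h f : E → ℝ → ℝ}
    (hp : PowL G p q k h f) {F : G.L2} (hF : ∀ e, F e =ᵐ[G.edgeMeasure e] f e) (e : E) :
    (greenOp hw ^ k) F e =ᵐ[G.edgeMeasure e] h e := by
  induction k generalizing h e with
  | zero =>
    have : h = f := hp
    subst this
    exact hF e
  | succ k ih =>
    obtain ⟨b, h', hd, hp⟩ := hp
    rw [pow_succ']
    exact hd.greenOp_eq hw (fun e => ih hp e) e

theorem PowL.eq_zero_of_isOpen (hw : G.Weights p q) {k : ℕ} {h f : E → ℝ → ℝ}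
    (hp : PowL G p q k h f) (e : E) {O : Set ℝ} (hO : IsOpen O)
    (h0 : ∀ᵐ t, t ∈ Icc 0 (G.len e) → t ∈ O → h e t = 0) :
    ∀ᵐ t, t ∈ Icc 0 (G.len e) → t ∈ O → f e t = 0 := by
  induction k generalizing h with
  | zero =>
    have : h = f := hp
    subst this
    exact h0
  | succ k ih =>
    obtain ⟨b, h', hd, hp⟩ := hp
    exact ih hp (hd.eq_zero_of_isOpen hw e hO h0)

theorem BddSob.mul_unit {ι : Type*} {ℓ : ℝ} {n : ℕ} (hℓ : 0 ≤ ℓ) {c : ℝ → ℝ} {F : ι → ℝ → ℝ}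
    (hc : BddSob ℓ ∞ n (fun _ : Unit => c)) (hF : BddSob ℓ 2 n F) :
    BddSob ℓ 2 n (fun i t => c t * F i t) :=
  (hc.comp fun _ => ()).mul hℓ (by norm_num) hF

theorem bddSob_succ_of_isPrim {ι : Type*} {ℓ : ℝ} {n : ℕ} (hℓ : 0 ≤ ℓ) {f g : ℝ → ℝ}
    (h : IsPrim ℓ f g) (hg : BddSob ℓ 2 n (fun _ : ι => g)) :
    BddSob ℓ 2 (n + 1) (fun _ : ι => f) :=
  ⟨(bddLp_unit (h.memLp hℓ)).comp fun _ => (), _, hg, fun _ => h⟩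

/-- Bootstrap on h and the flux b together: h' = p⁻² b and b' = q² h - f give both one more
derivative per round, up to order m + 1. One last use of h' = p⁻² b gives order m + 2. -/
theorem DomL.bddSob {α m : ℕ} (hc : CoeffReg G p q α) {h b f : E → ℝ → ℝ}
    (hd : DomL G p q h b f) (e : E) (hm : m + 2 ≤ α)
    (hf : BddSob (G.len e) 2 m (fun _ : Unit => f e)) :
    BddSob (G.len e) 2 (m + 2) (fun _ : Unit => h e) := by
  have hl := (G.len_pos e).le
  have key : ∀ j, j ≤ m + 1 → BddSob (G.len e) 2 j (fun _ : Unit => h e) ∧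
      BddSob (G.len e) 2 j (fun _ : Unit => b e) := by
    intro j
    induction j with
    | zero => exact fun _ => ⟨bddLp_unit ((hd.prim e).memLp hl),
        bddLp_unit ((hd.prim_flux e).memLp hl)⟩
    | succ j ih =>
      intro hj
      obtain ⟨h1, h2⟩ := ih (by omega)
      refine ⟨bddSob_succ_of_isPrim hl (hd.prim e)
        (BddSob.mul_unit hl (hc.p_sq_inv e j (by omega)) h2), bddSob_succ_of_isPrim hl
        (hd.prim_flux e) (BddSob.sub hl (by norm_num)
          (BddSob.mul_unit hl (hc.q_sq e j (by omega)) h1) (hf.of_le (by omega)))⟩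
  obtain ⟨h1, h2⟩ := key (m + 1) le_rfl
  exact bddSob_succ_of_isPrim hl (hd.prim e)
        (BddSob.mul_unit hl (hc.p_sq_inv e (m + 1) (by omega)) h2)

theorem PowL.bddSob {α k r : ℕ} (hc : CoeffReg G p q α) {h f : E → ℝ → ℝ}
    (hp : PowL G p q k h f) (e : E) (hm : 2 * k + r ≤ α)
    (hf : BddSob (G.len e) 2 r (fun _ : Unit => f e)) :
    BddSob (G.len e) 2 (2 * k + r) (fun _ : Unit => h e) := by
  induction k generalizing h with
  | zero =>
    have : h = f := hp
    subst this
    simpa using hf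
  | succ k ih =>
    obtain ⟨b, h', hd, hp⟩ := hp
    have h1 := ih hp (by omega)
    have h2 := hd.bddSob hc e (by omega) h1
    have : 2 * (k + 1) + r = 2 * k + r + 2 := by ring
    rwa [this]

/-- Near the ends of the edges, `ψ` is the multiple of `φ` by the value of `σ` at the vertex. -/
def NearEnds (G : MetricGraph V E) (σ : V → ℝ) (ψ φ : E → ℝ → ℝ) : Prop :=
  ∃ δ > 0, ∀ e,
    (∀ᵐ t, t ∈ Icc 0 (G.len e) → t ∈ Iio δ → ψ e t = σ (G.src e) * φ e t) ∧
    (∀ᵐ t, t ∈ Icc 0 (G.len e) → t ∈ Ioi (G.len e - δ) → ψ e t = σ (G.tgt e) * φ e t)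

/-- Every point of O in [0, ℓ], including the ends, is a limit of points of O in the open interval,
where f vanishes. -/
theorem eq_zero_of_ae_near {ℓ : ℝ} (hℓ : 0 < ℓ) {f : ℝ → ℝ} (hf : ContinuousOn f (Icc 0 ℓ))
    {O : Set ℝ} (hO : IsOpen O) (h0 : ∀ᵐ t, t ∈ Icc 0 ℓ → t ∈ O → f t = 0) {t : ℝ}
    (ht : t ∈ Icc 0 ℓ) (htO : t ∈ O) : f t = 0 := by
  have hU : IsOpen (O ∩ Ioo 0 ℓ) := hO.inter isOpen_Ioo
  have h1 : EqOn f (fun _ => 0) (O ∩ Ioo 0 ℓ) := by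
    refine Measure.eqOn_open_of_ae_eq (μ := volume) ?_ hU
      (hf.mono fun x hx => Ioo_subset_Icc_self hx.2) continuousOn_const
    refine (ae_restrict_iff' hU.measurableSet).2 ?_
    filter_upwards [h0] with t ht htO using ht (Ioo_subset_Icc_self htO.2) htO.1
  have hcl : t ∈ closure (O ∩ Ioo 0 ℓ) := by
    have h2 : t ∈ closure (Ioo 0 ℓ) := by rwa [closure_Ioo hℓ.ne]
    exact hO.inter_closure ⟨htO, h2⟩
  have hne : (𝓝[O ∩ Ioo 0 ℓ] t).NeBot := mem_closure_iff_nhdsWithin_neBot.1 hcl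
  have h3 : Tendsto f (𝓝[O ∩ Ioo 0 ℓ] t) (𝓝 (f t)) :=
    (hf t ht).mono fun x hx => Ioo_subset_Icc_self hx.2
  refine tendsto_nhds_unique h3 (tendsto_const_nhds.congr' ?_)
  filter_upwards [self_mem_nhdsWithin] with x hx using (h1 hx).symm

theorem NearEnds.ends {σ : V → ℝ} {ψ φ : E → ℝ → ℝ} (h : NearEnds G σ ψ φ)
    (hψ : ∀ e, ContinuousOn (ψ e) (Icc 0 (G.len e)))
    (hφ : ∀ e, ContinuousOn (φ e) (Icc 0 (G.len e))) (e : E) :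
    ψ e 0 = σ (G.src e) * φ e 0 ∧ ψ e (G.len e) = σ (G.tgt e) * φ e (G.len e) := by
  obtain ⟨δ, hδ, h⟩ := h
  have hl := G.len_pos e
  constructor
  · refine sub_eq_zero.1 (eq_zero_of_ae_near hl (f := fun t => ψ e t - σ (G.src e) * φ e t)
      ((hψ e).sub (continuousOn_const.mul (hφ e))) isOpen_Iio ?_ (left_mem_Icc.2 hl.le) hδ)
    filter_upwards [(h e).1] with t ht h1 h2 using sub_eq_zero.2 (ht h1 h2)
  · refine sub_eq_zero.1 (eq_zero_of_ae_near hl (f := fun t => ψ e t - σ (G.tgt e) * φ e t)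
      ((hψ e).sub (continuousOn_const.mul (hφ e))) isOpen_Ioi ?_ (right_mem_Icc.2 hl.le)
      (show G.len e - δ < G.len e by linarith))
    filter_upwards [(h e).2] with t ht h1 h2 using sub_eq_zero.2 (ht h1 h2)

theorem NearEnds.endsContinuous {σ : V → ℝ} {ψ φ : E → ℝ → ℝ} (h : NearEnds G σ ψ φ)
    (hψ : ∀ e, ContinuousOn (ψ e) (Icc 0 (G.len e)))
    (hφ : ∀ e, ContinuousOn (φ e) (Icc 0 (G.len e)))
    (hc : G.EndsContinuous (fun e => φ e 0) (fun e => φ e (G.len e))) :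
    G.EndsContinuous (fun e => ψ e 0) (fun e => ψ e (G.len e)) := by
  obtain ⟨x, hx0, hx1⟩ := hc
  refine ⟨fun v => σ v * x v, fun e => ?_, fun e => ?_⟩
  · exact (h.ends hψ hφ e).1.trans (congrArg _ (hx0 e))
  · exact (h.ends hψ hφ e).2.trans (congrArg _ (hx1 e))

theorem NearEnds.endsBalanced {σ : V → ℝ} {ψ φ : E → ℝ → ℝ} (h : NearEnds G σ ψ φ)
    (hψ : ∀ e, ContinuousOn (ψ e) (Icc 0 (G.len e)))
    (hφ : ∀ e, ContinuousOn (φ e) (Icc 0 (G.len e)))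
    (hc : G.EndsBalanced (fun e => φ e 0) (fun e => φ e (G.len e))) :
    G.EndsBalanced (fun e => ψ e 0) (fun e => ψ e (G.len e)) := by
  intro x
  refine Eq.trans (Finset.sum_congr rfl fun e _ => ?_) (hc fun v => σ v * x v)
  simp only [(h.ends hψ hφ e).1, (h.ends hψ hφ e).2]
  ring

theorem NearEnds.derivative {σ : V → ℝ} {ψ φ ψ' φ' : E → ℝ → ℝ} (h : NearEnds G σ ψ φ)
    (hψ : ∀ e, IsPrim (G.len e) (ψ e) (ψ' e)) (hφ : ∀ e, IsPrim (G.len e) (φ e) (φ' e)) :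
    NearEnds G σ ψ' φ' := by
  obtain ⟨δ, hδ, h⟩ := h
  refine ⟨δ, hδ, fun e => ⟨?_, ?_⟩⟩
  · have h1 := (((hψ e).sub (G.len_pos e).le ((hφ e).const_mul (G.len_pos e).le
      (σ (G.src e))))).ae_eq_zero_of_isOpen (G.len_pos e).le (isOpen_Iio (a := δ)) (by
        filter_upwards [(h e).1] with t ht h1 h2 using sub_eq_zero.2 (ht h1 h2))
    filter_upwards [h1] with t ht h1 h2 using sub_eq_zero.1 (ht h1 h2)
  · have h1 := (((hψ e).sub (G.len_pos e).le ((hφ e).const_mul (G.len_pos e).le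
      (σ (G.tgt e))))).ae_eq_zero_of_isOpen (G.len_pos e).le (isOpen_Ioi (a := G.len e - δ)) (by
        filter_upwards [(h e).2] with t ht h1 h2 using sub_eq_zero.2 (ht h1 h2))
    filter_upwards [h1] with t ht h1 h2 using sub_eq_zero.1 (ht h1 h2)

theorem NearEnds.mul {σ : V → ℝ} {ψ φ c : E → ℝ → ℝ} (h : NearEnds G σ ψ φ) :
    NearEnds G σ (fun e t => c e t * ψ e t) (fun e t => c e t * φ e t) := by
  obtain ⟨δ, hδ, h⟩ := h
  refine ⟨δ, hδ, fun e => ⟨?_, ?_⟩⟩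
  · filter_upwards [(h e).1] with t ht h1 h2
    rw [ht h1 h2]
    ring
  · filter_upwards [(h e).2] with t ht h1 h2
    rw [ht h1 h2]
    ring

theorem NearEnds.sub {σ : V → ℝ} {ψ φ ψ₁ φ₁ : E → ℝ → ℝ} (h : NearEnds G σ ψ φ)
    (h' : NearEnds G σ ψ₁ φ₁) :
    NearEnds G σ (fun e t => ψ e t - ψ₁ e t) (fun e t => φ e t - φ₁ e t) := by
  obtain ⟨δ, hδ, h⟩ := h
  obtain ⟨δ', hδ', h'⟩ := h'
  refine ⟨min δ δ', lt_min hδ hδ', fun e => ⟨?_, ?_⟩⟩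
  · filter_upwards [(h e).1, (h' e).1] with t ht ht' h1 h2
    have h3 : t < min δ δ' := h2
    rw [ht h1 (h3.trans_le (min_le_left _ _)), ht' h1 (h3.trans_le (min_le_right _ _))]
    ring
  · filter_upwards [(h e).2, (h' e).2] with t ht ht' h1 h2
    have h3 : G.len e - min δ δ' < t := h2
    have := min_le_left δ δ'
    have := min_le_right δ δ'
    rw [ht h1 (show G.len e - δ < t by linarith), ht' h1 (show G.len e - δ' < t by linarith)]
    ring

theorem NearEnds.congr {σ : V → ℝ} {ψ φ φ₁ : E → ℝ → ℝ} (h : NearEnds G σ ψ φ)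
    (hφ : ∀ e, φ₁ e =ᵐ[G.edgeMeasure e] φ e) : NearEnds G σ ψ φ₁ := by
  obtain ⟨δ, hδ, h⟩ := h
  refine ⟨δ, hδ, fun e => ⟨?_, ?_⟩⟩
  · filter_upwards [(h e).1, (ae_restrict_iff' measurableSet_Icc).1 (hφ e)] with t ht h0 h1 h2
    rw [ht h1 h2, h0 h1]
  · filter_upwards [(h e).2, (ae_restrict_iff' measurableSet_Icc).1 (hφ e)] with t ht h0 h1 h2
    rw [ht h1 h2, h0 h1]

/-- Functions that agree with multiples of a function in the domain of a power of the operator near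
the ends of the edges are in this domain. -/
theorem PowL.exists_of_nearEnds {ι : Type*} (hw : G.Weights p q) {α k n : ℕ}
    (hc : CoeffReg G p q α) {φ f : E → ℝ → ℝ} (hp : PowL G p q k φ f) {ψ : ι → E → ℝ → ℝ}
    {σ : ι → V → ℝ} (hn : 2 * k + n ≤ α)
    (hψ : ∀ e, BddSob (G.len e) 2 (2 * k + n) (fun i => ψ i e))
    (hnear : ∀ i, NearEnds G (σ i) (ψ i) φ) :
    ∃ g : ι → E → ℝ → ℝ, (∀ e, BddSob (G.len e) 2 n (fun i => g i e)) ∧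
      (∀ i, PowL G p q k (ψ i) (g i)) ∧ ∀ i, NearEnds G (σ i) (g i) f := by
  induction k generalizing φ ψ with
  | zero =>
    have : φ = f := hp
    subst this
    exact ⟨ψ, by simpa using hψ, fun _ => rfl, hnear⟩
  | succ k ih =>
    obtain ⟨b, φ', hd, hp⟩ := hp
    have hl := fun e => (G.len_pos e).le
    have e1 : 2 * (k + 1) + n = 2 * k + n + 1 + 1 := by ring
    rw [e1] at hψ hn
    choose hψ1 D hD hψD using hψ
    have hbD : ∀ e, BddSob (G.len e) 2 (2 * k + n + 1) (fun i t => p e t ^ 2 * D e i t) := fun e =>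
      BddSob.mul_unit (hl e) (hc.p_sq e _ (by omega)) (hD e)
    choose hb1 B hB hbB using hbD
    have hψ2 : ∀ e, BddSob (G.len e) 2 (2 * k + n) (fun i => ψ i e) := fun e =>
      BddSob.of_le (n := 2 * k + n + 1 + 1) (by omega) ⟨hψ1 e, D e, hD e, hψD e⟩
    -- With D = ψ' and B = (p² ψ')', this is the image of ψ under the operator.
    have hfs : ∀ e, BddSob (G.len e) 2 (2 * k + n) (fun i t => q e t ^ 2 * ψ i e t - B e i t) :=
      fun e => BddSob.sub (hl e) (by norm_num)
        (BddSob.mul_unit (hl e) (hc.q_sq e _ (by omega)) (hψ2 e)) (hB e)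
    -- Near each vertex v all derived quantities are σ(v) times those of φ, and both vertex
    -- conditions survive multiplication by a function of the vertex.
    have hnD : ∀ i, NearEnds G (σ i) (fun e => D e i) (fun e t => (p e t ^ 2)⁻¹ * b e t) := fun i =>
      (hnear i).derivative (fun e => hψD e i) hd.prim
    have hnb : ∀ i, NearEnds G (σ i) (fun e t => p e t ^ 2 * D e i t) b := fun i =>
      ((hnD i).mul (c := fun e t => p e t ^ 2)).congr fun e => by
        filter_upwards [hw.p_ne e] with t ht
        rw [mul_inv_cancel_left₀ (pow_ne_zero 2 ht)]
    have hnB : ∀ i, NearEnds G (σ i) (fun e => B e i) (fun e t => q e t ^ 2 * φ e t - φ' e t) :=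
      fun i => (hnb i).derivative (fun e => hbB e i) hd.prim_flux
    have hnf : ∀ i, NearEnds G (σ i) (fun e t => q e t ^ 2 * ψ i e t - B e i t) φ' := fun i =>
      (((hnear i).mul (c := fun e t => q e t ^ 2)).sub (hnB i)).congr fun e =>
        ae_of_all _ fun t => by ring
    obtain ⟨g, hg1, hg2, hg3⟩ := ih hp (ψ := fun i e t => q e t ^ 2 * ψ i e t - B e i t) (by omega)
      hfs hnf
    refine ⟨g, hg1, fun i => ⟨fun e t => p e t ^ 2 * D e i t, _, ⟨fun e => ?_, fun e => ?_,
      fun e => ?_, ?_, ?_⟩, hg2 i⟩, hg3⟩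
    · obtain ⟨C, hC⟩ := (hfs e).bddLp
      exact (hC i).1
    · refine (hψD e i).congr (fun _ _ => rfl) ?_
      filter_upwards [hw.p_ne e] with t ht
      rw [inv_mul_cancel_left₀ (pow_ne_zero 2 ht)]
    · exact (hbB e i).congr (fun _ _ => rfl) (ae_of_all _ fun t => by simp)
    · exact (hnear i).endsContinuous (fun e => (hψD e i).continuousOn (hl e))
        (fun e => (hd.prim e).continuousOn (hl e)) hd.ends
    · exact (hnb i).endsBalanced (fun e => (hbB e i).continuousOn (hl e))
        (fun e => (hd.prim_flux e).continuousOn (hl e)) hd.ends_flux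

/-! ### The root of the covariance operator -/

/-- `B` is an operator with `B B* = T ^ r` for the Green operator `T`, where `Rep y f` means that `f` is
the precise representative of `B y`. -/
structure IsRoot (hw : G.Weights p q) (r : ℕ) {Y : Type*} [NormedAddCommGroup Y]
    [InnerProductSpace ℝ Y] [CompleteSpace Y] (B : Y →L[ℝ] G.L2) (Rep : Y → (E → ℝ → ℝ) → Prop) :
    Prop where
  comp_adjoint : ∀ F, B (ContinuousLinearMap.adjoint B F) = (greenOp hw ^ r) F
  exists_rep : ∀ y, ∃ f, Rep y f
  ae_eq : ∀ {y f}, Rep y f → ∀ e, B y e =ᵐ[G.edgeMeasure e] f e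
  bddSob : ∀ {y f}, Rep y f → ∀ e, BddSob (G.len e) 2 r (fun _ : Unit => f e)
  exists_of_nearEnds : ∀ {ι : Type} {y f} {g : ι → E → ℝ → ℝ} {σ : ι → V → ℝ}, Rep y f →
    (∀ e, BddSob (G.len e) 2 r (fun i => g i e)) → (∀ i, NearEnds G (σ i) (g i) f) →
    ∃ z : ι → Y, (∀ i, Rep (z i) (g i)) ∧ ∃ C, ∀ i, ‖z i‖ ≤ C
  inner_eq_zero : ∀ {y f z g} (O₁ O₂ : E → Set ℝ), Rep y f → Rep z g → (∀ e, IsOpen (O₁ e)) →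
    (∀ e, IsOpen (O₂ e)) → (∀ e, Icc 0 (G.len e) ⊆ O₁ e ∪ O₂ e) →
    (∀ e, ∀ᵐ t, t ∈ Icc 0 (G.len e) → t ∈ O₁ e → f e t = 0) →
    (∀ e, ∀ᵐ t, t ∈ Icc 0 (G.len e) → t ∈ O₂ e → g e t = 0) → inner ℝ y z = 0

theorem integral_mul_eq_zero {ℓ : ℝ} {f g c : ℝ → ℝ} {O₁ O₂ : Set ℝ} (hO : Icc 0 ℓ ⊆ O₁ ∪ O₂)
    (hf : ∀ᵐ t, t ∈ Icc 0 ℓ → t ∈ O₁ → f t = 0) (hg : ∀ᵐ t, t ∈ Icc 0 ℓ → t ∈ O₂ → g t = 0) :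
    ∀ᵐ t ∂(volume.restrict (Icc 0 ℓ)), c t * (f t * g t) = 0 := by
  refine (ae_restrict_iff' measurableSet_Icc).2 ?_
  filter_upwards [hf, hg] with t h1 h2 ht
  rcases hO ht with h | h
  · rw [h1 ht h, zero_mul, mul_zero]
  · rw [h2 ht h, mul_zero, mul_zero]

theorem BddLp.exists_integral_sq_le {ι : Type*} {ℓ : ℝ} {F : ι → ℝ → ℝ} (h : BddLp ℓ 2 F) :
    ∃ C : ℝ, ∀ i, ∫ t in Icc 0 ℓ, F i t * F i t ≤ C := by
  obtain ⟨C, hC⟩ := h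
  refine ⟨(C : ℝ) ^ 2, fun i => ?_⟩
  have h1 : ∫ t in Icc 0 ℓ, F i t * F i t = ‖(hC i).1.toLp‖ ^ 2 := by
    rw [← real_inner_self_eq_norm_sq, L2.inner_def]
    refine integral_congr_ae ?_
    filter_upwards [(hC i).1.coeFn_toLp] with t ht
    rw [ht, real_inner_self_eq_norm_sq, Real.norm_eq_abs, sq_abs, pow_two]
  rw [h1, Lp.norm_toLp]
  gcongr
  exact ENNReal.toReal_le_coe_of_le_coe (hC i).2

theorem exists_norm_le_of_inner_eq_sum {ι Y : Type*} [NormedAddCommGroup Y] [InnerProductSpace ℝ Y]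
    {z : ι → Y} {I : ι → E → ℝ} (h : ∀ i, inner ℝ (z i) (z i) = ∑ e, I i e)
    (hI : ∀ e, ∃ C : ℝ, ∀ i, I i e ≤ C) : ∃ C, ∀ i, ‖z i‖ ≤ C := by
  choose C hC using hI
  refine ⟨√(∑ e, C e), fun i => ?_⟩
  refine Real.le_sqrt_of_sq_le ?_
  rw [← real_inner_self_eq_norm_sq, h i]
  exact Finset.sum_le_sum fun e _ => hC e i

/-- The root for even exponents, where only L₂ integrability remains after the integer powers. -/
theorem isRoot_id (hw : G.Weights p q) :
    IsRoot hw 0 (ContinuousLinearMap.id ℝ G.L2) (fun y f => ∀ e, y e =ᵐ[G.edgeMeasure e] f e) where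
  comp_adjoint F := by
    have h : ContinuousLinearMap.adjoint (ContinuousLinearMap.id ℝ G.L2) F = F := by
      refine ext_inner_right ℝ fun z => ?_
      rw [ContinuousLinearMap.adjoint_inner_left]
      rfl
    rw [h]
    rfl
  exists_rep y := ⟨fun e => y e, fun _ => EventuallyEq.rfl⟩
  ae_eq h := h
  bddSob h e := bddLp_unit ((memLp_congr_ae (h e)).1 (L2.memLp _ e))
  exists_of_nearEnds := by
    intro ι y f g σ _ hg _
    choose C hC using hg
    have hm : ∀ i e, MemLp (g i e) 2 (G.edgeMeasure e) := fun i e => (hC e i).1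
    refine ⟨fun i => ofFun (g i) (hm i), fun i => coeFn_ofFun _ _, ?_⟩
    exact exists_norm_le_of_inner_eq_sum
      (fun i => L2.inner_eq_of_ae (coeFn_ofFun _ (hm i)) (coeFn_ofFun _ (hm i)))
      (fun e => BddLp.exists_integral_sq_le ⟨C e, hC e⟩)
  inner_eq_zero := by
    intro y f z g O₁ O₂ hy hz _ _ hO h1 h2
    rw [L2.inner_eq_of_ae hy hz]
    refine Finset.sum_eq_zero fun e _ => integral_eq_zero_of_ae ?_
    filter_upwards [integral_mul_eq_zero (c := fun _ => 1) (hO e) (h1 e) (h2 e)] with t ht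
    simpa using ht

/-- The root for odd exponents: B B* is the Green operator by construction, and the energy form
replaces a square root of the operator, which would not be local. -/
theorem isRoot_energyEmb (hw : G.Weights p q) :
    IsRoot hw 1 (Y := energySpace G p q) (energyEmb hw)
      (fun y f => ∃ g, EnergyRep p q (y : WithLp 2 (G.L2 × G.L2)) f g) where
  comp_adjoint F := by
    rw [pow_one]
    rfl
  exists_rep y := exists_energyRep hw y.2
  ae_eq h e := by
    obtain ⟨g, hg⟩ := h
    exact hg.emb_eq hw e
  bddSob h e := by
    obtain ⟨g, hg⟩ := h
    exact bddSob_succ_of_isPrim (G.len_pos e).le (hg.prim e) (bddLp_unit (hg.memLp e))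
  exists_of_nearEnds := by
    intro ι y f g σ hy hg hn
    obtain ⟨f', hf⟩ := hy
    have hl := fun e => (G.len_pos e).le
    choose hgL D hD hgD using hg
    choose C hC using hgL
    choose C' hC' using hD
    have hm1 : ∀ i e, MemLp (fun t => p e t * D e i t) 2 (G.edgeMeasure e) := fun i e =>
      memLp_mul_of_top (hw.p_mem e) (hC' e i).1
    have hm2 : ∀ i e, MemLp (fun t => q e t * g i e t) 2 (G.edgeMeasure e) := fun i e =>
      memLp_mul_of_top (hw.q_mem e) (hC e i).1
    have hr : ∀ i, EnergyRep p q (WithLp.toLp 2 (ofFun _ (hm1 i), ofFun _ (hm2 i))) (g i)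
        (fun e => D e i) := fun i =>
      ⟨fun e => (hC' e i).1, fun e => hgD e i, (hn i).endsContinuous
        (fun e => (hgD e i).continuousOn (hl e)) (fun e => (hf.prim e).continuousOn (hl e)) hf.ends,
        coeFn_ofFun _ (hm1 i), coeFn_ofFun _ (hm2 i)⟩
    refine ⟨fun i => ⟨_, (hr i).mem hw⟩, fun i => ⟨_, hr i⟩, ?_⟩
    refine exists_norm_le_of_inner_eq_sum (fun i => by
      rw [Submodule.coe_inner]
      exact inner_prod_eq (hr i).fst_eq (hr i).snd_eq (hr i).fst_eq (hr i).snd_eq) fun e => ?_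
    obtain ⟨C₁, hC₁⟩ := BddLp.exists_integral_sq_le (BddLp.mul
      ((bddLp_unit (hw.p_mem e)).comp fun _ => ()) (⟨C' e, hC' e⟩ : BddLp (G.len e) 2 (D e)))
    obtain ⟨C₂, hC₂⟩ := BddLp.exists_integral_sq_le (BddLp.mul
      ((bddLp_unit (hw.q_mem e)).comp fun _ => ())
      (⟨C e, hC e⟩ : BddLp (G.len e) 2 (fun i => g i e)))
    refine ⟨C₁ + C₂, fun i => ?_⟩
    rw [integral_add (MemLp.integrable_mul_Icc (hm1 i e) (hm1 i e))
      (MemLp.integrable_mul_Icc (hm2 i e) (hm2 i e))]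
    exact add_le_add (hC₁ i) (hC₂ i)
  inner_eq_zero := by
    intro y f z g O₁ O₂ hy hz hO₁ hO₂ hO h1 h2
    obtain ⟨f', hf⟩ := hy
    obtain ⟨g', hg⟩ := hz
    rw [Submodule.coe_inner, inner_prod_eq hf.fst_eq hf.snd_eq hg.fst_eq hg.snd_eq]
    refine Finset.sum_eq_zero fun e _ => integral_eq_zero_of_ae ?_
    have h3 := (hf.prim e).ae_eq_zero_of_isOpen (G.len_pos e).le (hO₁ e) (h1 e)
    have h4 := (hg.prim e).ae_eq_zero_of_isOpen (G.len_pos e).le (hO₂ e) (h2 e)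
    filter_upwards [integral_mul_eq_zero (c := fun t => p e t ^ 2) (hO e) h3 h4,
      integral_mul_eq_zero (c := fun t => q e t ^ 2) (hO e) (h1 e) (h2 e)] with t ht ht'
    change p e t * f' e t * (p e t * g' e t) + q e t * f e t * (q e t * g e t) = 0
    linear_combination ht + ht'

end Powers

end MetricGraph

end

noncomputable section

/-! ### Points of the graph and coefficients -/

namespace MetricGraph

section Coefficients

variable {V E : Type*} [Fintype V] [Fintype E] {G : MetricGraph V E}

theorem pt_projIcc (e : E) (t : ℝ) :
    G.pt e (projIcc 0 (G.len e) (G.len_pos e).le t) = G.pt e t := by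
  rw [pt, pt, projIcc_val]

theorem edist_pt_le (e : E) {s t : ℝ} (hs : s ∈ Icc 0 (G.len e)) (ht : t ∈ Icc 0 (G.len e)) :
    edist (G.pt e s) (G.pt e t) ≤ edist s t := by
  rw [edist_dist, Real.dist_eq]
  refine sInf_le ?_
  simpa using PathLength.cons e s t hs ht _ 0 (PathLength.refl (G.pt e t))

theorem lipschitzWith_pt (e : E) : LipschitzWith 1 (G.pt e) := by
  intro s t
  rw [← pt_projIcc e s, ← pt_projIcc e t]
  refine (edist_pt_le e (Subtype.prop _) (Subtype.prop _)).trans ?_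
  exact LipschitzWith.projIcc (G.len_pos e).le s t

theorem continuous_pt (e : E) : Continuous (G.pt e) := (lipschitzWith_pt e).continuous

theorem exists_pt_eq (s : G.Point) : ∃ e, ∃ t ∈ Icc 0 (G.len e), G.pt e t = s := by
  obtain ⟨⟨e, t⟩, rfl⟩ := Quotient.exists_rep s
  refine ⟨e, t, t.2, ?_⟩
  rw [pt, projIcc_val]

open scoped Classical in
/-- The point of `Γ` located at a vertex. -/
def vertexPt (G : MetricGraph V E) (v : V) : G.Point :=
  if h : ∃ x : G.Loc, G.AtVertex x v then Quotient.mk G.glue h.choose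
  else G.pt G.nonempty_edges.some 0

theorem mk_eq_vertexPt {x : G.Loc} {v : V} (h : G.AtVertex x v) :
    Quotient.mk G.glue x = vertexPt G v := by
  have he : ∃ x : G.Loc, G.AtVertex x v := ⟨x, h⟩
  have h1 : vertexPt G v = Quotient.mk G.glue he.choose := dif_pos he
  exact (Quotient.sound (Or.inr ⟨v, h, he.choose_spec⟩)).trans h1.symm

theorem pt_zero (e : E) : G.pt e 0 = vertexPt G (G.src e) := by
  refine mk_eq_vertexPt (Or.inl ⟨?_, rfl⟩)
  simp

theorem pt_len (e : E) : G.pt e (G.len e) = vertexPt G (G.tgt e) := by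
  refine mk_eq_vertexPt (Or.inr ⟨?_, rfl⟩)
  simp

/-- The weights `p`, `q` represent the coefficients `a`, `κ`. -/
structure Represents (κ a : G.Point → ℝ) (p q : E → ℝ → ℝ) : Prop where
  a_pos : ∀ s, 0 < a s
  a_cont : Continuous a
  p_sq : ∀ e t, p e t ^ 2 = a (G.pt e t)
  q_sq : ∀ e, (fun t => q e t ^ 2) =ᵐ[G.edgeMeasure e] fun t => κ (G.pt e t) ^ 2

theorem ae_of_eqOn_Ioo {ℓ : ℝ} {f g : ℝ → ℝ} (h : EqOn f g (Ioo 0 ℓ)) :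
    f =ᵐ[volume.restrict (Icc 0 ℓ)] g := by
  have hn0 : ∀ᵐ x ∂(volume.restrict (Icc (0 : ℝ) ℓ)), x ≠ 0 :=
    ae_restrict_of_ae (by simp [ae_iff, measure_singleton])
  have hnl : ∀ᵐ x ∂(volume.restrict (Icc (0 : ℝ) ℓ)), x ≠ ℓ :=
    ae_restrict_of_ae (by simp [ae_iff, measure_singleton])
  filter_upwards [hn0, hnl, ae_restrict_mem measurableSet_Icc] with t h0 hl htI
  exact h ⟨lt_of_le_of_ne htI.1 (Ne.symm h0), lt_of_le_of_ne htI.2 hl⟩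

/-- For α ≥ 3 the class C^{α-3,1} is contained in W^{α-2,∞}, after correcting κ at the ends of the
edge. For α ≤ 2 only order 0 can occur, and boundedness is enough. -/
theorem exists_kappa_rep {κ a : G.Point → ℝ} {α : ℕ} (h : G.CoeffAssumption κ a α) (e : E) :
    ∃ q : ℝ → ℝ, q =ᵐ[G.edgeMeasure e] (fun t => κ (G.pt e t)) ∧
      ∀ m, m + 2 ≤ α → BddSob (G.len e) ∞ m (fun _ : Unit => q) := by
  obtain ⟨C, hC⟩ := h.basic.kappa_bdd
  by_cases hα : 3 ≤ α
  · have h1 := h.kappa_reg (by exact_mod_cast hα) e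
    rw [Nat.floor_natCast] at h1
    obtain ⟨g, hg, hgS⟩ := h1.exists_bddSob (G.len_pos e)
    exact ⟨g, ae_of_eqOn_Ioo hg, fun m hm => hgS.of_le (by omega)⟩
  · refine ⟨_, EventuallyEq.rfl, fun m hm => ?_⟩
    have : m = 0 := by omega
    subst this
    exact bddLp_unit (memLp_top_of_bound (h.basic.kappa_meas e) C (hC e))

theorem CoeffAssumption.bddSob_a {κ a : G.Point → ℝ} {α : ℕ} (h : G.CoeffAssumption κ a α) (e : E)
    {m : ℕ} (hm : m + 1 ≤ α) : BddSob (G.len e) ∞ m (fun _ : Unit => fun t => a (G.pt e t)) := by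
  obtain ⟨K, hK⟩ := h.basic.a_lip
  have hl := G.len_pos e
  have hLip : LipschitzWith (K * 1) fun t => a (G.pt e t) := hK.comp (lipschitzWith_pt e)
  by_cases hα : 3 ≤ α
  · have h1 := h.a_reg (by exact_mod_cast hα) e
    rw [Nat.floor_natCast] at h1
    obtain ⟨g, hg, hgS⟩ := h1.exists_bddSob hl
    have h2 : EqOn (fun t => a (G.pt e t)) g (Icc 0 (G.len e)) :=
      eqOn_Icc_of_ae_eq hl hLip.continuous.continuousOn (hgS.continuousOn hl.le ())
        (ae_of_eqOn_Ioo hg.symm)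
    exact (hgS.congr fun _ => h2).of_le (by omega)
  · exact (hLip.bddSob_one hl.le).of_le (by omega)

/-- The weights are p = √a and a representative q of κ. Derivatives are required only of p² = a, 1 /
a and q², so the square root is never differentiated. -/
theorem CoeffAssumption.exists_weights {κ a : G.Point → ℝ} {α : ℕ} (h : G.CoeffAssumption κ a α) :
    ∃ p q : E → ℝ → ℝ, G.Weights p q ∧ CoeffReg G p q α ∧ Represents κ a p q := by
  choose q hqκ hqS using fun e => exists_kappa_rep h e
  obtain ⟨K, hK⟩ := h.basic.a_lip
  obtain ⟨κ₀, hκ₀, hκ⟩ := h.basic.kappa_pos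
  obtain ⟨C, hC⟩ := h.basic.kappa_bdd
  have hp : ∀ e t, √(a (G.pt e t)) ^ 2 = a (G.pt e t) := fun e t =>
    Real.sq_sqrt (h.basic.a_pos _).le
  have hpc : ∀ e, Continuous fun t => a (G.pt e t) := fun e => hK.continuous.comp (continuous_pt e)
  have hlow : ∀ e, ∃ c > 0, ∀ t ∈ Icc 0 (G.len e), c ≤ a (G.pt e t) := fun e => by
    obtain ⟨t₀, _, ht₀⟩ := isCompact_Icc.exists_isMinOn
      (nonempty_Icc.2 (G.len_pos e).le) (hpc e).continuousOn
    exact ⟨_, h.basic.a_pos _, fun t ht => ht₀ ht⟩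
  have hq0 : ∀ e, ∀ᵐ t ∂(G.edgeMeasure e), κ₀ ≤ q e t := fun e => by
    filter_upwards [hκ e, hqκ e] with t h1 h2
    rwa [h2]
  have hqm : ∀ e, MemLp (q e) ∞ (G.edgeMeasure e) := fun e =>
    (memLp_congr_ae (hqκ e)).2 (memLp_top_of_bound (h.basic.kappa_meas e) C (hC e))
  refine ⟨fun e t => √(a (G.pt e t)), q, ⟨fun e => ?_, fun e => ?_, fun e => ?_, hqm, fun e => ?_,
    fun e => ?_⟩, ⟨fun e m hm => ?_, fun e m hm => ?_, fun e m hm => ?_⟩,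
    ⟨h.basic.a_pos, hK.continuous, hp, fun e => ?_⟩⟩
  · exact (hpc e).sqrt.continuousOn.memLp_Icc
  · exact ContinuousOn.memLp_Icc ((hpc e).sqrt.continuousOn.inv₀ fun t _ =>
      (Real.sqrt_pos.2 (h.basic.a_pos _)).ne')
  · exact ae_of_all _ fun t => (Real.sqrt_pos.2 (h.basic.a_pos _)).ne'
  · refine memLp_top_of_bound (hqm e).1.aemeasurable.inv.aestronglyMeasurable κ₀⁻¹ ?_
    filter_upwards [hq0 e] with t ht
    rw [norm_inv, Real.norm_eq_abs, abs_of_pos (hκ₀.trans_le ht)]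
    exact inv_anti₀ hκ₀ ht
  · filter_upwards [hq0 e] with t ht using (hκ₀.trans_le ht).ne'
  · simp only [hp]
    exact h.bddSob_a e hm
  · simp only [hp]
    obtain ⟨c, hc, hca⟩ := hlow e
    exact (h.bddSob_a e hm).inv (G.len_pos e).le hc fun _ => hca
  · simp only [pow_two]
    exact (hqS e m hm).mul (G.len_pos e).le le_top (hqS e m hm)
  · filter_upwards [hqκ e] with t ht
    rw [ht]

variable {κ a : G.Point → ℝ} {p q : E → ℝ → ℝ}

/-- The conditions defining L give those of `DomL` with flux a f'. -/
theorem LGraph.greenOp_eq (hw : G.Weights p q) (hr : Represents κ a p q) {η ψ : G.L2}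
    (h : G.LGraph κ a η ψ) : greenOp hw ψ = η := by
  classical
  obtain ⟨F, f', f'', d, hF, hη, hF', hf'c, -, hK, hd, hψ⟩ := h
  have hFc : ∀ e, Continuous fun t => F (G.pt e t) := fun e => hF.comp (continuous_pt e)
  have hac : ∀ e, Continuous fun t => a (G.pt e t) := fun e => hr.a_cont.comp (continuous_pt e)
  have hD : DomL G p q (fun e t => F (G.pt e t)) (fun e t => a (G.pt e t) * f' e t)
      (fun e => ψ e) := by
    refine ⟨L2.memLp ψ, fun e => ?_, fun e => ?_, ⟨fun v => F (vertexPt G v), fun e => ?_,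
      fun e => ?_⟩, fun x => ?_⟩
    · refine ((hF' e).isPrim (G.len_pos e) (hFc e).continuousOn).congr (fun _ _ => rfl)
        (ae_of_all _ fun t => ?_)
      simp only [hr.p_sq, inv_mul_cancel_left₀ (hr.a_pos _).ne']
    · refine ((hd e).isPrim (G.len_pos e) ((hac e).continuousOn.mul (hf'c e))).congr
        (fun _ _ => rfl) ?_
      filter_upwards [hψ e, hr.q_sq e] with t h1 h2
      rw [h1, h2]
      ring
    · exact congrArg F (pt_zero e)
    · exact congrArg F (pt_len e)
    -- At a vertex v all incident ends share the value a(v), which factors out: the condition on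
    -- derivatives implies the balance of the fluxes a f'.
    · have h1 : ∀ e, a (G.pt e (G.len e)) * f' e (G.len e) * x (G.tgt e) -
          a (G.pt e 0) * f' e 0 * x (G.src e) = ∑ v, -(a (vertexPt G v) * x v *
          ((if G.src e = v then f' e 0 else 0) +
            (if G.tgt e = v then -f' e (G.len e) else 0))) := by
        intro e
        rw [pt_len, pt_zero]
        simp only [mul_add, mul_ite, mul_zero, neg_add, Finset.sum_add_distrib,
          Finset.sum_neg_distrib, Finset.sum_ite_eq, Finset.mem_univ, if_true]
        ring
      simp only [h1]
      rw [Finset.sum_comm]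
      refine Finset.sum_eq_zero fun v _ => ?_
      rw [Finset.sum_neg_distrib, ← Finset.mul_sum, hK v, mul_zero, neg_zero]
  exact L2.ext_ae fun e => (hD.greenOp_eq hw (fun _ => EventuallyEq.rfl) e).trans (hη e).symm

theorem greenOp_eigenvalue_pos (hw : G.Weights p q) {ν : ℝ} {η : G.L2} (hη : η ≠ 0)
    (h : greenOp hw η = ν • η) : 0 < ν := by
  have h1 := inner_greenOp hw η η
  rw [h, real_inner_smul_left] at h1
  have h2 : 0 < (inner ℝ η η : ℝ) := real_inner_self_pos.2 hη
  have h3 : 0 ≤ (inner ℝ (energyAdj hw η) (energyAdj hw η) : ℝ) := real_inner_self_nonneg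
  have hν : ν ≠ 0 := by
    rintro rfl
    rw [zero_smul] at h
    exact hη (greenOp_injective hw (h.trans (map_zero _).symm))
  have h4 : 0 ≤ ν := by
    by_contra hneg
    have : ν * (inner ℝ η η : ℝ) < 0 := mul_neg_of_neg_of_pos (not_le.1 hneg) h2
    linarith
  exact lt_of_le_of_ne h4 hν.symm

theorem inner_eigenvector_eq_zero (hw : G.Weights p q) {ν ν' : ℝ} {η η' : G.L2}
    (h : greenOp hw η = ν • η) (h' : greenOp hw η' = ν' • η') (hne : ν ≠ ν') :
    inner ℝ η η' = 0 := by
  have h1 : inner ℝ (greenOp hw η) η' = inner ℝ η (greenOp hw η') :=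
    isSymmetric_greenOp hw η η'
  rw [h, h', real_inner_smul_left, real_inner_smul_right] at h1
  have h2 : (ν - ν') * (inner ℝ η η' : ℝ) = 0 := by
    linarith
  exact (mul_eq_zero.1 h2).resolve_left (sub_ne_zero.2 hne)

/-- The condition must be tested on eigenvectors ζ of L. These are eigenvectors of T with the
inverse eigenvalue, so either that eigenvalue is ν or both sides vanish by orthogonality. It is not
needed that η itself be an eigenvector of L. -/
theorem lpowGraph_eigenvector (hw : G.Weights p q) (hr : Represents κ a p q) (s : ℝ) {ν : ℝ}
    {η : G.L2} (hη : η ≠ 0) (h : greenOp hw η = ν • η) :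
    G.LPowGraph κ a s η (ν ^ (-s) • η) := by
  intro lam ζ hζ hL
  have hν := greenOp_eigenvalue_pos hw hη h
  have h1 : greenOp hw (lam • ζ) = ζ := hL.greenOp_eq hw hr
  rw [map_smul] at h1
  have hlam : lam ≠ 0 := by
    rintro rfl
    exact hζ (by rw [← h1, zero_smul])
  have h2 : greenOp hw ζ = lam⁻¹ • ζ := by
    rw [eq_inv_smul_iff₀ hlam, h1]
  rw [real_inner_smul_left]
  by_cases hne : ν = lam⁻¹
  · have h0 : 0 ≤ lam := by
      rw [← inv_nonneg, ← hne]
      exact hν.le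
    rw [hne, Real.inv_rpow h0, Real.rpow_neg h0, inv_inv]
  · rw [inner_eigenvector_eq_zero hw h h2 hne, mul_zero, mul_zero]

/-- Two continuous bilinear forms which agree on eigenvectors of the Green operator are equal. -/
theorem ext_eigenvectors (hw : G.Weights p q) {β : Type*} [AddCommGroup β] [Module ℝ β]
    [TopologicalSpace β] [T2Space β] {S T : G.L2 →L[ℝ] β}
    (h : ∀ (ν : ℝ) (η : G.L2), η ≠ 0 → greenOp hw η = ν • η → S η = T η) : S = T := by
  -- Spectral theorem: the eigenvectors of the compact symmetric operator T span a dense subspace.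
  have h1 := ContinuousLinearMap.orthogonalComplement_iSup_eigenspaces_eq_bot
    (isCompactOperator_greenOp hw) (isSymmetric_greenOp hw)
  have h2 := Submodule.topologicalClosure_eq_top_iff.2 h1
  refine ContinuousLinearMap.ext fun f => ?_
  have hcl : IsClosed {f : G.L2 | S f = T f} := isClosed_eq S.continuous T.continuous
  have hle : (⨆ ν, Module.End.eigenspace (greenOp hw : G.L2 →ₗ[ℝ] G.L2) ν) ≤
      LinearMap.eqLocus (S : G.L2 →ₗ[ℝ] β) (T : G.L2 →ₗ[ℝ] β) := by
    refine iSup_le fun ν η hη => ?_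
    rw [Module.End.mem_eigenspace_iff] at hη
    by_cases h0 : η = 0
    · subst h0
      exact zero_mem _
    · exact h ν η h0 hη
  have hf : f ∈ (⨆ ν, Module.End.eigenspace (greenOp hw : G.L2 →ₗ[ℝ] G.L2) ν).topologicalClosure := by
    rw [h2]
    trivial
  exact closure_minimal (fun x hx => hle hx) hcl hf

end Coefficients

end MetricGraph

end

noncomputable section

/-! ### The isometry between the Gaussian space and the energy space -/

section Isometry

variable {X H Y : Type*} [NormedAddCommGroup X] [InnerProductSpace ℝ X] [CompleteSpace X]
  [NormedAddCommGroup H] [InnerProductSpace ℝ H] [CompleteSpace H]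
  [NormedAddCommGroup Y] [InnerProductSpace ℝ Y] [CompleteSpace Y]

omit [CompleteSpace X] [CompleteSpace H] in
-- The map S f ↦ R f is well defined and isometric because norms agree; it extends from the range of
-- S to its closure.
theorem exists_isometry_of_inner_eq {S : X →L[ℝ] H} {R : X →L[ℝ] Y}
    (h : ∀ f g, (inner ℝ (S f) (S g) : ℝ) = inner ℝ (R f) (R g)) :
    ∃ J : (LinearMap.range (S : X →ₗ[ℝ] H)).topologicalClosure →L[ℝ] Y,
      (∀ f (hf : S f ∈ (LinearMap.range (S : X →ₗ[ℝ] H)).topologicalClosure), J ⟨S f, hf⟩ = R f) ∧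
      ∀ w w', (inner ℝ (J w) (J w') : ℝ) = inner ℝ w w' := by
  set K := (LinearMap.range (S : X →ₗ[ℝ] H)).topologicalClosure with hK
  have hmem : ∀ f, S f ∈ K := fun f => subset_closure ⟨f, rfl⟩
  let e : X →ₗ[ℝ] K := (S : X →ₗ[ℝ] H).codRestrict K hmem
  have hd : DenseRange e := by
    rw [DenseRange, dense_iff_closure_eq, eq_univ_iff_forall]
    intro w
    rw [closure_subtype]
    have h1 : (w : H) ∈ closure (range S) := w.2
    refine closure_mono ?_ h1
    rintro _ ⟨f, rfl⟩
    exact ⟨e f, ⟨f, rfl⟩, rfl⟩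
  have hn : ∀ f, ‖(R : X →ₗ[ℝ] Y) f‖ ≤ 1 * ‖e f‖ := fun f => by
    have h1 : ‖S f‖ = ‖R f‖ := by
      rw [← sq_eq_sq₀ (norm_nonneg _) (norm_nonneg _), ← real_inner_self_eq_norm_sq,
        ← real_inner_self_eq_norm_sq, h]
    rw [one_mul]
    exact h1.ge
  have hJ : ∀ f, (R : X →ₗ[ℝ] Y).extendOfNorm e (e f) = R f := fun f =>
    LinearMap.extendOfNorm_eq hd ⟨1, hn⟩ f
  refine ⟨(R : X →ₗ[ℝ] Y).extendOfNorm e, fun f hf => hJ f, fun w w' => ?_⟩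
  refine hd.induction_on₂ (p := fun w w' => (inner ℝ ((R : X →ₗ[ℝ] Y).extendOfNorm e w)
    ((R : X →ₗ[ℝ] Y).extendOfNorm e w') : ℝ) = inner ℝ w w') ?_ ?_ w w'
  · exact isClosed_eq (by fun_prop) (by fun_prop)
  · intro f g
    rw [hJ, hJ, ← h]
    rfl

/-- If `S* S = R* R`, then the images of `S*` on the closure of the range of `S` and of `R*`
coincide, isometrically. -/
theorem exists_adjoint_eq_of_inner_eq {S : X →L[ℝ] H} {R : X →L[ℝ] Y}
    (h : ∀ f g, (inner ℝ (S f) (S g) : ℝ) = inner ℝ (R f) (R g)) :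
    (∃ J : H → Y,
      (∀ w ∈ (LinearMap.range (S : X →ₗ[ℝ] H)).topologicalClosure,
        ContinuousLinearMap.adjoint R (J w) = ContinuousLinearMap.adjoint S w) ∧
      ∀ w ∈ (LinearMap.range (S : X →ₗ[ℝ] H)).topologicalClosure,
        ∀ w' ∈ (LinearMap.range (S : X →ₗ[ℝ] H)).topologicalClosure,
          (inner ℝ (J w) (J w') : ℝ) = inner ℝ w w') ∧
    ∀ y, ∃ w ∈ (LinearMap.range (S : X →ₗ[ℝ] H)).topologicalClosure, ‖w‖ ≤ ‖y‖ ∧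
      ContinuousLinearMap.adjoint S w = ContinuousLinearMap.adjoint R y := by
  classical
  obtain ⟨J, hJ, hJi⟩ := exists_isometry_of_inner_eq h
  have hmem : ∀ f, S f ∈ (LinearMap.range (S : X →ₗ[ℝ] H)).topologicalClosure := fun f =>
    subset_closure ⟨f, rfl⟩
  refine ⟨⟨fun w => if hw : w ∈ (LinearMap.range (S : X →ₗ[ℝ] H)).topologicalClosure then J ⟨w, hw⟩
    else 0, fun w hw => ?_, fun w hw w' hw' => ?_⟩, fun y => ?_⟩
  · simp only [dif_pos hw]
    refine ext_inner_right ℝ fun f => ?_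
    rw [ContinuousLinearMap.adjoint_inner_left, ContinuousLinearMap.adjoint_inner_left,
      ← hJ f (hmem f), hJi]
    rfl
  · simp only [dif_pos hw, dif_pos hw', hJi]
    rfl
  -- The witness is J* y, whose norm is at most that of y since J is isometric.
  · refine ⟨_, (ContinuousLinearMap.adjoint J y).2, ?_, ?_⟩
    · have h1 : (inner ℝ (ContinuousLinearMap.adjoint J y) (ContinuousLinearMap.adjoint J y) : ℝ) =
          inner ℝ y (J (ContinuousLinearMap.adjoint J y)) :=
        ContinuousLinearMap.adjoint_inner_left _ _ _
      have h2 : ‖J (ContinuousLinearMap.adjoint J y)‖ = ‖ContinuousLinearMap.adjoint J y‖ := by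
        rw [← sq_eq_sq₀ (norm_nonneg _) (norm_nonneg _), ← real_inner_self_eq_norm_sq,
          ← real_inner_self_eq_norm_sq, hJi]
      have h3 := real_inner_le_norm y (J (ContinuousLinearMap.adjoint J y))
      rw [← h1, h2, real_inner_self_eq_norm_sq] at h3
      change ‖ContinuousLinearMap.adjoint J y‖ ≤ ‖y‖
      by_contra hlt
      have h5 := not_le.1 hlt
      have h6 := (norm_nonneg y).trans_lt h5
      nlinarith
    · refine ext_inner_right ℝ fun f => ?_
      rw [ContinuousLinearMap.adjoint_inner_left, ContinuousLinearMap.adjoint_inner_left,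
        ← hJ f (hmem f)]
      exact ContinuousLinearMap.adjoint_inner_left J ⟨S f, hmem f⟩ y

end Isometry

/-! ### The covariance operator of the field -/

namespace RandomField

open MetricGraph

section Covariance

variable {V E : Type*} [Fintype V] [Fintype E] {G : MetricGraph V E}
  {Ω : Type*} [mΩ : MeasurableSpace Ω] {μ : Measure Ω} {u : RandomField G μ}

theorem continuous_toL2_pt (hu : Continuous u.toL2) (e : E) :
    Continuous fun t => u.toL2 (G.pt e t) :=
  hu.comp (continuous_pt e)

theorem continuous_inner_pt (hu : Continuous u.toL2) (w : Lp ℝ 2 μ) (e : E) :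
    Continuous fun t => (inner ℝ w (u.toL2 (G.pt e t)) : ℝ) :=
  continuous_const.inner (continuous_toL2_pt hu e)

theorem exists_norm_toL2_le (hu : Continuous u.toL2) (e : E) :
    ∃ C, 0 ≤ C ∧ ∀ t ∈ Icc 0 (G.len e), ‖u.toL2 (G.pt e t)‖ ≤ C := by
  obtain ⟨C, hC⟩ := isCompact_Icc.exists_bound_of_continuousOn
    (continuous_toL2_pt hu e).continuousOn (s := Icc 0 (G.len e))
  exact ⟨C, (norm_nonneg _).trans (hC 0 (left_mem_Icc.2 (G.len_pos e).le)), hC⟩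

/-- The function `t ↦ E[w u_e(t)]` in `L₂(e)`, as a function of `w`. -/
def evalEdge (hu : Continuous u.toL2) (e : E) : Lp ℝ 2 μ →L[ℝ] LTwo (G.len e) :=
  LinearMap.mkContinuous
    { toFun := fun w => ((continuous_inner_pt hu w e).continuousOn.memLp_Icc).toLp _
      map_add' := fun v w => by
        rw [← MemLp.toLp_add]
        refine MemLp.toLp_congr _ _ (ae_of_all _ fun t => ?_)
        exact inner_add_left _ _ _
      map_smul' := fun c w => by
        rw [RingHom.id_apply, ← MemLp.toLp_const_smul]
        refine MemLp.toLp_congr _ _ (ae_of_all _ fun t => ?_)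
        exact real_inner_smul_left _ _ _ }
    ((measureUnivNNReal (volume.restrict (Icc (0 : ℝ) (G.len e))) : ℝ) ^ (2 : ℝ≥0∞).toReal⁻¹ *
      (exists_norm_toL2_le hu e).choose)
    (fun w => by
      obtain ⟨h0, hC⟩ := (exists_norm_toL2_le hu e).choose_spec
      rw [mul_assoc]
      refine Lp.norm_le_of_ae_bound (by positivity) ?_
      filter_upwards [MemLp.coeFn_toLp
        ((continuous_inner_pt hu w e).continuousOn.memLp_Icc (p := 2) (ℓ := G.len e)),
        ae_restrict_mem measurableSet_Icc] with t ht htI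
      refine (congrArg norm ht).trans_le ((norm_inner_le_norm _ _).trans ?_)
      rw [mul_comm]
      exact mul_le_mul_of_nonneg_right (hC t htI) (norm_nonneg _))

/-- The function `E[w u]` in `L₂(Γ)`, as a function of `w`. -/
def evalField (hu : Continuous u.toL2) : Lp ℝ 2 μ →L[ℝ] G.L2 :=
  (PiLp.continuousLinearEquiv 2 ℝ fun e => LTwo (G.len e)).symm.toContinuousLinearMap ∘L
    ContinuousLinearMap.pi fun e => evalEdge hu e

theorem coeFn_evalField (hu : Continuous u.toL2) (w : Lp ℝ 2 μ) (e : E) :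
    evalField hu w e =ᵐ[G.edgeMeasure e] fun t => inner ℝ w (u.toL2 (G.pt e t)) :=
  MemLp.coeFn_toLp ((continuous_inner_pt hu w e).continuousOn.memLp_Icc)

theorem eqOn_of_evalField (hu : Continuous u.toL2) {w : Lp ℝ 2 μ} {e : E} {h : ℝ → ℝ}
    (hh : ContinuousOn h (Icc 0 (G.len e))) (hw : evalField hu w e =ᵐ[G.edgeMeasure e] h) :
    EqOn (fun t => inner ℝ w (u.toL2 (G.pt e t))) h (Icc 0 (G.len e)) :=
  eqOn_Icc_of_ae_eq (G.len_pos e) (continuous_inner_pt hu w e).continuousOn hh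
    ((coeFn_evalField hu w e).symm.trans hw)

/-- The operator `f ↦ ∫ f u` from `L₂(Γ)` to `L₂(Ω)`. -/
def smear (hu : Continuous u.toL2) : G.L2 →L[ℝ] Lp ℝ 2 μ :=
  ContinuousLinearMap.adjoint (𝕜 := ℝ) (E := Lp ℝ 2 μ) (F := G.L2) (evalField hu)

theorem inner_smear (hu : Continuous u.toL2) (f : G.L2) (w : Lp ℝ 2 μ) :
    inner ℝ (smear hu f) w = inner ℝ f (evalField hu w) := by
  rw [smear]
  exact ContinuousLinearMap.adjoint_inner_left _ _ _

theorem adjoint_smear (hu : Continuous u.toL2) :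
    ContinuousLinearMap.adjoint (𝕜 := ℝ) (E := G.L2) (F := Lp ℝ 2 μ) (smear hu) = evalField hu := by
  rw [smear]
  exact ContinuousLinearMap.adjoint_adjoint _

theorem sum_integral_eq_smear (hu : Continuous u.toL2) (f : G.L2) :
    ∑ e, ∫ t in Icc 0 (G.len e), ((f e : ℝ → ℝ) t) • u.toL2 (G.pt e t) = smear hu f := by
  refine ext_inner_left ℝ fun w => ?_
  rw [inner_sum, real_inner_comm, inner_smear,
    L2.inner_eq_of_ae (fun _ => EventuallyEq.rfl) (coeFn_evalField hu w)]
  refine Finset.sum_congr rfl fun e _ => ?_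
  rw [← integral_inner]
  · refine integral_congr_ae (ae_of_all _ fun t => ?_)
    exact real_inner_smul_right _ _ _
  · obtain ⟨C, _, hC⟩ := exists_norm_toL2_le hu e
    refine (MemLp.integrableOn_Icc (L2.memLp f e)).smul_bdd C
      ((continuous_toL2_pt hu e).aestronglyMeasurable) ?_
    exact (ae_restrict_iff' measurableSet_Icc).2 (ae_of_all _ hC)

/-- Both spaces have the same orthogonal complement: E[w u] is continuous, so it vanishes everywhere
exactly when its integrals against all f ∈ L₂(Γ) vanish. -/
theorem gaussSpace_eq (hu : Continuous u.toL2) :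
    u.gaussSpace univ = (LinearMap.range (smear hu : G.L2 →ₗ[ℝ] Lp ℝ 2 μ)).topologicalClosure := by
  have key : ∀ w, (∀ s, (inner ℝ (u.toL2 s) w : ℝ) = 0) ↔
      ∀ f, (inner ℝ (smear hu f) w : ℝ) = 0 := by
    intro w
    constructor
    · intro h f
      rw [inner_smear, L2.inner_eq_of_ae (fun _ => EventuallyEq.rfl) (coeFn_evalField hu w)]
      refine Finset.sum_eq_zero fun e _ => ?_
      simp only [fun t => (real_inner_comm (u.toL2 (G.pt e t)) w).trans (h _), mul_zero,
        integral_zero]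
    · intro h s
      have h1 : evalField hu w = 0 := by
        rw [← inner_self_eq_zero (𝕜 := ℝ), ← inner_smear, h]
      obtain ⟨e, t, ht, rfl⟩ := exists_pt_eq s
      have h2 := eqOn_of_evalField hu (w := w) (e := e) (h := fun _ => 0) continuousOn_const (by
        rw [h1]
        exact Lp.coeFn_zero _ _ _) ht
      rw [real_inner_comm]
      exact h2
  have h1 : (u.gaussSpace univ)ᗮ =
      ((LinearMap.range (smear hu : G.L2 →ₗ[ℝ] Lp ℝ 2 μ)).topologicalClosure)ᗮ := by
    ext w
    rw [gaussSpace, Submodule.orthogonal_closure, Submodule.orthogonal_closure,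
      mem_orthogonal_span_iff, Submodule.mem_orthogonal]
    constructor
    · rintro h _ ⟨f, rfl⟩
      exact (key w).1 (fun s => h _ ⟨s, mem_univ s, rfl⟩) f
    · rintro h _ ⟨s, _, rfl⟩
      exact (key w).2 (fun f => h _ ⟨f, rfl⟩) s
  have hc1 : CompleteSpace (u.gaussSpace univ) :=
    (Submodule.isClosed_topologicalClosure _).completeSpace_coe
  have hc2 : CompleteSpace (LinearMap.range (smear hu : G.L2 →ₗ[ℝ] Lp ℝ 2 μ)).topologicalClosure :=
    (Submodule.isClosed_topologicalClosure _).completeSpace_coe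
  rw [← Submodule.orthogonal_orthogonal (u.gaussSpace univ), h1, Submodule.orthogonal_orthogonal]

/-- White noise as an isometry from `L₂(Γ)` to `L₂(Ω)`. -/
def noiseMap {W : G.L2 → Ω → ℝ} (hW : IsWhiteNoise G μ W) : G.L2 →ₗᵢ[ℝ] Lp ℝ 2 μ :=
  have hin : ∀ f g : G.L2, (inner ℝ ((hW.gaussian f).memLp_two.toLp (W f))
      ((hW.gaussian g).memLp_two.toLp (W g)) : ℝ) = inner ℝ f g := fun f g => by
    rw [L2.inner_def, ← hW.covariance f g]
    refine integral_congr_ae ?_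
    filter_upwards [(hW.gaussian f).memLp_two.coeFn_toLp, (hW.gaussian g).memLp_two.coeFn_toLp]
      with x h1 h2
    rw [h1, h2]
    exact mul_comm _ _
  LinearMap.isometryOfInner
    { toFun := fun f => (hW.gaussian f).memLp_two.toLp (W f)
      map_add' := fun f g => by
        -- Linearity is not assumed of white noise: the covariance shows that W(f + g) - W(f) - W(g)
        -- has norm zero.
        rw [← sub_eq_zero, ← inner_self_eq_zero (𝕜 := ℝ)]
        simp only [inner_sub_left, inner_sub_right, inner_add_left, inner_add_right, hin]
        ring
      map_smul' := fun c f => by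
        rw [RingHom.id_apply, ← sub_eq_zero, ← inner_self_eq_zero (𝕜 := ℝ)]
        simp only [inner_sub_left, inner_sub_right, real_inner_smul_left, real_inner_smul_right, hin]
        ring } hin

theorem coeFn_noiseMap {W : G.L2 → Ω → ℝ} (hW : IsWhiteNoise G μ W) (f : G.L2) :
    noiseMap hW f =ᵐ[μ] W f :=
  (hW.gaussian f).memLp_two.coeFn_toLp

variable {κ a : G.Point → ℝ} {p q : E → ℝ → ℝ} {α : ℕ} {W : G.L2 → Ω → ℝ}

/-- The defining equation is used only here, with φ = η, for which L^(α/2) η is a multiple of η. -/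
theorem IsWhittleMatern.smear_eigenvector (hu : u.IsWhittleMatern κ a α W)
    (hW : IsWhiteNoise G μ W) (hw : G.Weights p q) (hr : Represents κ a p q) {ν : ℝ} {η : G.L2}
    (hη : η ≠ 0) (h : greenOp hw η = ν • η) :
    smear hu.continuous η = (ν ^ ((α : ℝ) / 2)) • noiseMap hW η := by
  obtain ⟨U, -, hU1, hU2⟩ := hu.solution
  have hν := greenOp_eigenvalue_pos hw hη h
  have h1 := hU2 η _ (lpowGraph_eigenvector hw hr ((α : ℝ) / 2) hη h)
  have h2 := hU1 (ν ^ (-((α : ℝ) / 2)) • η)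
  rw [sum_integral_eq_smear hu.continuous, map_smul] at h2
  have h3 : ν ^ (-((α : ℝ) / 2)) • smear hu.continuous η = noiseMap hW η :=
    Lp.ext ((h2.symm.trans h1).trans (coeFn_noiseMap hW η).symm)
  rw [← h3, smul_smul, ← Real.rpow_add hν, add_neg_cancel, Real.rpow_zero, one_smul]

theorem inner_greenOp_pow (hw : G.Weights p q) (k : ℕ) (f g : G.L2) :
    inner ℝ ((greenOp hw ^ k) f) g = inner ℝ f ((greenOp hw ^ k) g) := by
  induction k generalizing f g with
  | zero => rfl
  | succ k ih =>
    have h1 : (greenOp hw ^ (k + 1)) f = (greenOp hw ^ k) (greenOp hw f) := by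
      rw [pow_succ]
      rfl
    have h2 : (greenOp hw ^ (k + 1)) g = greenOp hw ((greenOp hw ^ k) g) := by
      rw [pow_succ']
      rfl
    rw [h1, h2, ih]
    exact isSymmetric_greenOp hw f _

theorem greenOp_pow_eigenvector (hw : G.Weights p q) (k : ℕ) {ν : ℝ} {η : G.L2}
    (h : greenOp hw η = ν • η) : (greenOp hw ^ k) η = ν ^ k • η := by
  induction k with
  | zero => exact (one_smul _ _).symm
  | succ k ih =>
    have h2 : (greenOp hw ^ (k + 1)) η = greenOp hw ((greenOp hw ^ k) η) := by
      rw [pow_succ']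
      rfl
    rw [h2, ih, map_smul, h, smul_smul, ← pow_succ]

/-- The covariance operator is T^α. On eigenvectors this follows from the isometry of white noise,
since ν^(α/2) ν^(α/2) = ν^α; density extends it in one argument at a time. -/
theorem IsWhittleMatern.inner_smear_smear (hu : u.IsWhittleMatern κ a α W)
    (hW : IsWhiteNoise G μ W) (hw : G.Weights p q) (hr : Represents κ a p q) (f g : G.L2) :
    inner ℝ (smear hu.continuous f) (smear hu.continuous g) =
      inner ℝ ((greenOp hw ^ α) f) g := by
  have h1 : ∀ (ν : ℝ) (η : G.L2), η ≠ 0 → greenOp hw η = ν • η → ∀ f,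
      inner ℝ (smear hu.continuous η) (smear hu.continuous f) =
        inner ℝ ((greenOp hw ^ α) η) f := by
    intro ν η hη h f
    have h2 : innerSL ℝ (smear hu.continuous η) ∘L smear hu.continuous =
        innerSL ℝ ((greenOp hw ^ α) η) := by
      refine ext_eigenvectors hw fun ν' η' hη' h' => ?_
      change inner ℝ (smear hu.continuous η) (smear hu.continuous η') =
        inner ℝ ((greenOp hw ^ α) η) η'
      rw [hu.smear_eigenvector hW hw hr hη h, hu.smear_eigenvector hW hw hr hη' h',
        greenOp_pow_eigenvector hw α h, real_inner_smul_left, real_inner_smul_left,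
        real_inner_smul_right, LinearIsometry.inner_map_map]
      have hν := greenOp_eigenvalue_pos hw hη h
      by_cases hne : ν = ν'
      · rw [← hne, ← mul_assoc, ← Real.rpow_add hν, add_halves, Real.rpow_natCast]
      · rw [inner_eigenvector_eq_zero hw h h' hne, mul_zero, mul_zero, mul_zero]
    exact congrArg (fun S : G.L2 →L[ℝ] ℝ => S f) h2
  have h3 : innerSL ℝ (smear hu.continuous g) ∘L smear hu.continuous =
      innerSL ℝ g ∘L (greenOp hw ^ α) := by
    refine ext_eigenvectors hw fun ν η hη h => ?_
    change inner ℝ (smear hu.continuous g) (smear hu.continuous η) =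
      inner ℝ g ((greenOp hw ^ α) η)
    rw [real_inner_comm, h1 ν η hη h g, real_inner_comm]
  have h4 := congrArg (fun S : G.L2 →L[ℝ] ℝ => S f) h3
  change inner ℝ (smear hu.continuous g) (smear hu.continuous f) =
      inner ℝ g ((greenOp hw ^ α) f) at h4
  rw [real_inner_comm, h4, real_inner_comm]

/-- The range of white noise is closed, being the isometric image of a complete space, and consists
of centered Gaussian variables. It contains the smeared field on eigenvectors, hence on all of
L₂(Γ). -/
theorem IsWhittleMatern.isGaussSub (hu : u.IsWhittleMatern κ a α W)
    (hW : IsWhiteNoise G μ W) (hw : G.Weights p q) (hr : Represents κ a p q) :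
    IsGaussSub (u.gaussSpace univ) := by
  set N := LinearMap.range (noiseMap hW).toLinearMap with hN
  have hNc : IsComplete (N : Set (Lp ℝ 2 μ)) := by
    have : (N : Set (Lp ℝ 2 μ)) = noiseMap hW '' univ := by
      rw [image_univ]
      rfl
    rw [this, LinearIsometry.isComplete_image_iff]
    exact isComplete_univ
  have hcs : CompleteSpace N := hNc.completeSpace_coe
  have h1 : N.starProjection ∘L smear hu.continuous = smear hu.continuous := by
    refine ext_eigenvectors hw fun ν η hη h => ?_
    change N.starProjection (smear hu.continuous η) = smear hu.continuous η
    rw [Submodule.starProjection_eq_self_iff, hu.smear_eigenvector hW hw hr hη h]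
    exact N.smul_mem _ ⟨η, rfl⟩
  have h2 : u.gaussSpace univ ≤ N := by
    rw [gaussSpace_eq hu.continuous]
    refine Submodule.topologicalClosure_minimal _ ?_ hNc.isClosed
    rintro _ ⟨f, rfl⟩
    change smear hu.continuous f ∈ N
    rw [← Submodule.starProjection_eq_self_iff]
    exact congrArg (fun S : G.L2 →L[ℝ] Lp ℝ 2 μ => S f) h1
  intro x hx
  obtain ⟨f, rfl⟩ := h2 hx
  have h3 : W f =ᵐ[μ] ((noiseMap hW).toLinearMap f : Ω → ℝ) := (coeFn_noiseMap hW f).symm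
  exact ⟨(hW.gaussian f).congr h3, (integral_congr_ae h3).symm.trans (hW.centered f)⟩

/-- The functions `E[w u]` for `w` in the Gaussian space, in terms of a root of the covariance. -/
theorem IsWhittleMatern.exists_root (hu : u.IsWhittleMatern κ a α W)
    (hW : IsWhiteNoise G μ W) (hw : G.Weights p q) (hr : Represents κ a p q) {k r : ℕ}
    (hα : α = 2 * k + r) {Y : Type*} [NormedAddCommGroup Y]
    [InnerProductSpace ℝ Y] [CompleteSpace Y] {B : Y →L[ℝ] G.L2} {Rep : Y → (E → ℝ → ℝ) → Prop}
    (hB : IsRoot hw r B Rep) :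
    (∃ J : Lp ℝ 2 μ → Y, (∀ w ∈ u.gaussSpace univ,
        (greenOp hw ^ k) (B (J w)) = evalField hu.continuous w) ∧
      ∀ w ∈ u.gaussSpace univ, ∀ w' ∈ u.gaussSpace univ,
        (inner ℝ (J w) (J w') : ℝ) = inner ℝ w w') ∧
    ∀ y, ∃ w ∈ u.gaussSpace univ, ‖w‖ ≤ ‖y‖ ∧
      evalField hu.continuous w = (greenOp hw ^ k) (B y) := by
  -- With this choice R* R = T^k B B* T^k = T^α, the covariance operator.
  let R : G.L2 →L[ℝ] Y := ContinuousLinearMap.adjoint B ∘L (greenOp hw ^ k)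
  have hR : ∀ y, ContinuousLinearMap.adjoint R y = (greenOp hw ^ k) (B y) := fun y => by
    refine ext_inner_right ℝ fun f => ?_
    rw [ContinuousLinearMap.adjoint_inner_left, inner_greenOp_pow]
    exact ContinuousLinearMap.adjoint_inner_right B y _
  have hS : ∀ w, ContinuousLinearMap.adjoint (smear hu.continuous) w = evalField hu.continuous w :=
    fun w => congrArg (fun S : Lp ℝ 2 μ →L[ℝ] G.L2 => S w) (adjoint_smear hu.continuous)
  have h := exists_adjoint_eq_of_inner_eq (S := smear hu.continuous) (R := R) (fun f g => by
    rw [hu.inner_smear_smear hW hw hr]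
    have h1 : inner ℝ (R f) (R g) =
        inner ℝ (B (ContinuousLinearMap.adjoint B ((greenOp hw ^ k) f))) ((greenOp hw ^ k) g) :=
      ContinuousLinearMap.adjoint_inner_right B _ _
    rw [h1, hB.comp_adjoint, ← inner_greenOp_pow]
    have h2 : greenOp hw ^ α = greenOp hw ^ k * (greenOp hw ^ r * greenOp hw ^ k) := by
      rw [hα, ← pow_add, ← pow_add]
      congr 1
      ring
    rw [h2]
    rfl)
  rw [← gaussSpace_eq hu.continuous] at h
  simp only [hR, hS] at h
  exact h

end Covariance

end RandomField

end

noncomputable section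

/-! ### The reproducing kernel space of a Whittle--Matérn field -/

namespace RandomField

open MetricGraph

variable {V E : Type*} [Fintype V] [Fintype E] {G : MetricGraph V E}
  {Ω : Type*} [mΩ : MeasurableSpace Ω] {μ : Measure Ω} {u : RandomField G μ}

/-- The function `t ↦ E[w u_e(t)]`. -/
def pairing (u : RandomField G μ) (w : Lp ℝ 2 μ) (e : E) (t : ℝ) : ℝ :=
  inner ℝ w (u.toL2 (G.pt e t))

/-- The functions `E[w u]`, `w ∈ H(Γ)`, are of Sobolev order `n` on the edges, they may be modified
away from the vertices within this class, and the inner product of `H(Γ)` is local. -/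
structure LocalSobolev (u : RandomField G μ) (n : ℕ) : Prop where
  continuous : Continuous u.toL2
  pos : 1 ≤ n
  bddSob : ∀ w ∈ u.gaussSpace univ, ∀ e,
    BddSob (G.len e) 2 n (fun _ : Unit => u.pairing w e)
  exists_of_nearEnds : ∀ w ∈ u.gaussSpace univ, ∀ {ι : Type} (ψ : ι → E → ℝ → ℝ) (σ : ι → V → ℝ),
    (∀ e, BddSob (G.len e) 2 n (fun i => ψ i e)) →
    (∀ i, NearEnds G (σ i) (ψ i) (u.pairing w)) →
    ∃ z : ι → Lp ℝ 2 μ, (∀ i, z i ∈ u.gaussSpace univ) ∧ (∃ C, ∀ i, ‖z i‖ ≤ C) ∧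
      ∀ i e, EqOn (u.pairing (z i) e) (ψ i e) (Icc 0 (G.len e))
  inner_eq_zero : ∀ w ∈ u.gaussSpace univ, ∀ w' ∈ u.gaussSpace univ, ∀ O₁ O₂ : E → Set ℝ,
    (∀ e, IsOpen (O₁ e)) → (∀ e, IsOpen (O₂ e)) → (∀ e, Icc 0 (G.len e) ⊆ O₁ e ∪ O₂ e) →
    (∀ e, ∀ t ∈ Icc 0 (G.len e), t ∈ O₁ e → u.pairing w e t = 0) →
    (∀ e, ∀ t ∈ Icc 0 (G.len e), t ∈ O₂ e → u.pairing w' e t = 0) → (inner ℝ w w' : ℝ) = 0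

theorem continuousOn_of_bddSob_unit {ι : Type*} {ℓ : ℝ} {n : ℕ} (hℓ : 0 ≤ ℓ) (hn : 1 ≤ n)
    {F : ι → ℝ → ℝ} (h : BddSob ℓ 2 n F) (i : ι) : ContinuousOn (F i) (Icc 0 ℓ) := by
  obtain ⟨m, rfl⟩ : ∃ m, n = m + 1 := ⟨n - 1, by omega⟩
  obtain ⟨-, g, -, hg⟩ := h
  exact (hg i).continuousOn hℓ

variable {κ a : G.Point → ℝ} {α : ℕ} {W : G.L2 → Ω → ℝ} {p q : E → ℝ → ℝ}

/-- E[w u] = T^k B (J w) with J isometric. Elliptic regularity gives the order 2k + r, modified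
functions are mapped back through L^k and B, and locality of L^k transfers locality from the inner
product of Y. -/
theorem IsWhittleMatern.localSobolev_of_isRoot [IsProbabilityMeasure μ]
    (hu : u.IsWhittleMatern κ a α W)
    (hW : IsWhiteNoise G μ W) (hw : G.Weights p q) (hr : Represents κ a p q)
    (hc : CoeffReg G p q α) {k r : ℕ}
    (hα : α = 2 * k + r) (hα1 : 1 ≤ α) {Y : Type*} [NormedAddCommGroup Y]
    [InnerProductSpace ℝ Y] [CompleteSpace Y] {B : Y →L[ℝ] G.L2} {Rep : Y → (E → ℝ → ℝ) → Prop}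
    (hB : IsRoot hw r B Rep) : u.LocalSobolev α := by
  obtain ⟨⟨J, hJ, hJi⟩, hsurj⟩ := hu.exists_root hW hw hr hα hB
  have hle := fun e => (G.len_pos e).le
  have hrep : ∀ w ∈ u.gaussSpace univ, ∃ f h, Rep (J w) f ∧ PowL G p q k h f ∧
      (∀ e, BddSob (G.len e) 2 α (fun _ : Unit => h e)) ∧
      ∀ e, EqOn (u.pairing w e) (h e) (Icc 0 (G.len e)) := by
    intro w hwK
    obtain ⟨f, hf⟩ := hB.exists_rep (J w)
    obtain ⟨h, hp, hh⟩ := exists_powL hw k (hB.ae_eq hf)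
    have hb : ∀ e, BddSob (G.len e) 2 α (fun _ : Unit => h e) := fun e => by
      have := hp.bddSob hc e hα.ge (hB.bddSob hf e)
      rwa [← hα] at this
    refine ⟨f, h, hf, hp, hb, fun e => ?_⟩
    refine eqOn_of_evalField hu.continuous
      (continuousOn_of_bddSob_unit (hle e) hα1 (hb e) ()) ?_
    rw [← hJ w hwK]
    exact hh e
  refine ⟨hu.continuous, hα1, fun w hwK e => ?_, ?_, ?_⟩
  · obtain ⟨f, h, -, -, hb, he⟩ := hrep w hwK
    exact (hb e).congr fun _ => he e
  · intro w hwK ι ψ σ hψ hnear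
    obtain ⟨f, h, hf, hp, hb, he⟩ := hrep w hwK
    have hnear' : ∀ i, NearEnds G (σ i) (ψ i) h := fun i => by
      obtain ⟨δ, hδ, hn⟩ := hnear i
      refine ⟨δ, hδ, fun e => ⟨?_, ?_⟩⟩
      · filter_upwards [(hn e).1] with t h1 ht h2
        rw [h1 ht h2, he e ht]
      · filter_upwards [(hn e).2] with t h1 ht h2
        rw [h1 ht h2, he e ht]
    obtain ⟨g, hg, hpg, hng⟩ := hp.exists_of_nearEnds hw hc hα.ge
      (fun e => by rw [← hα]; exact hψ e) hnear'
    obtain ⟨y, hy, C, hC⟩ := hB.exists_of_nearEnds hf hg hng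
    choose z hzK hzn hz using fun i => hsurj (y i)
    refine ⟨z, hzK, ⟨C, fun i => (hzn i).trans (hC i)⟩, fun i e => ?_⟩
    refine eqOn_of_evalField hu.continuous
      (continuousOn_of_bddSob_unit (hle e) hα1 (hψ e) i) ?_
    rw [hz i]
    exact (hpg i).greenOp_pow_eq hw (hB.ae_eq (hy i)) e
  · intro w hwK w' hwK' O₁ O₂ h1 h2 h12 h0 h0'
    obtain ⟨f, h, hf, hp, -, he⟩ := hrep w hwK
    obtain ⟨f', h', hf', hp', -, he'⟩ := hrep w' hwK'
    rw [← hJi w hwK w' hwK']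
    -- Where E[w u] vanishes on an open set, so does its image f under L^k.
    refine hB.inner_eq_zero O₁ O₂ hf hf' h1 h2 h12 (fun e => ?_) fun e => ?_
    · exact hp.eq_zero_of_isOpen hw e (h1 e)
        (ae_of_all _ fun t ht htO => (he e ht).symm.trans (h0 e t ht htO))
    · exact hp'.eq_zero_of_isOpen hw e (h2 e)
        (ae_of_all _ fun t ht htO => (he' e ht).symm.trans (h0' e t ht htO))

theorem IsWhittleMatern.localSobolev [IsProbabilityMeasure μ] (hu : u.IsWhittleMatern κ a α W)
    (hW : IsWhiteNoise G μ W) (hw : G.Weights p q) (hr : Represents κ a p q)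
    (hc : CoeffReg G p q α) (hα1 : 1 ≤ α) : u.LocalSobolev α := by
  obtain ⟨k, hk | hk⟩ := Nat.even_or_odd' α
  · exact hu.localSobolev_of_isRoot hW hw hr hc (r := 0) hk hα1 (isRoot_id hw)
  · exact hu.localSobolev_of_isRoot hW hw hr hc (r := 1) hk hα1 (isRoot_energyEmb hw)

end RandomField

end

noncomputable section

/-! ### Weak limits in Hilbert spaces -/

section Hilbert

variable {H : Type*} [NormedAddCommGroup H] [InnerProductSpace ℝ H]

/-- A vector of `K` that is orthogonal to every vector of `K` orthogonal to `M` belongs to `M`. -/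
theorem Submodule.mem_of_orthogonal_inter {K M : Submodule ℝ H} [M.HasOrthogonalProjection]
    (hMK : M ≤ K) {x : H} (hx : x ∈ K)
    (h : ∀ w ∈ K, (∀ m ∈ M, (inner ℝ w m : ℝ) = 0) → (inner ℝ w x : ℝ) = 0) : x ∈ M := by
  set y := M.starProjection x
  have hy : y ∈ M := M.starProjection_apply_mem x
  have h1 : ∀ m ∈ M, (inner ℝ (x - y) m : ℝ) = 0 := fun m hm =>
    Submodule.starProjection_inner_eq_zero x m hm
  have h2 : (inner ℝ (x - y) (x - y) : ℝ) = 0 := by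
    rw [inner_sub_right, h1 y hy, sub_zero]
    exact h _ (K.sub_mem hx (hMK hy)) h1
  rw [sub_eq_zero.1 (inner_self_eq_zero.1 h2)]
  exact hy

/-- Banach–Steinhaus makes the pointwise limit of the functionals continuous, and Riesz represents
it in `K`. -/
theorem exists_inner_eq_of_tendsto {K : Submodule ℝ H} [CompleteSpace K] {α : Type*}
    {l : Filter α} [l.IsCountablyGenerated] [l.NeBot] {v : α → H} {c : H → ℝ}
    (h : ∀ w ∈ K, Tendsto (fun i => (inner ℝ w (v i) : ℝ)) l (𝓝 (c w))) :
    ∃ d ∈ K, ∀ w ∈ K, (inner ℝ w d : ℝ) = c w := by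
  let g : α → K →L[ℝ] ℝ := fun i => (innerSL ℝ (v i)).comp K.subtypeL
  have hg : Tendsto (fun i x => g i x) l (𝓝 fun x : K => c x) :=
    tendsto_pi_nhds.2 fun x => (h x x.2).congr fun i => real_inner_comm _ _
  let F : K →L[ℝ] ℝ := continuousLinearMapOfTendsto g hg
  let d := (InnerProductSpace.toDual ℝ K).symm F
  refine ⟨d, d.2, fun w hw => ?_⟩
  have h1 : (inner ℝ d (⟨w, hw⟩ : K) : ℝ) = F ⟨w, hw⟩ :=
    InnerProductSpace.toDual_symm_apply
  rw [real_inner_comm]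
  exact h1

/-- Weak compactness of balls: along an ultrafilter each bounded scalar sequence converges, and the
limit is a bounded functional. No subsequence or separability is needed. -/
theorem exists_tendsto_inner_of_bounded [CompleteSpace H] {z : ℕ → H} {C : ℝ}
    (hC : ∀ i, ‖z i‖ ≤ C) (l : Ultrafilter ℕ) :
    ∃ x : H, ∀ v, Tendsto (fun i => (inner ℝ (z i) v : ℝ)) l (𝓝 (inner ℝ x v)) := by
  have hb : ∀ i v, (inner ℝ (z i) v : ℝ) ∈ Icc (-(C * ‖v‖)) (C * ‖v‖) := fun i v =>
    abs_le.1 ((abs_real_inner_le_norm _ _).trans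
      (mul_le_mul_of_nonneg_right (hC i) (norm_nonneg v)))
  have hlim : ∀ v, ∃ c : ℝ, c ∈ Icc (-(C * ‖v‖)) (C * ‖v‖) ∧
      Tendsto (fun i => (inner ℝ (z i) v : ℝ)) l (𝓝 c) := fun v => by
    obtain ⟨c, hc, hl⟩ := (isCompact_Icc (a := -(C * ‖v‖)) (b := C * ‖v‖)).ultrafilter_le_nhds'
      (l.map fun i => (inner ℝ (z i) v : ℝ)) (Ultrafilter.mem_map.2 (univ_mem' fun i => hb i v))
    exact ⟨c, hc, hl⟩
  choose c hc hl using hlim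
  let F := linearMapOfTendsto c (fun i => ((innerSL ℝ (z i) : H →L[ℝ] ℝ) : H →ₗ[ℝ] ℝ))
    (l := (l : Filter ℕ)) (tendsto_pi_nhds.2 hl)
  let F' := F.mkContinuous C fun v => abs_le.2 (hc v)
  refine ⟨(InnerProductSpace.toDual ℝ H).symm F', fun v => ?_⟩
  rw [InnerProductSpace.toDual_symm_apply]
  exact hl v

end Hilbert

/-! ### Weak derivatives of the field -/

namespace RandomField

open MetricGraph

variable {V E : Type*} [Fintype V] [Fintype E] {G : MetricGraph V E}
  {Ω : Type*} [mΩ : MeasurableSpace Ω] {μ : Measure Ω} {u : RandomField G μ} {n : ℕ}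

theorem isClosed_gaussSpace (S : Set G.Point) :
    IsClosed (u.gaussSpace S : Set (Lp ℝ 2 μ)) :=
  Submodule.isClosed_topologicalClosure _

instance (S : Set G.Point) : CompleteSpace (u.gaussSpace S) :=
  (isClosed_gaussSpace S).completeSpace_coe

theorem gaussSpace_mono {S T : Set G.Point} (h : S ⊆ T) : u.gaussSpace S ≤ u.gaussSpace T :=
  Submodule.topologicalClosure_mono (Submodule.span_mono (image_mono h))

theorem toL2_mem_gaussSpace {S : Set G.Point} {s : G.Point} (hs : s ∈ S) :
    u.toL2 s ∈ u.gaussSpace S :=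
  Submodule.le_topologicalClosure _ (Submodule.subset_span ⟨s, hs, rfl⟩)

/-- A vector orthogonal to the values of the field on `S` is orthogonal to `H(S)`. -/
theorem inner_eq_zero_of_mem_gaussSpace {S : Set G.Point} {w x : Lp ℝ 2 μ}
    (h : ∀ s ∈ S, (inner ℝ w (u.toL2 s) : ℝ) = 0) (hx : x ∈ u.gaussSpace S) :
    (inner ℝ w x : ℝ) = 0 := by
  have h1 : w ∈ (u.gaussSpace S)ᗮ := by
    rw [gaussSpace, Submodule.orthogonal_closure, mem_orthogonal_span_iff]
    rintro _ ⟨s, hs, rfl⟩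
    rw [real_inner_comm]
    exact h s hs
  rw [real_inner_comm]
  exact h1 x hx

theorem LocalSobolev.contDiffOn (hu : u.LocalSobolev n) {w : Lp ℝ 2 μ}
    (hw : w ∈ u.gaussSpace univ) (e : E) :
    ContDiffOn ℝ (n - 1 : ℕ) (u.pairing w e) (Icc 0 (G.len e)) := by
  have h := hu.bddSob w hw e
  obtain ⟨m, rfl⟩ : ∃ m, n = m + 1 := ⟨n - 1, by have := hu.pos; omega⟩
  exact h.contDiffOn (G.len_pos e)

/-- Each E[w u_e] is C^(n-1) on the closed edge, so the difference quotients converge against every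
w ∈ H(Γ), and their weak limit lies in H(Γ). Derivatives at the ends are one-sided. -/
theorem LocalSobolev.inner_iterWeakDeriv (hu : u.LocalSobolev n) {k : ℕ} (hk : k < n) (e : E)
    {t : ℝ} (ht : t ∈ Icc 0 (G.len e)) :
    u.iterWeakDeriv e k t ∈ u.gaussSpace univ ∧ ∀ w ∈ u.gaussSpace univ,
      (inner ℝ w (u.iterWeakDeriv e k t) : ℝ) =
        iteratedDerivWithin k (u.pairing w e) (Icc 0 (G.len e)) t := by
  induction k generalizing t with
  | zero =>
    refine ⟨toL2_mem_gaussSpace (mem_univ _), fun w _ => ?_⟩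
    rw [iteratedDerivWithin_zero]
    rfl
  | succ k ih =>
    replace ih := fun t ht => @ih (by omega) t ht
    have hU := uniqueDiffOn_Icc (G.len_pos e)
    have hslope : ∀ w ∈ u.gaussSpace univ, Tendsto (fun t' => (inner ℝ w ((t' - t)⁻¹ •
        (u.iterWeakDeriv e k t' - u.iterWeakDeriv e k t)) : ℝ))
        (𝓝[Icc 0 (G.len e) \ {t}] t)
        (𝓝 (iteratedDerivWithin (k + 1) (u.pairing w e) (Icc 0 (G.len e)) t)) := by
      intro w hw
      have hd : DifferentiableOn ℝ (iteratedDerivWithin k (u.pairing w e) (Icc 0 (G.len e)))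
          (Icc 0 (G.len e)) :=
        (hu.contDiffOn hw e).differentiableOn_iteratedDerivWithin
          (by exact_mod_cast (by omega : k < n - 1)) hU
      have h1 := hasDerivWithinAt_iff_tendsto_slope.1 (hd t ht).hasDerivWithinAt
      rw [← iteratedDerivWithin_succ] at h1
      refine h1.congr' ?_
      filter_upwards [self_mem_nhdsWithin] with t' ht'
      rw [real_inner_smul_right, inner_sub_right, (ih t' ht'.1).2 w hw, (ih t ht).2 w hw]
      rfl
    have hne : (𝓝[Icc 0 (G.len e) \ {t}] t).NeBot := by
      have := (hU t ht).accPt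
      rwa [accPt_principal_iff_nhdsWithin] at this
    have hex : ∃ d, u.HasWeakDerivAt e (u.iterWeakDeriv e k) d t := by
      obtain ⟨d, hd, hdw⟩ := exists_inner_eq_of_tendsto hslope
      refine ⟨d, hd, fun w hw => ?_⟩
      rw [hdw w hw]
      exact hslope w hw
    -- The choice is harmless: inner products with the derivative are limits along a nontrivial
    -- filter, hence determined.
    have heq : u.iterWeakDeriv e (k + 1) t = hex.choose := dif_pos hex
    rw [heq]
    exact ⟨hex.choose_spec.1, fun w hw =>
      tendsto_nhds_unique (hex.choose_spec.2 w hw) (hslope w hw)⟩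

theorem LocalSobolev.hasWeakDerivAt (hu : u.LocalSobolev n) {k : ℕ} (hk : k + 1 < n) (e : E)
    {t : ℝ} (ht : t ∈ Icc 0 (G.len e)) :
    u.HasWeakDerivAt e (u.iterWeakDeriv e k) (u.iterWeakDeriv e (k + 1) t) t := by
  refine ⟨(hu.inner_iterWeakDeriv hk e ht).1, fun w hw => ?_⟩
  have hd : DifferentiableOn ℝ (iteratedDerivWithin k (u.pairing w e) (Icc 0 (G.len e)))
      (Icc 0 (G.len e)) :=
    (hu.contDiffOn hw e).differentiableOn_iteratedDerivWithin
      (by exact_mod_cast (by omega : k < n - 1)) (uniqueDiffOn_Icc (G.len_pos e))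
  have h1 := hasDerivWithinAt_iff_tendsto_slope.1 (hd t ht).hasDerivWithinAt
  rw [← iteratedDerivWithin_succ, ← (hu.inner_iterWeakDeriv hk e ht).2 w hw] at h1
  refine h1.congr' ?_
  filter_upwards [self_mem_nhdsWithin] with t' ht'
  rw [real_inner_smul_right, inner_sub_right,
    (hu.inner_iterWeakDeriv (by omega) e ht'.1).2 w hw,
    (hu.inner_iterWeakDeriv (by omega) e ht).2 w hw]
  rfl

theorem LocalSobolev.isDifferentiable (hu : u.LocalSobolev n) : u.IsDifferentiable (n - 1) := by
  refine ⟨hu.continuous, fun k hk e t ht => hu.hasWeakDerivAt (by omega) e ht,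
    fun k hk e w hw => ?_⟩
  have h1 := (hu.contDiffOn hw e).continuousOn_iteratedDerivWithin (m := k)
    (by exact_mod_cast hk) (uniqueDiffOn_Icc (G.len_pos e))
  exact h1.congr fun t ht =>
    (hu.inner_iterWeakDeriv (by have := hu.pos; omega) e ht).2 w hw

/-- If w ∈ H(Γ) is orthogonal to H(S), then E[w u_e] vanishes near t, and so do its derivatives at
t. -/
theorem LocalSobolev.iterWeakDeriv_mem (hu : u.LocalSobolev n) {k : ℕ} (hk : k < n) {e : E}
    {t : ℝ} (ht : t ∈ Icc 0 (G.len e)) {S : Set G.Point} (hS : S ∈ 𝓝 (G.pt e t)) :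
    u.iterWeakDeriv e k t ∈ u.gaussSpace S := by
  refine Submodule.mem_of_orthogonal_inter (gaussSpace_mono (subset_univ S))
    (hu.inner_iterWeakDeriv hk e ht).1 fun w hw h => ?_
  rw [(hu.inner_iterWeakDeriv hk e ht).2 w hw]
  have hz : ∀ t, G.pt e t ∈ S → u.pairing w e t = 0 := fun t ht => h _ (toL2_mem_gaussSpace ht)
  have h1 : u.pairing w e =ᶠ[𝓝[Icc 0 (G.len e)] t] fun _ => 0 := by
    filter_upwards [nhdsWithin_le_nhds ((continuous_pt e).continuousAt hS)] with t' ht'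
    exact hz t' ht'
  rw [h1.iteratedDerivWithin_eq (hz t (mem_of_mem_nhds hS))]
  simp

end RandomField

end

noncomputable section

/-! ### Cutting off along an open set -/

section Cutoff

/-- Near a point outside `Z`, the cutoff of `S` at a small scale is constant. -/
theorem eventually_notMem_thickening {S Z : Set ℝ} (hS : IsOpen S) (hZ : IsClosed Z)
    (hSZ : frontier S ⊆ Z) {x : ℝ} (hx : x ∉ Z) :
    ∀ᶠ ε in 𝓝[>] (0 : ℝ), ∀ t, |t - x| < ε → t ∉ Metric.thickening (3 * ε) Z ∧ (t ∈ S ↔ x ∈ S) := by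
  have hnb : ∀ᶠ t in 𝓝 x, t ∉ Z ∧ (t ∈ S ↔ x ∈ S) := by
    refine (hZ.isOpen_compl.eventually_mem hx).and ?_
    by_cases hxS : x ∈ S
    · exact (hS.eventually_mem hxS).mono fun t ht => iff_of_true ht hxS
    · have hxc : x ∈ (closure S)ᶜ := fun h => hx (hSZ (by
        rw [hS.frontier_eq]
        exact ⟨h, hxS⟩))
      exact (isClosed_closure.isOpen_compl.eventually_mem hxc).mono fun t ht =>
        iff_of_false (fun h => ht (subset_closure h)) hxS
  obtain ⟨r, hr, hball⟩ := Metric.eventually_nhds_iff.1 hnb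
  filter_upwards [Ioo_mem_nhdsGT (show (0 : ℝ) < r / 4 by positivity)] with ε hε t ht
  refine ⟨fun h => ?_, (hball (y := t) ?_).2⟩
  · obtain ⟨z, hz, hd⟩ := Metric.mem_thickening_iff.1 h
    refine (hball (y := z) ?_).1 hz
    calc dist z x ≤ dist t z + dist t x := by
          rw [dist_comm t z]
          exact dist_triangle _ _ _
      _ < 3 * ε + ε := add_lt_add hd ht
      _ < r := by linarith [hε.2]
  · exact lt_trans ht (by linarith [hε.1, hε.2])

end Cutoff

namespace RandomField

open MetricGraph

variable {V E : Type*} [Fintype V] [Fintype E] {G : MetricGraph V E}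
  {Ω : Type*} [mΩ : MeasurableSpace Ω] {μ : Measure Ω} {u : RandomField G μ} {n : ℕ}

/-- The functions of `H(Γ)` pairing to zero with the field on a neighbourhood of `A`. -/
def vanishingNear (u : RandomField G μ) (A : Set G.Point) : Set (Lp ℝ 2 μ) :=
  {z | z ∈ u.gaussSpace univ ∧ ∃ O : E → Set ℝ, (∀ e, IsOpen (O e)) ∧ (∀ e, G.pt e ⁻¹' A ⊆ O e) ∧
    ∀ e, ∀ t ∈ Icc 0 (G.len e), t ∈ O e → u.pairing z e t = 0}

theorem frontier_preimage_pt_subset {T Z : Set G.Point} (hTZ : frontier T ⊆ Z) (e : E) :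
    frontier (G.pt e ⁻¹' T) ⊆ G.pt e ⁻¹' Z :=
  ((continuous_pt e).frontier_preimage_subset T).trans (preimage_mono hTZ)

theorem clampStable_preimage_pt (Z : Set G.Point) (e : E) :
    ClampStable (G.len e) (G.pt e ⁻¹' Z) := by
  intro z hz
  have h := pt_projIcc (G := G) e z
  rw [mem_preimage] at hz ⊢
  rw [← h, coe_projIcc] at hz
  exact hz

/-- E[w u] is multiplied by cutoffs of T at scales tending to zero. Vanishing on `Z` bounds the
products in H^n. Near a vertex the cutoff is constant: zero if the vertex is in `Z`, and for small
scales the indicator of T otherwise, so the products stay in the kernel space. -/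
theorem LocalSobolev.exists_cutoff (hu : u.LocalSobolev n) {T Z : Set G.Point} (hT : IsOpen T)
    (hZ : IsClosed Z) (hTZ : frontier T ⊆ Z) (hdisj : Disjoint T Z) {w : Lp ℝ 2 μ}
    (hw : w ∈ u.gaussSpace univ) (hv : ∀ e, VanishSob (G.len e) (G.pt e ⁻¹' Z) n (u.pairing w e)) :
    ∃ z : ℕ → Lp ℝ 2 μ, (∀ i, z i ∈ u.vanishingNear Tᶜ) ∧ (∃ C, ∀ i, ‖z i‖ ≤ C) ∧
      ∀ s, (s ∈ T → Tendsto (fun i => (inner ℝ (z i) (u.toL2 s) : ℝ)) atTop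
        (𝓝 (inner ℝ w (u.toL2 s)))) ∧
      (s ∉ T → Tendsto (fun i => (inner ℝ (z i) (u.toL2 s) : ℝ)) atTop (𝓝 0)) := by
  classical
  obtain ⟨ρ, hρ, hρ1⟩ := exists_isKernel
  have hTe : ∀ e, IsOpen (G.pt e ⁻¹' T) := fun e => hT.preimage (continuous_pt e)
  have hZe : ∀ e, IsClosed (G.pt e ⁻¹' Z) := fun e => hZ.preimage (continuous_pt e)
  have hfr := fun e => frontier_preimage_pt_subset hTZ e
  -- One scale serves all ends outside `Z`, because there are finitely many edges.
  have hev : ∀ᶠ ε in 𝓝[>] (0 : ℝ), ∀ e, ∀ x : ℝ, x = 0 ∨ x = G.len e → x ∉ G.pt e ⁻¹' Z →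
      ∀ t, |t - x| < ε →
        t ∉ Metric.thickening (3 * ε) (G.pt e ⁻¹' Z) ∧ (t ∈ G.pt e ⁻¹' T ↔ x ∈ G.pt e ⁻¹' T) := by
    rw [eventually_all]
    intro e
    have h : ∀ x : ℝ, ∀ᶠ ε in 𝓝[>] (0 : ℝ), x ∉ G.pt e ⁻¹' Z → ∀ t, |t - x| < ε →
        t ∉ Metric.thickening (3 * ε) (G.pt e ⁻¹' Z) ∧
          (t ∈ G.pt e ⁻¹' T ↔ x ∈ G.pt e ⁻¹' T) := fun x => by
      by_cases hx : x ∈ G.pt e ⁻¹' Z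
      · exact Eventually.of_forall fun ε h => absurd hx h
      · exact (eventually_notMem_thickening (hTe e) (hZe e) (hfr e) hx).mono fun ε h _ => h
    filter_upwards [h 0, h (G.len e)] with ε h1 h2 x hx
    rcases hx with rfl | rfl
    · exact h1
    · exact h2
  obtain ⟨ε₀, hε₀, hsub⟩ := (mem_nhdsGT_iff_exists_Ioo_subset).1 hev
  have hε₀' : (0 : ℝ) < ε₀ := hε₀
  let ε : ℕ → {ε : ℝ // 0 < ε} := fun i => ⟨ε₀ / (i + 2), by positivity⟩
  have hεlt : ∀ i, (ε i : ℝ) < ε₀ := fun i =>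
    div_lt_self hε₀' (by linarith [(Nat.cast_nonneg i : (0 : ℝ) ≤ i)])
  have hεt : Tendsto (fun i => (ε i : ℝ)) atTop (𝓝[>] 0) := by
    refine tendsto_nhdsWithin_iff.2 ⟨?_, Eventually.of_forall fun i => (ε i).2⟩
    exact (tendsto_atTop_add_const_right _ _ tendsto_natCast_atTop_atTop).const_div_atTop ε₀
  have hεs : ∀ i, ∀ e, ∀ x : ℝ, x = 0 ∨ x = G.len e → x ∉ G.pt e ⁻¹' Z →
      ∀ t, |t - x| < ε i → t ∉ Metric.thickening (3 * (ε i : ℝ)) (G.pt e ⁻¹' Z) ∧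
        (t ∈ G.pt e ⁻¹' T ↔ x ∈ G.pt e ⁻¹' T) := fun i => hsub ⟨(ε i).2, hεlt i⟩
  let χ : ℕ → E → ℝ → ℝ := fun i e =>
    mollify (innerPart (G.pt e ⁻¹' T) (G.pt e ⁻¹' Z) (ε i)) (ε i) ρ
  have hχ0 : ∀ i e t, (t ∈ G.pt e ⁻¹' T → t ∈ Metric.thickening (ε i : ℝ) (G.pt e ⁻¹' Z)) →
      χ i e t = 0 := fun i e t ht => mollify_innerPart_eq_zero (hfr e) (ε i).2 hρ ht
  have hχ1 : ∀ i e t, t ∉ Metric.thickening (3 * (ε i : ℝ)) (G.pt e ⁻¹' Z) →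
      χ i e t = if t ∈ G.pt e ⁻¹' T then 1 else 0 := fun i e t ht => by
    have := mollify_innerPart_eq (hfr e) (ε i).2 hρ ht
    rw [hρ1, mul_one] at this
    exact this
  let σ : V → ℝ := fun v => if G.vertexPt v ∈ T then 1 else 0
  have hend : ∀ i e x, x = 0 ∨ x = G.len e → ∀ t, |t - x| < ε i →
      χ i e t = if G.pt e x ∈ T then 1 else 0 := by
    intro i e x hx t ht
    by_cases hxZ : x ∈ G.pt e ⁻¹' Z
    · rw [if_neg fun h => disjoint_left.1 hdisj h hxZ]
      exact hχ0 i e t fun _ => Metric.mem_thickening_iff.2 ⟨x, hxZ, ht⟩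
    · obtain ⟨h1, h2⟩ := hεs i e x hx hxZ t ht
      rw [hχ1 i e t h1]
      exact if_congr h2 rfl rfl
  have hnear : ∀ i, NearEnds G σ (fun e t => χ i e t * u.pairing w e t) (u.pairing w) := by
    refine fun i => ⟨ε i, (ε i).2, fun e => ⟨ae_of_all _ fun t ht ht' => ?_,
      ae_of_all _ fun t ht ht' => ?_⟩⟩
    · have h := hend i e 0 (Or.inl rfl) t (by
        rw [sub_zero, abs_of_nonneg ht.1]
        exact ht')
      rw [pt_zero] at h
      change χ i e t * _ = (if G.vertexPt (G.src e) ∈ T then 1 else 0) * _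
      rw [h]
    · have h := hend i e (G.len e) (Or.inr rfl) t (by
        rw [abs_sub_comm, abs_of_nonneg (sub_nonneg.2 ht.2)]
        have : G.len e - ε i < t := ht'
        linarith)
      rw [pt_len] at h
      change χ i e t * _ = (if G.vertexPt (G.tgt e) ∈ T then 1 else 0) * _
      rw [h]
  have hb : ∀ e, BddSob (G.len e) 2 n (fun i t => χ i e t * u.pairing w e t) := fun e => by
    have h := VanishSob.bddSob_cutoff (m := 0) (n := n) (G.len_pos e).le
      (clampStable_preimage_pt Z e) (hTe e) (hfr e) hρ (fun h => absurd rfl h)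
      (by rw [zero_add]; exact hv e)
    refine (h.comp ε).congr fun i t _ => ?_
    simp only [pow_zero, one_mul]
    rfl
  obtain ⟨z, hzK, hC, hz⟩ := hu.exists_of_nearEnds w hw
    (fun i e t => χ i e t * u.pairing w e t) (fun _ => σ) hb hnear
  refine ⟨z, fun i => ⟨hzK i, fun e => interior (G.pt e ⁻¹' Tᶜ) ∪
      Metric.thickening (ε i) (G.pt e ⁻¹' Z), fun e => ?_, fun e t ht => ?_,
      fun e t ht htO => ?_⟩, hC, fun s => ?_⟩
  · exact isOpen_interior.union Metric.isOpen_thickening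
  -- A point of the complement of T that is not in `Z` is not on the frontier of T, so it is
  -- interior to the complement.
  · by_cases htZ : t ∈ G.pt e ⁻¹' Z
    · exact Or.inr (Metric.self_subset_thickening (ε i).2 _ htZ)
    · refine Or.inl ?_
      rw [preimage_compl, interior_compl]
      intro hcl
      exact htZ (hfr e (by
        rw [(hTe e).frontier_eq]
        exact ⟨hcl, ht⟩))
  · rw [hz i e ht]
    refine mul_eq_zero_of_left (hχ0 i e t fun htT => ?_) _
    rcases htO with h | h
    · exact absurd htT (interior_subset h)
    · exact h
  · obtain ⟨e, t, ht, rfl⟩ := exists_pt_eq s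
    have hval : ∀ i, (inner ℝ (z i) (u.toL2 (G.pt e t)) : ℝ) = χ i e t * u.pairing w e t :=
      fun i => hz i e ht
    simp only [hval]
    by_cases htZ : G.pt e t ∈ Z
    · have htT : G.pt e t ∉ T := fun h => disjoint_left.1 hdisj h htZ
      refine ⟨fun h => absurd h htT, fun _ => ?_⟩
      refine tendsto_const_nhds.congr fun i => ?_
      rw [hχ0 i e t fun h => absurd h htT, zero_mul]
    · have hevt : ∀ᶠ i in atTop, χ i e t = if t ∈ G.pt e ⁻¹' T then 1 else 0 := by
        filter_upwards [hεt.eventually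
          (eventually_notMem_thickening (hTe e) (hZe e) (hfr e) htZ)] with i hi
        exact hχ1 i e t (hi t (by
          rw [sub_self, abs_zero]
          exact (ε i).2)).1
      constructor
      · intro h
        refine tendsto_const_nhds.congr' (hevt.mono fun i hi => ?_)
        dsimp only
        rw [hi, if_pos (show t ∈ G.pt e ⁻¹' T from h), one_mul]
        rfl
      · intro h
        refine tendsto_const_nhds.congr' (hevt.mono fun i hi => ?_)
        dsimp only
        rw [hi, if_neg (show t ∉ G.pt e ⁻¹' T from h), zero_mul]

theorem LocalSobolev.inner_vanishingNear (hu : u.LocalSobolev n) {A B : Set G.Point}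
    (hAB : A ∪ B = univ) {y z : Lp ℝ 2 μ} (hy : y ∈ u.vanishingNear A)
    (hz : z ∈ u.vanishingNear B) : (inner ℝ y z : ℝ) = 0 := by
  obtain ⟨hyK, O₁, h1, hO₁, h01⟩ := hy
  obtain ⟨hzK, O₂, h2, hO₂, h02⟩ := hz
  refine hu.inner_eq_zero y hyK z hzK O₁ O₂ h1 h2 (fun e t _ => ?_) h01 h02
  have : G.pt e t ∈ A ∪ B := hAB ▸ mem_univ _
  exact this.imp (fun h => hO₁ e h) fun h => hO₂ e h

/-- The function E[z u] is supported in a compact set disjoint from A. It therefore vanishes on some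
A_δ, so z is orthogonal to H(A_δ), which contains the germ space. -/
theorem inner_vanishingNear_germSpace {A : Set G.Point} (hA : IsClosed A) {z x : Lp ℝ 2 μ}
    (hz : z ∈ u.vanishingNear A) (hx : x ∈ u.germSpace A) : (inner ℝ z x : ℝ) = 0 := by
  obtain ⟨-, O, hO, hAO, h0⟩ := hz
  let C : Set G.Point := ⋃ e, G.pt e '' (Icc 0 (G.len e) \ O e)
  have hC : IsCompact C := isCompact_iUnion fun e =>
    (isCompact_Icc.diff (hO e)).image (continuous_pt e)
  have hCA : C ⊆ Aᶜ := by
    refine iUnion_subset fun e => ?_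
    rintro _ ⟨t, ht, rfl⟩ hA
    exact ht.2 (hAO e hA)
  obtain ⟨δ, hδ, hsub⟩ := hC.exists_thickening_subset_open hA.isOpen_compl hCA
  have hx' : x ∈ u.gaussSpace (Metric.thickening δ A) := by
    rw [germSpace, Submodule.mem_iInf] at hx
    exact (Submodule.mem_iInf _).1 (hx δ) hδ
  refine inner_eq_zero_of_mem_gaussSpace (fun s hs => ?_) hx'
  obtain ⟨e, t, ht, rfl⟩ := exists_pt_eq s
  refine h0 e t ht ?_
  by_contra htO
  obtain ⟨y, hy, hd⟩ := (Metric.mem_thickening_iff_exists_edist_lt _ _).1 hs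
  refine hsub ((Metric.mem_thickening_iff_exists_edist_lt _ _).2
    ⟨G.pt e t, mem_iUnion.2 ⟨e, t, ⟨ht, htO⟩, rfl⟩, ?_⟩) hy
  rwa [edist_comm]

/-- The restriction of the function `E[w u]` to `T` extended by zero belongs to the reproducing
kernel space, and is a limit of functions vanishing near the complement of `T`. -/
theorem LocalSobolev.exists_restriction (hu : u.LocalSobolev n) {T Z : Set G.Point} (hT : IsOpen T)
    (hZ : IsClosed Z) (hTZ : frontier T ⊆ Z) (hdisj : Disjoint T Z) {w : Lp ℝ 2 μ}
    (hw : w ∈ u.gaussSpace univ) (hv : ∀ e, VanishSob (G.len e) (G.pt e ⁻¹' Z) n (u.pairing w e)) :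
    ∃ x ∈ u.gaussSpace univ,
      (∀ s, (s ∈ T → (inner ℝ x (u.toL2 s) : ℝ) = inner ℝ w (u.toL2 s)) ∧
        (s ∉ T → (inner ℝ x (u.toL2 s) : ℝ) = 0)) ∧
      ∀ y, (∀ z ∈ u.vanishingNear Tᶜ, (inner ℝ z y : ℝ) = 0) → (inner ℝ x y : ℝ) = 0 := by
  obtain ⟨z, hz, ⟨C, hC⟩, hlim⟩ := hu.exists_cutoff hT hZ hTZ hdisj hw hv
  obtain ⟨x, hx⟩ := exists_tendsto_inner_of_bounded hC (hyperfilter ℕ)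
  have hle : ((hyperfilter ℕ : Ultrafilter ℕ) : Filter ℕ) ≤ atTop := Nat.hyperfilter_le_atTop
  have hperp : ∀ y, (∀ z ∈ u.vanishingNear Tᶜ, (inner ℝ z y : ℝ) = 0) →
      (inner ℝ x y : ℝ) = 0 := fun y hy =>
    tendsto_nhds_unique (hx y) (tendsto_const_nhds.congr fun i => (hy _ (hz i)).symm)
  refine ⟨x, ?_, fun s => ⟨fun hs => ?_, fun hs => ?_⟩, hperp⟩
  -- A weak limit of elements of the closed subspace H(Γ) stays in it.
  · rw [← Submodule.orthogonal_orthogonal (u.gaussSpace univ), Submodule.mem_orthogonal']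
    exact fun y hy => hperp y fun z hz => hy z hz.1
  · exact tendsto_nhds_unique (hx _) (((hlim s).1 hs).mono_left hle)
  · exact tendsto_nhds_unique (hx _) (((hlim s).2 hs).mono_left hle)

theorem LocalSobolev.vanishSob (hu : u.LocalSobolev n) {Z : Set G.Point} {w : Lp ℝ 2 μ}
    (hw : w ∈ u.gaussSpace univ) (h : ∀ d ∈ u.dataSpace n Z, (inner ℝ w d : ℝ) = 0) (e : E) :
    VanishSob (G.len e) (G.pt e ⁻¹' Z) n (u.pairing w e) := by
  refine VanishSob.of_iteratedDerivWithin (G.len_pos e) (hu.bddSob w hw e) fun k hk t ht htZ => ?_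
  rw [← (hu.inner_iterWeakDeriv hk e ht).2 w hw]
  exact h _ (Submodule.subset_span ⟨⟨(e, t, k), ht, htZ, hk⟩, rfl⟩)

theorem LocalSobolev.pairing_eq_zero (hu : u.LocalSobolev n) {Z : Set G.Point} {w : Lp ℝ 2 μ}
    (h : ∀ d ∈ u.dataSpace n Z, (inner ℝ w d : ℝ) = 0) {s : G.Point} (hs : s ∈ Z) :
    (inner ℝ w (u.toL2 s) : ℝ) = 0 := by
  obtain ⟨e, t, ht, rfl⟩ := exists_pt_eq s
  exact h _ (Submodule.subset_span ⟨⟨(e, t, 0), ht, hs, hu.pos⟩, rfl⟩)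

theorem ext_of_forall_inner_toL2 {x y : Lp ℝ 2 μ} (hx : x ∈ u.gaussSpace univ)
    (hy : y ∈ u.gaussSpace univ)
    (h : ∀ s, (inner ℝ x (u.toL2 s) : ℝ) = inner ℝ y (u.toL2 s)) : x = y := by
  rw [← sub_eq_zero, ← inner_self_eq_zero (𝕜 := ℝ)]
  refine inner_eq_zero_of_mem_gaussSpace (S := univ) (fun s _ => ?_) (Submodule.sub_mem _ hx hy)
  rw [inner_sub_left, h, sub_self]

theorem germSpace_le_gaussSpace (A : Set G.Point) : u.germSpace A ≤ u.gaussSpace univ :=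
  (iInf₂_le 1 one_pos).trans (gaussSpace_mono (subset_univ _))

/-- The boundary data decouple the two sides of an open set. -/
theorem LocalSobolev.inner_germSpace_eq_zero (hu : u.LocalSobolev n) {S : Set G.Point}
    (hS : IsOpen S) {x y : Lp ℝ 2 μ} (hx : x ∈ u.germSpace (closure S)) (hy : y ∈ u.germSpace Sᶜ)
    (hxd : ∀ d ∈ u.dataSpace n (frontier S), (inner ℝ x d : ℝ) = 0) : (inner ℝ x y : ℝ) = 0 := by
  have hxK := germSpace_le_gaussSpace _ hx
  have hv := hu.vanishSob hxK hxd
  have hfr : frontier (closure S)ᶜ ⊆ frontier S := by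
    rw [frontier_compl]
    exact frontier_closure_subset
  have hd1 : Disjoint S (frontier S) := by
    rw [hS.frontier_eq]
    exact disjoint_sdiff_self_right
  have hd2 : Disjoint (closure S)ᶜ (frontier S) :=
    disjoint_left.2 fun s hs h => hs (frontier_subset_closure h)
  obtain ⟨x₁, hx₁, hp₁, ho₁⟩ :=
    hu.exists_restriction hS isClosed_frontier Subset.rfl hd1 hxK hv
  obtain ⟨x₂, hx₂, hp₂, ho₂⟩ :=
    hu.exists_restriction isClosed_closure.isOpen_compl isClosed_frontier hfr hd2 hxK hv
  rw [compl_compl] at ho₂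
  -- On ∂S all three functions vanish: the data include the values of the field.
  have hsum : x = x₁ + x₂ := by
    refine ext_of_forall_inner_toL2 hxK (Submodule.add_mem _ hx₁ hx₂) fun s => ?_
    rw [inner_add_left]
    by_cases h1 : s ∈ S
    · rw [(hp₁ s).1 h1, (hp₂ s).2 fun h => h (subset_closure h1), add_zero]
    · rw [(hp₁ s).2 h1, zero_add]
      by_cases h2 : s ∈ closure S
      · rw [(hp₂ s).2 fun h => h h2]
        refine hu.pairing_eq_zero hxd ?_
        rw [hS.frontier_eq]
        exact ⟨h2, h1⟩
      · rw [(hp₂ s).1 h2]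
  -- Approximants of x₁ vanish near the complement of S and those of x₂ near closure S; these two
  -- sets cover Γ, so locality applies.
  have h21 : (inner ℝ x₂ x₁ : ℝ) = 0 := by
    refine ho₂ _ fun z hz => ?_
    rw [real_inner_comm]
    refine ho₁ _ fun z' hz' => hu.inner_vanishingNear ?_ hz' hz
    exact eq_univ_of_forall fun s => (em (s ∈ S)).elim (fun h => Or.inr (subset_closure h)) Or.inl
  have h2x : (inner ℝ x₂ x : ℝ) = 0 :=
    ho₂ _ fun z hz => inner_vanishingNear_germSpace isClosed_closure hz hx
  -- From x₂ ⟂ x and x₂ ⟂ x₁ it follows that x₂ is orthogonal to itself.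
  have h20 : x₂ = 0 := by
    rw [← inner_self_eq_zero (𝕜 := ℝ)]
    rwa [hsum, inner_add_right, h21, zero_add] at h2x
  rw [hsum, h20, add_zero]
  exact ho₁ _ fun z hz => inner_vanishingNear_germSpace hS.isClosed_compl hz hy

end RandomField

end

noncomputable section

/-! ### Germ spaces and the Markov property -/

namespace RandomField

open MetricGraph

variable {V E : Type*} [Fintype V] [Fintype E] {G : MetricGraph V E}
  {Ω : Type*} [mΩ : MeasurableSpace Ω] {μ : Measure Ω} {u : RandomField G μ} {n : ℕ}

theorem isClosed_germSpace (A : Set G.Point) : IsClosed (u.germSpace A : Set (Lp ℝ 2 μ)) := by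
  simp only [germSpace, Submodule.coe_iInf]
  exact isClosed_iInter fun ε => isClosed_iInter fun _ => isClosed_gaussSpace _

instance (A : Set G.Point) : CompleteSpace (u.germSpace A) :=
  (isClosed_germSpace A).completeSpace_coe

theorem mem_germSpace {A : Set G.Point} {x : Lp ℝ 2 μ} :
    x ∈ u.germSpace A ↔ ∀ ε : ℝ, 0 < ε → x ∈ u.gaussSpace (Metric.thickening ε A) := by
  simp only [germSpace, Submodule.mem_iInf]

theorem germSpace_mono {A B : Set G.Point} (h : A ⊆ B) : u.germSpace A ≤ u.germSpace B :=
  fun _ hx => mem_germSpace.2 fun ε hε =>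
    gaussSpace_mono (Metric.thickening_subset_of_subset ε h) (mem_germSpace.1 hx ε hε)

theorem sigmaAlg_eq_sigmaSub [μ.IsComplete] (S : Set G.Point) :
    u.sigmaAlg S = sigmaSub (u.gaussSpace S) := by
  have h := sigmaGen_eq_sigmaSub (μ := μ) (X := fun s : S => u.val s)
    (x := fun s : S => u.toL2 s) fun s => (MemLp.coeFn_toLp (u.memLp s)).symm
  have hr : range (fun s : S => u.toL2 s) = u.toL2 '' S := by
    rw [image_eq_range]
  rwa [hr] at h

theorem dataSigmaAlg_eq_sigmaSub [μ.IsComplete] (B : Set G.Point) :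
    u.dataSigmaAlg n B = sigmaSub (u.dataSpace n B).topologicalClosure :=
  sigmaGen_eq_sigmaSub fun _ => EventuallyEq.rfl

/-- The germ σ-algebra lies in every σ(F_k), so it is independent of σ(N_k), where N_k is the
orthogonal complement of F_k in H(Γ), and hence of their supremum, which contains the σ-algebra of
the complement of H₊(A) in H(Γ). A σ-algebra between σ(H₊(A)) and σ(H(Γ)) with this independence is
σ(H₊(A)). -/
theorem germSigmaAlg_eq_sigmaSub [IsProbabilityMeasure μ] [μ.IsComplete]
    (hu : IsGaussSub (u.gaussSpace univ)) (A : Set G.Point) :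
    u.germSigmaAlg A = sigmaSub (u.germSpace A) := by
  let ε : ℕ → ℝ := fun k => 1 / ((k : ℝ) + 1)
  have hε : ∀ k, 0 < ε k := fun k => Nat.one_div_pos_of_nat
  let F : ℕ → Submodule ℝ (Lp ℝ 2 μ) := fun k => u.gaussSpace (Metric.thickening (ε k) A)
  let N : ℕ → Submodule ℝ (Lp ℝ 2 μ) := fun k => (F k)ᗮ ⊓ u.gaussSpace univ
  have hF : Antitone F := fun i j hij =>
    gaussSpace_mono (Metric.thickening_mono (Nat.one_div_le_one_div hij) A)
  have hN : Monotone N := fun i j hij =>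
    inf_le_inf_right _ (Submodule.orthogonal_le (hF hij))
  have hFK : ∀ k, F k ≤ u.gaussSpace univ := fun k => gaussSpace_mono (subset_univ _)
  have hle : ∀ k, u.germSigmaAlg A ≤ sigmaSub (F k) := fun k => by
    refine (iInf₂_le (ε k) (hε k)).trans ?_
    rw [sigmaAlg_eq_sigmaSub]
  have hA : u.germSigmaAlg A ≤ mΩ := (hle 0).trans (sigmaSub_le _)
  have hind : Indep (⨆ k, sigmaSub (N k)) (u.germSigmaAlg A) μ := by
    refine indep_iSup_of_directed_le (fun k => ?_) (fun k => sigmaSub_le _) hA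
      (Monotone.directed_le fun i j hij => sigmaSub_mono (hN hij))
    exact indep_of_indep_of_le_right (hu.indep inf_le_right (hFK k) fun x hx y hy => by
      rw [real_inner_comm]
      exact hx.1 y hy) (hle k)
  refine eq_sigmaSub_of_indep (K := u.gaussSpace univ)
    (N := (u.germSpace A)ᗮ ⊓ u.gaussSpace univ) ?_ ?_ ?_ ?_
  · exact (Submodule.sup_orthogonal_inf_of_hasOrthogonalProjection (germSpace_le_gaussSpace A)).ge
  · refine le_iInf₂ fun ε hε => ?_
    rw [sigmaAlg_eq_sigmaSub]
    exact sigmaSub_mono fun x hx => mem_germSpace.1 hx ε hε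
  · exact (hle 0).trans (sigmaSub_mono (hFK 0))
  · refine indep_of_indep_of_le_right hind.symm ?_
    have hnull : ∀ B, μ B = 0 → MeasurableSet[⨆ k, sigmaSub (N k)] B := fun B hB =>
      (le_iSup (fun k => sigmaSub (N k)) 0) _ (measurableSet_sigmaGen_of_null _ hB)
    refine sigmaGen_le hnull fun x => ?_
    refine measurable_coe_of_mem_closure_span (s := ⋃ k, (N k : Set (Lp ℝ 2 μ)))
      (iSup_le fun k => sigmaSub_le _) hnull (fun y hy => ?_) ?_
    · obtain ⟨k, hk⟩ := mem_iUnion.1 hy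
      exact (measurable_sigmaGen (fun x : ↥(N k) => ((x : Lp ℝ 2 μ) : Ω → ℝ)) ⟨y, hk⟩).mono
        (le_iSup (fun k => sigmaSub (N k)) k) le_rfl
    · have hPK : (Submodule.span ℝ (⋃ k, (N k : Set (Lp ℝ 2 μ)))).topologicalClosure ≤
          u.gaussSpace univ :=
        Submodule.topologicalClosure_minimal _
          (Submodule.span_le.2 (iUnion_subset fun k y hy => hy.2)) (isClosed_gaussSpace _)
      have : CompleteSpace
          (Submodule.span ℝ (⋃ k, (N k : Set (Lp ℝ 2 μ)))).topologicalClosure :=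
        (Submodule.isClosed_topologicalClosure _).completeSpace_coe
      -- The N_k span the complement densely: w ∈ H(Γ) orthogonal to all of them lies in every F_k,
      -- hence in H₊(A), and so is orthogonal to x.
      refine Submodule.mem_of_orthogonal_inter hPK x.2.2 fun w hw hwP => ?_
      refine x.2.1 w (mem_germSpace.2 fun δ hδ => ?_)
      obtain ⟨k, hk⟩ := exists_nat_one_div_lt hδ
      have hwF : w ∈ F k := Submodule.mem_of_orthogonal_inter (hFK k) hw fun y hy hyF => by
        rw [real_inner_comm]
        refine hwP y (Submodule.le_topologicalClosure _ (Submodule.subset_span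
          (mem_iUnion.2 ⟨k, ?_, hy⟩)))
        rw [SetLike.mem_coe, Submodule.mem_orthogonal']
        exact hyF
      exact gaussSpace_mono (Metric.thickening_mono hk.le A) hwF

theorem LocalSobolev.dataSpace_le_germSpace (hu : u.LocalSobolev n) (B : Set G.Point) :
    u.dataSpace n B ≤ u.germSpace B := by
  refine Submodule.span_le.2 ?_
  rintro _ ⟨⟨⟨e, t, k⟩, ht, htB, hk⟩, rfl⟩
  exact mem_germSpace.2 fun ε hε => hu.iterWeakDeriv_mem hk ht
    (Metric.isOpen_thickening.mem_nhds (Metric.self_subset_thickening hε _ htB))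

/-- ∂S lies in closure S and in the complement of S, so an element of H₊(∂S) orthogonal to the data
is orthogonal to all of H₊(∂S). -/
theorem LocalSobolev.germSpace_frontier (hu : u.LocalSobolev n) {S : Set G.Point} (hS : IsOpen S) :
    u.germSpace (frontier S) = (u.dataSpace n (frontier S)).topologicalClosure := by
  have hle : (u.dataSpace n (frontier S)).topologicalClosure ≤ u.germSpace (frontier S) :=
    Submodule.topologicalClosure_minimal _ (hu.dataSpace_le_germSpace _) (isClosed_germSpace _)
  have : CompleteSpace (u.dataSpace n (frontier S)).topologicalClosure :=
    (Submodule.isClosed_topologicalClosure _).completeSpace_coe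
  refine le_antisymm (fun x hx => ?_) hle
  refine Submodule.mem_of_orthogonal_inter hle hx fun w hw h => ?_
  refine hu.inner_germSpace_eq_zero hS (germSpace_mono frontier_subset_closure hw)
    (germSpace_mono (fun s hs => ?_) hx) fun d hd => h d (Submodule.le_topologicalClosure _ hd)
  rw [hS.frontier_eq] at hs
  exact hs.2

/-- A point has finitely many positions: on each edge only the two ends can be identified with other
positions. -/
theorem finite_dataIndex {B : Set G.Point} (hB : B.Finite) : Finite (DataIndex G n B) := by
  have hfib : ∀ e s, {t | t ∈ Icc 0 (G.len e) ∧ G.pt e t = s}.Finite := fun e s => by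
    rcases eq_empty_or_nonempty {t | t ∈ Icc 0 (G.len e) ∧ G.pt e t = s} with h | ⟨t₀, ht₀, rfl⟩
    · rw [h]
      exact finite_empty
    · refine (toFinite {0, G.len e, t₀}).subset ?_
      rintro t ⟨ht, h⟩
      rw [pt, pt, projIcc_of_mem _ ht, projIcc_of_mem _ ht₀] at h
      rcases Quotient.exact h with h | ⟨v, h | h, -⟩
      · have h1 := eq_of_heq (Sigma.mk.inj_iff.1 h).2
        exact Or.inr (Or.inr (congrArg Subtype.val h1))
      · exact Or.inl h.1
      · exact Or.inr (Or.inl h.1)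
  have hT : ∀ e, {t | t ∈ Icc 0 (G.len e) ∧ G.pt e t ∈ B}.Finite := fun e =>
    (hB.biUnion fun s _ => hfib e s).subset fun t ht => mem_biUnion ht.2 ⟨ht.1, rfl⟩
  have hU : (⋃ e, {t | t ∈ Icc 0 (G.len e) ∧ G.pt e t ∈ B}).Finite := finite_iUnion hT
  refine (finite_univ.prod (hU.prod (finite_Iio n))).subset ?_ |>.to_subtype
  rintro ⟨e, t, k⟩ ⟨ht, htB, hk⟩
  exact ⟨mem_univ _, mem_iUnion.2 ⟨e, ht, htB⟩, hk⟩

theorem topologicalClosure_dataSpace {B : Set G.Point} (hB : B.Finite) :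
    (u.dataSpace n B).topologicalClosure = u.dataSpace n B := by
  have := finite_dataIndex (n := n) hB
  have : FiniteDimensional ℝ (u.dataSpace n B) :=
    FiniteDimensional.span_of_finite ℝ (finite_range _)
  exact (Submodule.closed_of_finiteDimensional _).submodule_topologicalClosure_eq

/-- Split H₊(Γ \ S) into the closed data space M and its orthogonal part N. Subtracting from x ∈
H₊(closure S) its projection to M leaves a vector orthogonal to H₊(Γ \ S), so x ⟂ N. Gaussianity
turns this into independence and `splits_of_indep` applies. -/
theorem LocalSobolev.isMarkovOfOrder [IsProbabilityMeasure μ] [μ.IsComplete]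
    (hu : u.LocalSobolev n) (hg : IsGaussSub (u.gaussSpace univ)) : u.IsMarkovOfOrder n := by
  refine ⟨hu.isDifferentiable, fun S hS => ?_⟩
  set M := (u.dataSpace n (frontier S)).topologicalClosure
  have : CompleteSpace M := (Submodule.isClosed_topologicalClosure _).completeSpace_coe
  have hM : M = u.germSpace (frontier S) := (hu.germSpace_frontier hS).symm
  have hMA : M ≤ u.germSpace (closure S) := by
    rw [hM]
    exact germSpace_mono frontier_subset_closure
  have hMB : M ≤ u.germSpace Sᶜ := by
    rw [hM]
    refine germSpace_mono fun s hs => ?_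
    rw [hS.frontier_eq] at hs
    exact hs.2
  rw [dataSigmaAlg_eq_sigmaSub, germSigmaAlg_eq_sigmaSub hg, germSigmaAlg_eq_sigmaSub hg]
  refine splits_of_indep (N := sigmaSub (Mᗮ ⊓ u.germSpace Sᶜ)) (sigmaSub_mono hMA)
    (sigmaSub_le _) (sigmaSub_le _) ?_
    (sigmaSub_sup_ge (Submodule.sup_orthogonal_inf_of_hasOrthogonalProjection hMB).ge)
  refine hg.indep (germSpace_le_gaussSpace _) (inf_le_right.trans (germSpace_le_gaussSpace _))
    fun x hx y hy => ?_
  have hPx : M.starProjection x ∈ M := M.starProjection_apply_mem x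
  have h1 : (inner ℝ (x - M.starProjection x) y : ℝ) = 0 :=
    hu.inner_germSpace_eq_zero hS (Submodule.sub_mem _ hx (hMA hPx)) hy.2 fun d hd =>
      Submodule.starProjection_inner_eq_zero x d (Submodule.le_topologicalClosure _ hd)
  rw [inner_sub_left, hy.1 _ hPx, sub_zero] at h1
  exact h1

end RandomField

theorem mainTheorem2 {V E : Type*} [Fintype V] [Fintype E] (G : MetricGraph V E)
    {Ω : Type*} [MeasurableSpace Ω] (μ : Measure Ω) [IsProbabilityMeasure μ] [μ.IsComplete]
    (κ a : G.Point → ℝ) (α : ℕ) (hα : 1 ≤ α) (hcoeff : G.CoeffAssumption κ a α)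
    (W : G.L2 → Ω → ℝ) (hW : IsWhiteNoise G μ W)
    (u : RandomField G μ) (hu : u.IsWhittleMatern κ a α W) :
    (∀ S : Set G.Point, IsOpen S → (frontier S).Finite →
      u.germSpace (frontier S) = u.dataSpace α (frontier S) ∧
      u.germSigmaAlg (frontier S) = u.dataSigmaAlg α (frontier S)) ∧
    u.IsMarkovOfOrder α := by
  obtain ⟨p, q, hw, hc, hr⟩ := hcoeff.exists_weights
  have hloc := hu.localSobolev hW hw hr hc hα
  have hg := hu.isGaussSub hW hw hr
  refine ⟨fun S hS hfin => ?_, hloc.isMarkovOfOrder hg⟩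
  have h := hloc.germSpace_frontier hS
  refine ⟨h.trans (RandomField.topologicalClosure_dataSpace hfin), ?_⟩
  rw [RandomField.germSigmaAlg_eq_sigmaSub hg, h, RandomField.dataSigmaAlg_eq_sigmaSub]

end
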